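/- Write $q=e^{2\pi i\tau}$ and $\tau=u+iv$ with $\tau$ in the upper half-plane $\mathbb{H}$. For $a,b\in\mathbb{C}$ put \[ \theta(z;\tau)=\sum_{\nu\in\frac12+\mathbb{Z}}e^{\pi i\nu^2\tau+2\pi i\nu(z+\frac12)},\qquad \mu(a,b;\tau)=\frac{e^{\pi i a}}{\theta(b;\tau)}\sum_{n\in\mathbb{Z}}\frac{(-1)^ne^{\pi i(n^2+n)\tau+2\pi i nb}}{1-e^{2\pi i n\tau+2\pi i a}}, \] \[ R(a;\tau)=\sum_{\nu\in\frac12+\mathbb{Z}}\Big(\operatorname{sgn}(\nu)-E\big((\nu+\tfrac{\operatorname{Im}(a)}{v})\sqrt{2v}\big)\Big)(-1)^{\nu-\frac12}e^{-\pi i\nu^2\tau-2\pi i a\nu}, \] where $E(z)=\operatorname{sgn}(z)(1-\beta(z^2))$ and $\beta(x)=\int_x^\infty s^{-1/2}e^{-\pi s}\,ds$, and let $\widetilde\mu(a,b;\tau)=\mu(a,b;\tau)+\frac i2R(a-b;\tau)$ be Zwegers' completed $\mu$-function. A multiplier system of weight $r\in\mathbb{R}$ on a subgroup $\Gamma\subseteq\mathrm{SL}_2(\mathbb{Z})$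 is a map $\nu:\Gamma\to\{z\in\mathbb{C}:|z|=1\}$ with $\nu(M\gamma)j(M\gamma,\tau)^r=\nu(M)j(M,\gamma\tau)^r\nu(\gamma)j(\gamma,\tau)^r$ for all $M,\gamma\in\Gamma$ and $\tau\in\mathbb{H}$, where $j(\gamma,\tau)=c\tau+d$ for $\gamma=\left(\begin{smallmatrix}a&b\\c&d\end{smallmatrix}\right)$ and powers are principal. Let $\xi_r f=2iv^r\,\overline{\partial f/\partial\overline\tau}$. A harmonic Maass form of weight $r$ and multiplier system $\nu$ on $\Gamma$ is a smooth function $f:\mathbb{H}\to\mathbb{C}$ such that (1) $\Delta_rf=-\xi_{2-r}(\xi_rf)=0$; (2) $\nu(\gamma)^{-1}j(\gamma,\tau)^{-r}f(\gamma\tau)=f(\tau)$ for all $\gamma\in\Gamma$; (3) $f$ has at most linear exponential growth at every cusp: for every $\gamma\in\mathrm{SL}_2(\mathbb{Z})$ the function $f_\gamma(\tau)=j(\gamma,\tau)^{-r}f(\gamma\tau)$ is $O(e^{Cv})$ for some $C$ as $v\to\infty$, uniformly in $u$, and it has a Fourier expansion $\sum_{n\in\mathbb{Z}}c(v;n)e^{2\pi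 i(n+\kappa)\tau/w}$, with some $w\in\mathbb{N}$ and $\kappa\in\mathbb{R}$, of which only finitely many terms are unbounded as $v\to\infty$. Theorem. Let $h,t,N\in\mathbb{N}$ with $t\mid 2N$ and $h\not\equiv\frac Nt\pmod{\frac{2N}t}$, i.e. $\frac{ht-N}{2N}\notin\mathbb{Z}$. Then \[ \mathcal{F}_{h,t,N}(\tau)=-e^{-2\pi i\left(h-\frac Nt\right)^2\tau}\,\widetilde\mu\left(\frac{ht-N}{2N}\cdot\frac{8N^2\tau}{t^2},-\frac12;\frac{8N^2\tau}{t^2}\right) \] is a harmonic Maass form of weight $\frac12$ on $\Gamma_1(4N/t)\cap\Gamma_0(16N^2/t^2)$ for some multiplier system. Moreover, \[ \xi_{\frac12}\left(\mathcal{F}_{h,t,N}\right)(\tau)=\sum_{\substack{r\in\mathbb{Z}\\ r\equiv h\ (\mathrm{mod}\ 2N/t)}}r\,q^{r^2}=\vartheta_{h,t,N}\left(\frac{\tau}{t}\right), \] where $\vartheta_{h,t,N}(\tau)=\sum_{r\equiv h\ (\mathrm{mod}\ 2N/t)}r\,q^{tr^2}$ is the unary theta function. -/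

import Mathlib

open scoped UpperHalfPlane MatrixGroups ContDiff

noncomputable section

namespace HarmonicMaass

/-- The Wirtinger derivative `∂f/∂τ̄ = (∂f/∂u + i ∂f/∂v) / 2` of a function on the upper
half-plane, at `τ = u + iv`. -/
def dbar (f : ℍ → ℂ) (τ : ℍ) : ℂ :=
  (fderiv ℝ (fun z : ℂ => f (UpperHalfPlane.ofComplex z)) (τ : ℂ) 1
    + Complex.I * fderiv ℝ (fun z : ℂ => f (UpperHalfPlane.ofComplex z)) (τ : ℂ) Complex.I) / 2

/-- The operator `ξ_r = 2 i v ^ r * conj (∂/∂τ̄)`. -/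
def xi (r : ℝ) (f : ℍ → ℂ) (τ : ℍ) : ℂ :=
  2 * Complex.I * ((τ.im ^ r : ℝ) : ℂ) * (starRingEnd ℂ) (dbar f τ)

/-- The weight `r` hyperbolic Laplacian `Δ_r = - ξ_{2-r} ∘ ξ_r`. -/
def laplacian (r : ℝ) (f : ℍ → ℂ) (τ : ℍ) : ℂ :=
  - xi (2 - r) (xi r f) τ

/-- The automorphy factor `j(γ, τ) = c τ + d`. -/
def autFactor (γ : SL(2, ℤ)) (τ : ℍ) : ℂ :=
  ((γ 1 0 : ℤ) : ℂ) * (τ : ℂ) + ((γ 1 1 : ℤ) : ℂ)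

/-- A (unitary) multiplier system of weight `r` on `Γ`; powers are principal. -/
structure IsMultiplierSystem (r : ℝ) (Γ : Subgroup SL(2, ℤ)) (ν : Γ → ℂ) : Prop where
  norm_eq_one : ∀ γ : Γ, ‖ν γ‖ = 1
  cocycle : ∀ (M γ : Γ) (τ : ℍ),
    ν (M * γ) * autFactor ((M : SL(2, ℤ)) * (γ : SL(2, ℤ))) τ ^ (r : ℂ) =
      ν M * autFactor (M : SL(2, ℤ)) ((γ : SL(2, ℤ)) • τ) ^ (r : ℂ) *
        (ν γ * autFactor (γ : SL(2, ℤ)) τ ^ (r : ℂ))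

/-- The slash operator of weight `r` with trivial multiplier, for arbitrary `γ ∈ SL₂(ℤ)`. -/
def slash (r : ℝ) (f : ℍ → ℂ) (γ : SL(2, ℤ)) (τ : ℍ) : ℂ :=
  autFactor γ τ ^ (-r : ℂ) * f (γ • τ)

/-- For `g` with `g (τ + w) = e^{2πiκ} g τ`: the Fourier coefficient, at height `v`, of `g` at
the frequency `(n + κ) / w`, so that
`g (u + iv) = ∑ n, fourierCoeffAt g w κ n v * e^{2πi(n+κ)u/w}`. In absolute value it is the size
of the `n`-th term of the Fourier expansion of `g` at height `v`. -/
def fourierCoeffAt (g : ℍ → ℂ) (w : ℕ) (κ : ℝ) (n : ℤ) (v : ℝ) : ℂ :=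
  (1 / (w : ℂ)) * ∫ u in (0 : ℝ)..(w : ℝ),
    g (UpperHalfPlane.ofComplex ((u : ℂ) + (v : ℂ) * Complex.I)) *
      Complex.exp (-2 * Real.pi * Complex.I * ((n : ℂ) + (κ : ℂ)) * (u : ℂ) / (w : ℂ))

/-- `g` has a Fourier expansion in `e^{2πi(n+κ)τ/w}` for some period `w` and shift `κ` (the shift
accounts for the value of the multiplier system at the stabilizer of the cusp), in which at most
finitely many terms grow (are unbounded) as `v → ∞`. -/
def FinitelyManyGrowingTerms (g : ℍ → ℂ) : Prop :=
  ∃ w : ℕ, 0 < w ∧ ∃ κ : ℝ,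
    (∀ τ : ℍ, g ((w : ℝ) +ᵥ τ) = Complex.exp (2 * Real.pi * Complex.I * (κ : ℂ)) * g τ) ∧
    {n : ℤ | ¬ (fourierCoeffAt g w κ n =O[Filter.atTop] (fun _ : ℝ => (1 : ℝ)))}.Finite

/-- `g (u + iv) = O(e^{Cv})` for some `C`, as `v → ∞`, uniformly in `u`. -/
def LinearExponentialGrowth (g : ℍ → ℂ) : Prop :=
  ∃ C : ℝ, g =O[UpperHalfPlane.atImInfty] (fun τ : ℍ => Real.exp (C * τ.im))

/-- Harmonic Maass forms of weight `r` and multiplier system `ν` on `Γ`. Each cusp is `γ (i∞)`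
for some `γ ∈ SL₂(ℤ)`. -/
structure IsHarmonicMaassForm (r : ℝ) (Γ : Subgroup SL(2, ℤ)) (ν : Γ → ℂ) (f : ℍ → ℂ) :
    Prop where
  smooth : ContDiffOn ℝ ∞ (fun z : ℂ => f (UpperHalfPlane.ofComplex z)) {z : ℂ | 0 < z.im}
  harmonic : ∀ τ : ℍ, laplacian r f τ = 0
  modular : ∀ (γ : Γ) (τ : ℍ), (ν γ)⁻¹ * slash r f (γ : SL(2, ℤ)) τ = f τ
  growth : ∀ γ : SL(2, ℤ), LinearExponentialGrowth (slash r f γ)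
  fourier : ∀ γ : SL(2, ℤ), FinitelyManyGrowingTerms (slash r f γ)

/-- `θ(z; τ) = ∑_{ν ∈ 1/2 + ℤ} e^{πiν²τ + 2πiν(z + 1/2)}`, with `ν = n + 1/2`. -/
def jacobiTheta (z τ : ℂ) : ℂ :=
  ∑' n : ℤ, Complex.exp (Real.pi * Complex.I * ((n : ℂ) + 1 / 2) ^ 2 * τ
    + 2 * Real.pi * Complex.I * ((n : ℂ) + 1 / 2) * (z + 1 / 2))

/-- Zwegers' `μ`-function (an Appell–Lerch sum). -/
def mu (a b τ : ℂ) : ℂ :=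
  Complex.exp (Real.pi * Complex.I * a) / jacobiTheta b τ *
    ∑' n : ℤ, (-1 : ℂ) ^ n *
      Complex.exp (Real.pi * Complex.I * ((n : ℂ) ^ 2 + (n : ℂ)) * τ
        + 2 * Real.pi * Complex.I * (n : ℂ) * b) /
      (1 - Complex.exp (2 * Real.pi * Complex.I * (n : ℂ) * τ + 2 * Real.pi * Complex.I * a))

/-- `β(x) = ∫_x^∞ t^{-1/2} e^{-πt} dt`. -/
def beta (x : ℝ) : ℝ :=
  ∫ t in Set.Ioi x, t ^ (-(1 / 2) : ℝ) * Real.exp (-Real.pi * t)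

/-- `E(z) = sgn(z) (1 - β(z²))`. -/
def errE (z : ℝ) : ℝ :=
  Real.sign z * (1 - beta (z ^ 2))

/-- `R(a; τ) = ∑_{ν ∈ 1/2 + ℤ} (sgn ν - E((ν + Im a / v) √(2v))) (-1)^{ν-1/2} e^{-πiν²τ-2πiaν}`,
with `v = Im τ` and `ν = n + 1/2`. -/
def zwegersR (a τ : ℂ) : ℂ :=
  ∑' n : ℤ,
    ((Real.sign ((n : ℝ) + 1 / 2)
      - errE (((n : ℝ) + 1 / 2 + a.im / τ.im) * Real.sqrt (2 * τ.im)) : ℝ) : ℂ) *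
    (-1 : ℂ) ^ n *
    Complex.exp (-Real.pi * Complex.I * ((n : ℂ) + 1 / 2) ^ 2 * τ
      - 2 * Real.pi * Complex.I * a * ((n : ℂ) + 1 / 2))

/-- The completed function `μ̃(a, b; τ) = μ(a, b; τ) + (i/2) R(a - b; τ)`. -/
def muTilde (a b τ : ℂ) : ℂ :=
  mu a b τ + Complex.I / 2 * zwegersR (a - b) τ

/-- The function `F_{h,t,N}`. -/
def F (h t N : ℕ) (τ : ℍ) : ℂ :=
  - Complex.exp (-2 * Real.pi * Complex.I * ((h : ℂ) - (N : ℂ) / (t : ℂ)) ^ 2 * (τ : ℂ)) *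
    muTilde
      (((h : ℂ) * (t : ℂ) - (N : ℂ)) / (2 * (N : ℂ)) * (8 * (N : ℂ) ^ 2 * (τ : ℂ) / (t : ℂ) ^ 2))
      (-1 / 2)
      (8 * (N : ℂ) ^ 2 * (τ : ℂ) / (t : ℂ) ^ 2)

/-- The unary theta function `ϑ_{h,t,N}(τ) = ∑_{r ≡ h mod 2N/t} r q^{t r²}`, `q = e^{2πiτ}`. -/
def unaryTheta (h t N : ℕ) (τ : ℂ) : ℂ :=
  ∑' r : {r : ℤ // r ≡ (h : ℤ) [ZMOD ((2 * N / t : ℕ) : ℤ)]},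
    ((r : ℤ) : ℂ) * Complex.exp (2 * Real.pi * Complex.I * ((t : ℂ) * ((r : ℤ) : ℂ) ^ 2) * τ)

/-- The group `Γ₁(4N/t) ∩ Γ₀(16N²/t²)`. -/
def levelGroup (t N : ℕ) : Subgroup SL(2, ℤ) :=
  CongruenceSubgroup.Gamma1 (4 * N / t) ⊓ CongruenceSubgroup.Gamma0 (16 * N ^ 2 / t ^ 2)

end HarmonicMaass

end

namespace HarmonicMaass

open Real Set Filter Topology MeasureTheory Asymptotics

/-! ### The error function -/

lemma integrable_exp_neg_pi_sq : Integrable (fun x : ℝ => rexp (-π * x ^ 2)) :=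
  integrable_exp_neg_mul_sq pi_pos

lemma beta_sq {z : ℝ} (hz : 0 ≤ z) : beta (z ^ 2) = 2 * ∫ y in Ioi z, rexp (-π * y ^ 2) := by
  rw [← integral_comp_rpow_Ioi_of_pos' (p := 1 / 2) (by norm_num) hz, beta,
    ← integral_const_mul]
  rw [show z ^ ((1 / 2 : ℝ))⁻¹ = z ^ 2 by norm_num]
  refine setIntegral_congr_fun measurableSet_Ioi fun x hx => ?_
  have hx0 : 0 < x := lt_of_le_of_lt (sq_nonneg z) hx
  have h2 : (x ^ (1 / 2 : ℝ)) ^ 2 = x := by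
    rw [← rpow_natCast, ← rpow_mul hx0.le]; norm_num
  simp only [smul_eq_mul]
  rw [h2]
  norm_num
  ring

lemma integral_Ioi_zero_exp : 2 * ∫ y in Ioi (0 : ℝ), rexp (-π * y ^ 2) = 1 := by
  rw [integral_gaussian_Ioi, div_self pi_ne_zero]; norm_num

lemma errE_of_nonneg {z : ℝ} (hz : 0 ≤ z) : errE z = 2 * ∫ y in (0 : ℝ)..z, rexp (-π * y ^ 2) := by
  rcases hz.eq_or_lt with rfl | hz'
  · simp [errE]
  rw [errE, Real.sign_of_pos hz', one_mul, beta_sq hz, ← integral_Ioi_zero_exp,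
    ← intervalIntegral.integral_Ioi_sub_Ioi integrable_exp_neg_pi_sq.integrableOn hz]
  ring

lemma errE_neg (z : ℝ) : errE (-z) = -errE z := by
  simp [errE, Real.sign_neg]

lemma errE_eq (z : ℝ) : errE z = 2 * ∫ y in (0 : ℝ)..z, rexp (-π * y ^ 2) := by
  rcases le_total 0 z with hz | hz
  · exact errE_of_nonneg hz
  · have h := errE_of_nonneg (neg_nonneg.2 hz)
    rw [errE_neg] at h
    have h2 : ∫ y in (0 : ℝ)..(-z), rexp (-π * y ^ 2) = - ∫ y in (0 : ℝ)..z, rexp (-π * y ^ 2) := by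
      have := intervalIntegral.integral_comp_neg (a := 0) (b := -z) (fun y => rexp (-π * y ^ 2))
      simp only [neg_sq, neg_neg, neg_zero] at this
      rw [this, intervalIntegral.integral_symm]
    rw [h2] at h
    linarith

lemma hasDerivAt_errE (z : ℝ) : HasDerivAt errE (2 * rexp (-π * z ^ 2)) z := by
  have hc : Continuous (fun x : ℝ => rexp (-π * x ^ 2)) := by fun_prop
  have h := (intervalIntegral.integral_hasDerivAt_right
    (hc.intervalIntegrable 0 z) (hc.stronglyMeasurableAtFilter _ _) hc.continuousAt).const_mul 2
  exact h.congr_of_eventuallyEq (Eventually.of_forall errE_eq)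

lemma abs_errE_le (z : ℝ) : |errE z| ≤ 1 := by
  have key : ∀ z : ℝ, 0 ≤ z → |errE z| ≤ 1 := by
    intro z hz
    rw [errE_eq, abs_of_nonneg, ← integral_Ioi_zero_exp, intervalIntegral.integral_of_le hz]
    · gcongr
      · exact ae_of_all _ fun x => (exp_pos _).le
      · exact integrable_exp_neg_pi_sq.integrableOn
      · exact Ioc_subset_Ioi_self
    · have := intervalIntegral.integral_nonneg hz (μ := volume)
        (f := fun y => rexp (-π * y ^ 2)) fun x _ => (exp_pos _).le
      positivity
  rcases le_total 0 z with hz | hz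
  · exact key z hz
  · have := key (-z) (neg_nonneg.2 hz)
    rwa [errE_neg, abs_neg] at this

lemma abs_one_sub_errE_le {z : ℝ} (hz : 0 < z) : |1 - errE z| ≤ rexp (-π * z ^ 2) := by
  have h1 : 1 - errE z = 2 * ∫ y in Ioi z, rexp (-π * y ^ 2) := by
    rw [errE, Real.sign_of_pos hz, beta_sq hz.le]; ring
  have hintegral : IntegrableOn (fun y : ℝ => rexp (-π * (y + z) ^ 2)) (Ioi 0) :=
    (integrable_exp_neg_pi_sq.comp_add_right z).integrableOn
  have h2 : ∫ y in Ioi z, rexp (-π * y ^ 2) = ∫ y in Ioi (0 : ℝ), rexp (-π * (y + z) ^ 2) := by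
    have := (measurePreserving_add_right volume z).setIntegral_preimage_emb
      (measurableEmbedding_addRight z) (fun y => rexp (-π * y ^ 2)) (Ioi z)
    rw [← this]
    simp
  have h3 : ∫ y in Ioi (0 : ℝ), rexp (-π * (y + z) ^ 2)
      ≤ ∫ y in Ioi (0 : ℝ), rexp (-π * z ^ 2) * rexp (-π * y ^ 2) := by
    refine setIntegral_mono_on hintegral (integrable_exp_neg_pi_sq.const_mul _).integrableOn
      measurableSet_Ioi fun y hy => ?_
    rw [← exp_add, exp_le_exp]
    have : 0 ≤ π * (y * z) := by have := mem_Ioi.1 hy; positivity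
    nlinarith
  rw [integral_const_mul] at h3
  have h4 : 0 ≤ ∫ y in Ioi z, rexp (-π * y ^ 2) := integral_nonneg fun y => (exp_pos _).le
  rw [h1, abs_of_nonneg (by positivity), h2]
  nlinarith [integral_Ioi_zero_exp]

/-- If `s` and `z` have the same sign, `sgn s - E(z)` has Gaussian decay in `z`. -/
lemma abs_sign_sub_errE_le {s z : ℝ} (h : 0 < s * z) :
    |Real.sign s - errE z| ≤ rexp (-π * z ^ 2) := by
  rcases lt_trichotomy s 0 with hs | rfl | hs
  · have hz : 0 < -z := by nlinarith
    have := abs_one_sub_errE_le hz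
    rw [errE_neg, neg_sq] at this
    rw [Real.sign_of_neg hs, ← abs_neg]
    convert this using 2; ring
  · simp at h
  · have hz : 0 < z := by nlinarith
    rw [Real.sign_of_pos hs]; exact abs_one_sub_errE_le hz

lemma abs_sign_sub_errE_le_two (s z : ℝ) : |Real.sign s - errE z| ≤ 2 := by
  have h1 : |Real.sign s| ≤ 1 := by
    rcases Real.sign_apply_eq s with h | h | h <;> simp [h]
  calc _ ≤ |Real.sign s| + |errE z| := abs_sub _ _
    _ ≤ 2 := by linarith [abs_errE_le z]

/-! ### Series whose terms are closed under differentiation -/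

section ClosedSeries

variable {E ι κ α : Type*} [Fintype κ] [NormedAddCommGroup E] [NormedSpace ℝ E]

/-- Suppose that the derivative of each term `f i n` is a combination, with continuous coefficients
independent of `n`, of the terms `f j n` of finitely many of the series of a family, and that all
the series converge locally normally. Then the series may be differentiated term by term. -/
lemma hasFDerivAt_tsum_closed {U : Set E} (hU : IsOpen U) {f : ι → α → E → ℂ}
    {d : ι → κ → ι} {L : ι → κ → E → E →L[ℝ] ℂ}
    (hL : ∀ i j, ContinuousOn (L i j) U)
    (hf : ∀ i n, ∀ p ∈ U, HasFDerivAt (f i n) (∑ j, f (d i j) n p • L i j p) p)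
    (hB : ∀ i, ∀ p ∈ U, ∃ B : α → ℝ, Summable B ∧ ∀ᶠ q in 𝓝 p, ∀ n, ‖f i n q‖ ≤ B n)
    (i : ι) {p : E} (hp : p ∈ U) :
    HasFDerivAt (fun q => ∑' n, f i n q) (∑ j, (∑' n, f (d i j) n p) • L i j p) p := by
  choose! B hBs hBb using hB
  have h1 : ∀ᶠ q in 𝓝 p, ∀ j, ‖L i j q‖ ≤ ‖L i j p‖ + 1 := by
    rw [Filter.eventually_all]
    intro j
    exact ((hL i j).continuousAt (hU.mem_nhds hp)).norm.eventually_le_const (lt_add_one _)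
  have h2 : ∀ᶠ q in 𝓝 p, ∀ j, ∀ n, ‖f (d i j) n q‖ ≤ B (d i j) p n := by
    rw [Filter.eventually_all]
    intro j
    exact hBb _ p hp
  obtain ⟨ε, hε, hs⟩ := Metric.eventually_nhds_iff_ball.1 ((h1.and h2).and (hU.mem_nhds hp))
  have hsum : ∀ j, Summable fun n => f j n p := fun j =>
    (hBs j p hp).of_norm_bounded fun n => (hBb j p hp).self_of_nhds n
  have key := hasFDerivAt_tsum_of_isPreconnected
    (u := fun n => ∑ j, B (d i j) p n * (‖L i j p‖ + 1))
    (f := f i) (f' := fun n q => ∑ j, f (d i j) n q • L i j q) (s := Metric.ball p ε) (x₀ := p)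
    (x := p) (summable_sum fun j _ => (hBs _ p hp).mul_right _) Metric.isOpen_ball
    (convex_ball p ε).isPreconnected (fun n q hq => hf i n q (hs q hq).2)
    (fun n q hq => ?_) (Metric.mem_ball_self hε) (hsum i) (Metric.mem_ball_self hε)
  · rw [Summable.tsum_finsetSum (fun j _ => (hsum _).smul_const _)] at key
    have e : ∀ j ∈ Finset.univ, (∑' n, f (d i j) n p) • L i j p
        = ∑' n, f (d i j) n p • L i j p :=
      fun j _ => ((hsum _).hasSum.smul_const (L i j p)).tsum_eq.symm
    rwa [Finset.sum_congr rfl e]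
  · refine (norm_sum_le _ _).trans (Finset.sum_le_sum fun j _ => ?_)
    rw [norm_smul]
    exact mul_le_mul ((hs q hq).1.2 j n) ((hs q hq).1.1 j) (norm_nonneg _)
      ((norm_nonneg _).trans ((hs q hq).1.2 j n))

lemma contDiffOn_tsum_closed {U : Set E} (hU : IsOpen U) {f : ι → α → E → ℂ}
    {d : ι → κ → ι} {L : ι → κ → E → E →L[ℝ] ℂ}
    (hL : ∀ i j, ContDiffOn ℝ ∞ (L i j) U)
    (hf : ∀ i n, ∀ p ∈ U, HasFDerivAt (f i n) (∑ j, f (d i j) n p • L i j p) p)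
    (hB : ∀ i, ∀ p ∈ U, ∃ B : α → ℝ, Summable B ∧ ∀ᶠ q in 𝓝 p, ∀ n, ‖f i n q‖ ≤ B n)
    (i : ι) : ContDiffOn ℝ ∞ (fun q => ∑' n, f i n q) U := by
  have hder := fun i => fun p (hp : p ∈ U) =>
    hasFDerivAt_tsum_closed hU (fun i j => (hL i j).continuousOn) hf hB i hp
  rw [contDiffOn_infty]
  intro m
  induction m generalizing i with
  | zero =>
    rw [Nat.cast_zero, contDiffOn_zero]
    exact fun p hp => (hder i p hp).continuousAt.continuousWithinAt
  | succ m ih =>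
    rw [Nat.cast_add, Nat.cast_one, contDiffOn_succ_iff_fderiv_of_isOpen hU]
    refine ⟨fun p hp => (hder i p hp).differentiableAt.differentiableWithinAt,
      fun h => by simp at h, ?_⟩
    have : ContDiffOn ℝ m (fun p => ∑ j, (∑' n, f (d i j) n p) • L i j p) U :=
      ContDiffOn.sum fun j _ => (ih _).smul ((hL i j).of_le (by exact_mod_cast le_top))
    exact this.congr fun p hp => (hder i p hp).fderiv

end ClosedSeries

/-! ### The terms of Zwegers' function `R` -/

/-- The argument `(ν + Im w / v) √(2v)`, `ν = n + 1/2`, of the error function in `R(w; τ)`. -/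
noncomputable def rArg (n : ℤ) (p : ℂ × ℂ) : ℝ :=
  ((n : ℝ) + 1 / 2 + p.1.im / p.2.im) * √(2 * p.2.im)

/-- The exponent `-πiν²τ - 2πiwν`, `ν = n + 1/2`, in `R(w; τ)`. -/
noncomputable def rExp (n : ℤ) (p : ℂ × ℂ) : ℂ :=
  -π * Complex.I * ((n : ℂ) + 1 / 2) ^ 2 * p.2 - 2 * π * Complex.I * p.1 * ((n : ℂ) + 1 / 2)

/-- The terms of `R(w; τ)`, weighted by `ν ^ k`. -/
noncomputable def rTerm (k : ℕ) (n : ℤ) (p : ℂ × ℂ) : ℂ :=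
  ((n : ℂ) + 1 / 2) ^ k *
    (((Real.sign ((n : ℝ) + 1 / 2) - errE (rArg n p) : ℝ) : ℂ) * (-1) ^ n * Complex.exp (rExp n p))

/-- The terms of the theta series that arises as the `w̄`-derivative of `R(w; τ)`, weighted by
`ν ^ k`. -/
noncomputable def gTerm (k : ℕ) (n : ℤ) (p : ℂ × ℂ) : ℂ :=
  ((n : ℂ) + 1 / 2) ^ k *
    (((rexp (-π * rArg n p ^ 2) : ℝ) : ℂ) * (-1) ^ n * Complex.exp (rExp n p))

lemma zwegersR_eq (w τ : ℂ) : zwegersR w τ = ∑' n, rTerm 0 n (w, τ) := by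
  simp [zwegersR, rTerm, rArg, rExp]

lemma norm_half_add (n : ℤ) : ‖((n : ℂ) + 1 / 2)‖ = |(n : ℝ) + 1 / 2| := by
  rw [← Real.norm_eq_abs, ← Complex.norm_real]; push_cast; rfl

lemma norm_exp_rExp (n : ℤ) (p : ℂ × ℂ) : ‖Complex.exp (rExp n p)‖ =
    rexp (π * ((n : ℝ) + 1 / 2) ^ 2 * p.2.im + 2 * π * p.1.im * ((n : ℝ) + 1 / 2)) := by
  rw [Complex.norm_exp]
  have : rExp n p = ((-π * ((n : ℝ) + 1 / 2) ^ 2 : ℝ) : ℂ) * (p.2 * Complex.I)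
      + ((-2 * π * ((n : ℝ) + 1 / 2) : ℝ) : ℂ) * (p.1 * Complex.I) := by
    rw [rExp]; push_cast; ring
  rw [this, Complex.add_re, Complex.re_ofReal_mul, Complex.re_ofReal_mul, Complex.mul_I_re,
    Complex.mul_I_re]
  ring_nf

lemma rArg_sq (n : ℤ) {p : ℂ × ℂ} (hp : 0 < p.2.im) :
    rArg n p ^ 2 = ((n : ℝ) + 1 / 2 + p.1.im / p.2.im) ^ 2 * (2 * p.2.im) := by
  rw [rArg, mul_pow, Real.sq_sqrt (by positivity)]

lemma norm_rTerm_le (k : ℕ) (n : ℤ) {p : ℂ × ℂ} (hp : 0 < p.2.im) :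
    ‖rTerm k n p‖ ≤ |(n : ℝ) + 1 / 2| ^ k * (2 * rexp (8 * π * p.1.im ^ 2 / p.2.im)
      * rexp (-π * p.2.im * ((n : ℝ) + 1 / 2 + p.1.im / p.2.im) ^ 2)) := by
  rw [rTerm, norm_mul, norm_pow, norm_half_add, norm_mul, norm_mul, Complex.norm_real,
    norm_zpow, norm_neg, norm_one, one_zpow, mul_one, norm_exp_rExp]
  refine mul_le_mul_of_nonneg_left ?_ (by positivity)
  have hs := rArg_sq n hp
  set ν : ℝ := (n : ℝ) + 1 / 2
  set v := p.2.im
  obtain ⟨δ, hδ⟩ : ∃ δ, δ = p.1.im / v := ⟨_, rfl⟩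
  have hy : p.1.im = δ * v := by rw [hδ]; field_simp
  have hyy : 8 * π * p.1.im ^ 2 / v = 8 * π * (v * δ ^ 2) := by rw [hy]; field_simp
  rw [hyy, ← hδ, hy]
  rw [← hδ] at hs
  have hpv : 0 < π * v := by positivity
  rw [Real.norm_eq_abs, mul_assoc 2 (rexp _) (rexp _), ← exp_add]
  by_cases h : 0 < ν * (ν + δ)
  · have hx : 0 < ν * rArg n p := by
      have : rArg n p = (ν + δ) * √(2 * v) := by rw [rArg, hδ]
      rw [this, ← mul_assoc]; exact mul_pos h (by positivity)
    have h1 := abs_sign_sub_errE_le hx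
    calc _ ≤ rexp (-π * rArg n p ^ 2) * _ := by gcongr
      _ = rexp (-(π * v) * (ν + δ) ^ 2 - (π * v) * δ ^ 2) := by
          rw [← exp_add, hs]; congr 1; ring
      _ ≤ 1 * rexp (8 * π * (v * δ ^ 2) + -π * v * (ν + δ) ^ 2) := by
          rw [one_mul, exp_le_exp]; nlinarith [mul_nonneg hpv.le (sq_nonneg δ)]
      _ ≤ _ := by gcongr; norm_num
  · have h1 := abs_sign_sub_errE_le_two ν (rArg n p)
    refine mul_le_mul h1 ?_ (exp_pos _).le (by norm_num)
    rw [exp_le_exp]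
    have h2 : ν ^ 2 + 2 * δ * ν ≤ 8 * δ ^ 2 - (ν + δ) ^ 2 := by nlinarith [sq_nonneg (ν + δ), sq_nonneg (ν - δ), sq_nonneg δ]
    nlinarith [mul_le_mul_of_nonneg_left h2 hpv.le]

lemma norm_gTerm (k : ℕ) (n : ℤ) {p : ℂ × ℂ} (hp : 0 < p.2.im) :
    ‖gTerm k n p‖ = |(n : ℝ) + 1 / 2| ^ k * rexp (-π * p.1.im ^ 2 / p.2.im
      + -π * p.2.im * ((n : ℝ) + 1 / 2 + p.1.im / p.2.im) ^ 2) := by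
  rw [gTerm, norm_mul, norm_pow, norm_half_add, norm_mul, norm_mul, Complex.norm_real,
    norm_zpow, norm_neg, norm_one, one_zpow, mul_one, norm_exp_rExp, Real.norm_eq_abs,
    abs_of_pos (exp_pos _), ← exp_add, rArg_sq n hp]
  congr 2
  field_simp
  ring

lemma norm_gTerm_le (k : ℕ) (n : ℤ) {p : ℂ × ℂ} (hp : 0 < p.2.im) :
    ‖gTerm k n p‖ ≤ |(n : ℝ) + 1 / 2| ^ k * (2 * rexp (8 * π * p.1.im ^ 2 / p.2.im)
      * rexp (-π * p.2.im * ((n : ℝ) + 1 / 2 + p.1.im / p.2.im) ^ 2)) := by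
  rw [norm_gTerm k n hp]
  refine mul_le_mul_of_nonneg_left ?_ (by positivity)
  rw [mul_assoc 2 (rexp _) (rexp _), ← exp_add]
  have : -π * p.1.im ^ 2 / p.2.im ≤ 8 * π * p.1.im ^ 2 / p.2.im := by
    gcongr
    linarith [pi_pos]
  have h2 := exp_le_exp.2 (add_le_add_left this
    (-π * p.2.im * ((n : ℝ) + 1 / 2 + p.1.im / p.2.im) ^ 2))
  linarith [exp_pos (8 * π * p.1.im ^ 2 / p.2.im
    + -π * p.2.im * ((n : ℝ) + 1 / 2 + p.1.im / p.2.im) ^ 2)]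

/-- A summable majorant for theta-like series. -/
lemma summable_half_pow_mul_exp (S : ℝ) {T : ℝ} (hT : 0 < T) (k : ℕ) :
    Summable fun n : ℤ => |(n : ℝ) + 1 / 2| ^ k * rexp (-π * (T * n ^ 2 - 2 * S * |(n : ℝ)|)) := by
  have h1 := (summable_pow_mul_jacobiTheta₂_term_bound S hT k).add
    (summable_pow_mul_jacobiTheta₂_term_bound S hT 0)
  refine Summable.of_nonneg_of_le (fun n => by positivity) (fun n => ?_) (h1.mul_left (2 ^ k))
  rw [pow_zero, ← add_mul, ← mul_assoc, Int.cast_abs]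
  refine mul_le_mul_of_nonneg_right ?_ (exp_pos _).le
  have h2 : |(n : ℝ) + 1 / 2| ≤ |(n : ℝ)| + 1 := by
    refine (abs_add_le _ _).trans ?_
    norm_num
  rcases le_total (|(n : ℝ)|) 1 with h | h
  · calc |(n : ℝ) + 1 / 2| ^ k ≤ 2 ^ k := by gcongr; linarith
      _ ≤ _ := le_mul_of_one_le_right (by positivity) (by linarith [show 0 ≤ |(n : ℝ)| ^ k by positivity])
  · calc |(n : ℝ) + 1 / 2| ^ k ≤ (2 * |(n : ℝ)|) ^ k := by gcongr; linarith
      _ = 2 ^ k * |(n : ℝ)| ^ k := mul_pow _ _ _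
      _ ≤ _ := by gcongr; linarith

lemma exp_neg_mul_half_sq_le {S T v δ : ℝ} (hT : 0 ≤ T) (hv : T ≤ v) (hS : |δ * v + v / 2| ≤ S)
    (n : ℤ) : rexp (-π * v * ((n : ℝ) + 1 / 2 + δ) ^ 2)
      ≤ rexp (-π * (T * n ^ 2 - 2 * S * |(n : ℝ)|)) := by
  rw [exp_le_exp, neg_mul, neg_mul, neg_mul, neg_le_neg_iff, mul_assoc π v]
  refine mul_le_mul_of_nonneg_left ?_ pi_pos.le
  have h1 : -(S * |(n : ℝ)|) ≤ (δ * v + v / 2) * n := by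
    refine neg_le_of_abs_le ?_
    rw [abs_mul]; gcongr
  have h2 : T * (n : ℝ) ^ 2 ≤ v * n ^ 2 := by gcongr
  have h3 : 0 ≤ v * (1 / 2 + δ) ^ 2 := mul_nonneg (hT.trans hv) (sq_nonneg _)
  nlinarith

/-- Local normal convergence of the series of the terms `rTerm` and `gTerm`. -/
lemma exists_local_majorant (k : ℕ) {p : ℂ × ℂ} (hp : 0 < p.2.im) :
    ∃ B : ℤ → ℝ, Summable B ∧ ∀ᶠ q : ℂ × ℂ in 𝓝 p, ∀ n, ‖rTerm k n q‖ ≤ B n ∧ ‖gTerm k n q‖ ≤ B n := by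
  have c1 : ContinuousAt (fun q : ℂ × ℂ => q.2.im) p := by fun_prop
  have c2 : ContinuousAt (fun q : ℂ × ℂ => 8 * π * q.1.im ^ 2 / q.2.im) p := by
    fun_prop (disch := exact hp.ne')
  have c3 : ContinuousAt (fun q : ℂ × ℂ => |q.1.im + q.2.im / 2|) p := by fun_prop
  obtain ⟨K, hK⟩ := exists_gt (8 * π * p.1.im ^ 2 / p.2.im)
  obtain ⟨S, hS⟩ := exists_gt |p.1.im + p.2.im / 2|
  refine ⟨fun n => 2 * rexp K * (|(n : ℝ) + 1 / 2| ^ k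
    * rexp (-π * (p.2.im / 2 * n ^ 2 - 2 * S * |(n : ℝ)|))),
    (summable_half_pow_mul_exp S (half_pos hp) k).mul_left _, ?_⟩
  filter_upwards [c1.eventually_const_le (half_lt_self hp), c2.eventually_le_const hK,
    c3.eventually_le_const hS] with q h1 h2 h3 n
  have hq : 0 < q.2.im := (half_pos hp).trans_le h1
  have key : |(n : ℝ) + 1 / 2| ^ k * (2 * rexp (8 * π * q.1.im ^ 2 / q.2.im)
      * rexp (-π * q.2.im * ((n : ℝ) + 1 / 2 + q.1.im / q.2.im) ^ 2)) ≤ 2 * rexp K *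
      (|(n : ℝ) + 1 / 2| ^ k * rexp (-π * (p.2.im / 2 * n ^ 2 - 2 * S * |(n : ℝ)|))) := by
    have := exp_neg_mul_half_sq_le (δ := q.1.im / q.2.im) (half_pos hp).le h1
      (S := S) (by rwa [div_mul_cancel₀ _ hq.ne']) n
    calc _ ≤ |(n : ℝ) + 1 / 2| ^ k * (2 * rexp K
          * rexp (-π * (p.2.im / 2 * n ^ 2 - 2 * S * |(n : ℝ)|))) := by gcongr
      _ = _ := by ring
  exact ⟨(norm_rTerm_le k n hq).trans key, (norm_gTerm_le k n hq).trans key⟩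

lemma summable_rTerm (k : ℕ) {p : ℂ × ℂ} (hp : 0 < p.2.im) : Summable fun n => rTerm k n p := by
  obtain ⟨B, hB, h⟩ := exists_local_majorant k hp
  exact hB.of_norm_bounded fun n => (h.self_of_nhds n).1

lemma summable_gTerm (k : ℕ) {p : ℂ × ℂ} (hp : 0 < p.2.im) : Summable fun n => gTerm k n p := by
  obtain ⟨B, hB, h⟩ := exists_local_majorant k hp
  exact hB.of_norm_bounded fun n => (h.self_of_nhds n).2

/-! ### Derivatives of the terms -/

/-- The coefficient `√(2v)` of `ν` in the argument of the error function. -/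
noncomputable def rSlope (p : ℂ × ℂ) : ℝ := √(2 * p.2.im)

/-- The constant term `(Im w / v) √(2v)` in the argument of the error function. -/
noncomputable def rConst (p : ℂ × ℂ) : ℝ := p.1.im / p.2.im * √(2 * p.2.im)

/-- The derivative of a real function, as a complex-valued linear form. -/
noncomputable def realFDeriv (f : ℂ × ℂ → ℝ) (p : ℂ × ℂ) : ℂ × ℂ →L[ℝ] ℂ :=
  Complex.ofRealCLM.comp (fderiv ℝ f p)

lemma isOpen_im_snd_pos : IsOpen {p : ℂ × ℂ | 0 < p.2.im} :=
  isOpen_lt continuous_const (Complex.continuous_im.comp continuous_snd)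

lemma contDiffOn_im_snd : ContDiffOn ℝ ∞ (fun p : ℂ × ℂ => p.2.im) {p : ℂ × ℂ | 0 < p.2.im} :=
  (Complex.imCLM.contDiff.comp contDiff_snd).contDiffOn

lemma contDiffOn_im_fst : ContDiffOn ℝ ∞ (fun p : ℂ × ℂ => p.1.im) {p : ℂ × ℂ | 0 < p.2.im} :=
  (Complex.imCLM.contDiff.comp contDiff_fst).contDiffOn

lemma contDiffOn_rSlope : ContDiffOn ℝ ∞ rSlope {p : ℂ × ℂ | 0 < p.2.im} :=
  (contDiffOn_const.mul contDiffOn_im_snd).sqrt fun p hp =>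
    (mul_pos two_pos (show 0 < p.2.im from hp)).ne'

lemma contDiffOn_rConst : ContDiffOn ℝ ∞ rConst {p : ℂ × ℂ | 0 < p.2.im} :=
  (contDiffOn_im_fst.div contDiffOn_im_snd fun _ hp => ne_of_gt hp).mul contDiffOn_rSlope

lemma contDiffOn_realFDeriv {f : ℂ × ℂ → ℝ} (hf : ContDiffOn ℝ ∞ f {p : ℂ × ℂ | 0 < p.2.im}) :
    ContDiffOn ℝ ∞ (realFDeriv f) {p : ℂ × ℂ | 0 < p.2.im} :=
  contDiffOn_const.clm_comp (hf.fderiv_of_isOpen isOpen_im_snd_pos (by simp))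

lemma rArg_eq (n : ℤ) (p : ℂ × ℂ) : rArg n p = ((n : ℝ) + 1 / 2) * rSlope p + rConst p := by
  rw [rArg, rSlope, rConst]; ring

lemma hasFDerivAt_rArg (n : ℤ) {p : ℂ × ℂ} (hp : 0 < p.2.im) :
    HasFDerivAt (rArg n) (((n : ℝ) + 1 / 2) • fderiv ℝ rSlope p + fderiv ℝ rConst p) p := by
  have h1 := ((contDiffOn_rSlope.contDiffAt (isOpen_im_snd_pos.mem_nhds hp)).differentiableAt
    (by simp)).hasFDerivAt
  have h2 := ((contDiffOn_rConst.contDiffAt (isOpen_im_snd_pos.mem_nhds hp)).differentiableAt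
    (by simp)).hasFDerivAt
  exact ((h1.const_mul ((n : ℝ) + 1 / 2)).add h2).congr_of_eventuallyEq
    (Eventually.of_forall (rArg_eq n))

/-- First projection as a real-linear form. -/
noncomputable def projW : ℂ × ℂ →L[ℝ] ℂ := ContinuousLinearMap.fst ℝ ℂ ℂ

/-- Second projection as a real-linear form. -/
noncomputable def projT : ℂ × ℂ →L[ℝ] ℂ := ContinuousLinearMap.snd ℝ ℂ ℂ

lemma hasFDerivAt_exp_rExp (n : ℤ) (p : ℂ × ℂ) :
    HasFDerivAt (fun q => Complex.exp (rExp n q)) (Complex.exp (rExp n p) •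
      ((-π * Complex.I * ((n : ℂ) + 1 / 2) ^ 2) • projT
        + (-2 * π * Complex.I * ((n : ℂ) + 1 / 2)) • projW)) p := by
  have h1 : HasFDerivAt (rExp n) ((-π * Complex.I * ((n : ℂ) + 1 / 2) ^ 2) • projT
        + (-2 * π * Complex.I * ((n : ℂ) + 1 / 2)) • projW) p := by
    have a := (projT.hasFDerivAt (x := p)).const_mul (-π * Complex.I * ((n : ℂ) + 1 / 2) ^ 2)
    have b := (projW.hasFDerivAt (x := p)).const_mul (-2 * π * Complex.I * ((n : ℂ) + 1 / 2))
    refine (a.add b).congr_of_eventuallyEq (Eventually.of_forall fun q => ?_)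
    simp only [rExp, projT, projW, Pi.add_apply, ContinuousLinearMap.coe_fst',
      ContinuousLinearMap.coe_snd']
    ring
  exact h1.cexp

lemma hasFDerivAt_rTerm (k : ℕ) (n : ℤ) {p : ℂ × ℂ} (hp : 0 < p.2.im) :
    HasFDerivAt (rTerm k n)
      (gTerm (k + 1) n p • ((-2 : ℂ) • realFDeriv rSlope p)
        + gTerm k n p • ((-2 : ℂ) • realFDeriv rConst p)
        + rTerm (k + 1) n p • ((-2 * π * Complex.I) • projW)
        + rTerm (k + 2) n p • ((-π * Complex.I) • projT)) p := by
  have h1 : HasFDerivAt (fun q => (((Real.sign ((n : ℝ) + 1 / 2) - errE (rArg n q) : ℝ) : ℂ)))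
      (Complex.ofRealCLM.comp (-((2 * rexp (-π * rArg n p ^ 2)) •
        (((n : ℝ) + 1 / 2) • fderiv ℝ rSlope p + fderiv ℝ rConst p)))) p :=
    Complex.ofRealCLM.hasFDerivAt.comp p
      (((hasDerivAt_errE (rArg n p)).comp_hasFDerivAt p (hasFDerivAt_rArg n hp)).const_sub _)
  have h2 := ((h1.mul_const ((-1) ^ n)).mul (hasFDerivAt_exp_rExp n p)).const_mul
    (((n : ℂ) + 1 / 2) ^ k)
  refine (h2.congr_fderiv ?_)
  ext x
  all_goals
    simp [realFDeriv, projW, projT, rTerm, gTerm]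
    ring

lemma hasFDerivAt_gTerm (k : ℕ) (n : ℤ) {p : ℂ × ℂ} (hp : 0 < p.2.im) :
    HasFDerivAt (gTerm k n)
      (gTerm k n p • ((-2 * π * rConst p : ℂ) • realFDeriv rConst p)
        + gTerm (k + 1) n p • ((-2 * π * rSlope p : ℂ) • realFDeriv rConst p
          + (-2 * π * rConst p : ℂ) • realFDeriv rSlope p + (-2 * π * Complex.I) • projW)
        + gTerm (k + 2) n p • ((-2 * π * rSlope p : ℂ) • realFDeriv rSlope p
          + (-π * Complex.I) • projT)) p := by
  have h1 : HasFDerivAt (fun q => ((rexp (-π * rArg n q ^ 2) : ℝ) : ℂ))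
      (Complex.ofRealCLM.comp (rexp (-π * rArg n p ^ 2) • (-π • ((2 * rArg n p) •
        (((n : ℝ) + 1 / 2) • fderiv ℝ rSlope p + fderiv ℝ rConst p))))) p := by
    refine Complex.ofRealCLM.hasFDerivAt.comp p (HasFDerivAt.exp ?_)
    have := ((hasFDerivAt_rArg n hp).pow 2).const_mul (-π)
    refine this.congr_fderiv ?_
    simp
  have h2 := ((h1.mul_const ((-1) ^ n)).mul (hasFDerivAt_exp_rExp n p)).const_mul
    (((n : ℂ) + 1 / 2) ^ k)
  refine (h2.congr_fderiv ?_)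
  have h3 : (rArg n p : ℂ) = ((n : ℂ) + 1 / 2) * rSlope p + rConst p := by
    rw [rArg_eq]; push_cast; ring
  ext x
  all_goals
    simp [realFDeriv, projW, projT, gTerm, -Complex.ofReal_exp, h3]
    ring

/-- The two families of terms, indexed by `(true, k)` for `rTerm k` and `(false, k)` for
`gTerm k`. -/
noncomputable def zTerm : Bool × ℕ → ℤ → ℂ × ℂ → ℂ
  | (true, k) => rTerm k
  | (false, k) => gTerm k

/-- The terms occurring in the derivative of a term. -/
def zIndex : Bool × ℕ → Fin 4 → Bool × ℕ
  | (true, k) => ![(false, k + 1), (false, k), (true, k + 1), (true, k + 2)]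
  | (false, k) => ![(false, k), (false, k + 1), (false, k + 2), (false, k)]

/-- The coefficients occurring in the derivative of a term. -/
noncomputable def zCoeff : Bool × ℕ → Fin 4 → ℂ × ℂ → ℂ × ℂ →L[ℝ] ℂ
  | (true, _) => ![fun p => (-2 : ℂ) • realFDeriv rSlope p, fun p => (-2 : ℂ) • realFDeriv rConst p,
      fun _ => (-2 * π * Complex.I) • projW, fun _ => (-π * Complex.I) • projT]
  | (false, _) => ![fun p => (-2 * π * rConst p : ℂ) • realFDeriv rConst p,
      fun p => (-2 * π * rSlope p : ℂ) • realFDeriv rConst p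
          + (-2 * π * rConst p : ℂ) • realFDeriv rSlope p + (-2 * π * Complex.I) • projW,
      fun p => (-2 * π * rSlope p : ℂ) • realFDeriv rSlope p + (-π * Complex.I) • projT,
      fun _ => 0]

lemma hasFDerivAt_zTerm (i : Bool × ℕ) (n : ℤ) {p : ℂ × ℂ} (hp : 0 < p.2.im) :
    HasFDerivAt (zTerm i n) (∑ j, zTerm (zIndex i j) n p • zCoeff i j p) p := by
  rcases i with ⟨_ | _, k⟩
  · refine (hasFDerivAt_gTerm k n hp).congr_fderiv ?_
    have h0 : gTerm k n p • (0 : ℂ × ℂ →L[ℝ] ℂ) = 0 := by ext x <;> simp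
    simp only [zTerm, zIndex, zCoeff, Fin.sum_univ_four, Matrix.cons_val]
    rw [h0, add_zero]
  · simpa [zTerm, zIndex, zCoeff, Fin.sum_univ_four] using hasFDerivAt_rTerm k n hp

lemma contDiffOn_zCoeff (i : Bool × ℕ) (j : Fin 4) :
    ContDiffOn ℝ ∞ (zCoeff i j) {p : ℂ × ℂ | 0 < p.2.im} := by
  have a := contDiffOn_realFDeriv contDiffOn_rSlope
  have b := contDiffOn_realFDeriv contDiffOn_rConst
  have a' : ContDiffOn ℝ ∞ (fun p => (-2 * π * rSlope p : ℂ)) {p : ℂ × ℂ | 0 < p.2.im} :=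
    contDiffOn_const.mul (Complex.ofRealCLM.contDiff.comp_contDiffOn contDiffOn_rSlope)
  have b' : ContDiffOn ℝ ∞ (fun p => (-2 * π * rConst p : ℂ)) {p : ℂ × ℂ | 0 < p.2.im} :=
    contDiffOn_const.mul (Complex.ofRealCLM.contDiff.comp_contDiffOn contDiffOn_rConst)
  rcases i with ⟨_ | _, k⟩
  · fin_cases j
    · exact b'.smul b
    · exact ((a'.smul b).add (b'.smul a)).add contDiffOn_const
    · exact (a'.smul a).add contDiffOn_const
    · exact contDiffOn_const
  · fin_cases j
    · exact (contDiffOn_const (c := (-2 : ℂ))).smul a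
    · exact (contDiffOn_const (c := (-2 : ℂ))).smul b
    · exact contDiffOn_const
    · exact contDiffOn_const

lemma exists_majorant_zTerm (i : Bool × ℕ) (p : ℂ × ℂ) (hp : p ∈ {p : ℂ × ℂ | 0 < p.2.im}) :
    ∃ B : ℤ → ℝ, Summable B ∧ ∀ᶠ q : ℂ × ℂ in 𝓝 p, ∀ n, ‖zTerm i n q‖ ≤ B n := by
  obtain ⟨B, hB, h⟩ := exists_local_majorant i.2 hp
  refine ⟨B, hB, h.mono fun q hq n => ?_⟩
  rcases i with ⟨_ | _, k⟩
  · exact (hq n).2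
  · exact (hq n).1

/-- Zwegers' `R` is jointly smooth. -/
lemma contDiffOn_zwegersR :
    ContDiffOn ℝ ∞ (fun p : ℂ × ℂ => zwegersR p.1 p.2) {p : ℂ × ℂ | 0 < p.2.im} := by
  have := contDiffOn_tsum_closed isOpen_im_snd_pos contDiffOn_zCoeff
    (fun i n p hp => hasFDerivAt_zTerm i n hp) exists_majorant_zTerm (true, 0)
  exact this.congr fun p _ => zwegersR_eq p.1 p.2

lemma hasFDerivAt_zwegersR {p : ℂ × ℂ} (hp : 0 < p.2.im) :
    HasFDerivAt (fun p : ℂ × ℂ => zwegersR p.1 p.2)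
      ((∑' n, gTerm 1 n p) • ((-2 : ℂ) • realFDeriv rSlope p)
        + (∑' n, gTerm 0 n p) • ((-2 : ℂ) • realFDeriv rConst p)
        + (∑' n, rTerm 1 n p) • ((-2 * π * Complex.I) • projW)
        + (∑' n, rTerm 2 n p) • ((-π * Complex.I) • projT)) p := by
  have := hasFDerivAt_tsum_closed isOpen_im_snd_pos
    (fun i j => (contDiffOn_zCoeff i j).continuousOn)
    (fun i n p hp => hasFDerivAt_zTerm i n hp) exists_majorant_zTerm (true, 0) hp
  refine (this.congr_of_eventuallyEq (Eventually.of_forall fun p => zwegersR_eq p.1 p.2)).congr_fderiv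
    ?_
  simp [zTerm, zIndex, zCoeff, Fin.sum_univ_four]

lemma fderiv_rSlope {p : ℂ × ℂ} (hp : 0 < p.2.im) (x : ℂ × ℂ) :
    fderiv ℝ rSlope p x = x.2.im / √(2 * p.2.im) := by
  have h1 : HasFDerivAt (fun q : ℂ × ℂ => 2 * q.2.im)
      ((2 : ℝ) • (Complex.imCLM.comp (ContinuousLinearMap.snd ℝ ℂ ℂ))) p :=
    ((Complex.imCLM.comp (ContinuousLinearMap.snd ℝ ℂ ℂ)).hasFDerivAt (x := p)).const_mul 2
  have h2 := h1.sqrt (by positivity)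
  have : HasFDerivAt rSlope _ p := h2
  rw [this.fderiv]
  simp
  field_simp

lemma fderiv_rConst {p : ℂ × ℂ} (hp : 0 < p.2.im) (x : ℂ × ℂ) :
    fderiv ℝ rConst p x = (2 * x.1.im - p.1.im / p.2.im * x.2.im) / √(2 * p.2.im) := by
  have h1 := (Complex.imCLM.comp (ContinuousLinearMap.fst ℝ ℂ ℂ)).hasFDerivAt (x := p)
  have h2 := (Complex.imCLM.comp (ContinuousLinearMap.snd ℝ ℂ ℂ)).hasFDerivAt (x := p)
  have h3 := ((contDiffOn_rSlope.contDiffAt (isOpen_im_snd_pos.mem_nhds hp)).differentiableAt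
    (by simp)).hasFDerivAt
  have h4 := (h1.mul ((hasDerivAt_inv hp.ne').comp_hasFDerivAt p h2)).mul h3
  have : HasFDerivAt rConst _ p := h4
  rw [this.fderiv]
  have hs : √(2 * p.2.im) ^ 2 = 2 * p.2.im := Real.sq_sqrt (by positivity)
  have hs0 : √(2 * p.2.im) ≠ 0 := by positivity
  have hr : rSlope p = √(2 * p.2.im) := rfl
  simp only [add_apply, smul_apply, fderiv_rSlope hp, hr]
  generalize √(2 * p.2.im) = s at hs hs0
  simp
  field_simp
  rw [hs]
  ring

/-- Real derivative of `R` along a holomorphic curve, with its antilinear part. -/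
lemma zwegersR_curve {w τ : ℂ → ℂ} {w' τ' z : ℂ} (hw : HasDerivAt w w' z) (hτ : HasDerivAt τ τ' z)
    (h : 0 < (τ z).im) : ∃ A : ℂ →L[ℝ] ℂ,
      HasFDerivAt (fun z => zwegersR (w z) (τ z)) A z ∧
      A 1 + Complex.I * A Complex.I = -(2 * Complex.I / √(2 * (τ z).im)) *
        ((∑' n, gTerm 1 n (w z, τ z)) * (starRingEnd ℂ) τ' + (∑' n, gTerm 0 n (w z, τ z)) *
          (2 * (starRingEnd ℂ) w' - ((w z).im / (τ z).im : ℝ) * (starRingEnd ℂ) τ')) := by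
  have hc : HasFDerivAt (fun z => (w z, τ z)) _ z :=
    (hw.hasFDerivAt.restrictScalars ℝ).prodMk (hτ.hasFDerivAt.restrictScalars ℝ)
  have hR := hasFDerivAt_zwegersR (p := (w z, τ z)) h
  generalize (∑' n, gTerm 1 n (w z, τ z)) = G₁ at hR ⊢
  generalize (∑' n, gTerm 0 n (w z, τ z)) = G₀ at hR ⊢
  generalize (∑' n, rTerm 1 n (w z, τ z)) = R₁ at hR
  generalize (∑' n, rTerm 2 n (w z, τ z)) = R₂ at hR
  have hA := HasFDerivAt.comp (g := fun p : ℂ × ℂ => zwegersR p.1 p.2) z hR hc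
  refine ⟨_, hA, ?_⟩
  clear hA hR hc
  have e : ∀ x : ℂ, (x.im : ℂ) = ((starRingEnd ℂ) x - x) * Complex.I / 2 := by
    intro x; apply Complex.ext <;> simp
  simp only [realFDeriv, projW, projT, ContinuousLinearMap.comp_apply, add_apply, smul_apply,
    ContinuousLinearMap.prod_apply, ContinuousLinearMap.coe_restrictScalars',
    ContinuousLinearMap.toSpanSingleton_apply, fderiv_rSlope (p := (w z, τ z)) h,
    fderiv_rConst (p := (w z, τ z)) h, Complex.ofRealCLM_apply, smul_eq_mul, one_mul,
    ContinuousLinearMap.coe_fst', ContinuousLinearMap.coe_snd', Complex.ofReal_div,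
    Complex.ofReal_sub, Complex.ofReal_mul, e, map_mul, Complex.conj_I]
  generalize (√(2 * (τ z).im) : ℂ) = s
  generalize (((starRingEnd ℂ) (w z) - w z) * Complex.I / 2 /
    (((starRingEnd ℂ) (τ z) - τ z) * Complex.I / 2)) = δ
  have hI : Complex.I ^ 2 = -1 := Complex.I_sq
  have hI3 : Complex.I ^ 3 = -Complex.I := by rw [pow_succ, hI]; ring
  push_cast
  ring_nf
  simp only [hI3]
  ring

/-! ### The odd Jacobi theta function -/

lemma exp_pi_I_int (n : ℤ) : Complex.exp (π * Complex.I * n) = (-1) ^ n := by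
  rw [mul_comm, Complex.exp_int_mul, Complex.exp_pi_mul_I]

lemma neg_one_zpow_sq (n : ℤ) : ((-1 : ℂ) ^ n) * (-1) ^ n = 1 := by
  rw [← mul_zpow]; simp

lemma exp_pi_I_half : Complex.exp (π * Complex.I * (1 / 2)) = Complex.I := by
  rw [show (π : ℂ) * Complex.I * (1 / 2) = π / 2 * Complex.I by ring, Complex.exp_pi_div_two_mul_I]

lemma exp_neg_pi_I_half : Complex.exp (-(π * Complex.I * (1 / 2))) = -Complex.I := by
  rw [Complex.exp_neg, exp_pi_I_half, Complex.inv_I]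

lemma theta_term_eq (n : ℤ) (z τ : ℂ) :
    Complex.exp (π * Complex.I * ((n : ℂ) + 1 / 2) ^ 2 * τ
      + 2 * π * Complex.I * ((n : ℂ) + 1 / 2) * (z + 1 / 2)) =
    Complex.exp (π * Complex.I * (τ / 4 + (z + 1 / 2))) *
      jacobiTheta₂_term n (z + 1 / 2 + τ / 2) τ := by
  rw [jacobiTheta₂_term, ← Complex.exp_add]
  congr 1
  ring

lemma theta_eq (z τ : ℂ) : jacobiTheta z τ =
    Complex.exp (π * Complex.I * (τ / 4 + (z + 1 / 2))) * jacobiTheta₂ (z + 1 / 2 + τ / 2) τ := by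
  simp only [jacobiTheta, theta_term_eq, jacobiTheta₂, tsum_mul_left]

lemma differentiableAt_theta {f g : ℂ → ℂ} {z : ℂ} (hf : DifferentiableAt ℂ f z)
    (hg : DifferentiableAt ℂ g z) (h : 0 < (g z).im) :
    DifferentiableAt ℂ (fun x => jacobiTheta (f x) (g x)) z := by
  simp only [theta_eq]
  refine DifferentiableAt.mul (by fun_prop) ?_
  have h1 := (hasFDerivAt_jacobiTheta₂ (f z + 1 / 2 + g z / 2) h).differentiableAt
  exact DifferentiableAt.comp (g := fun p : ℂ × ℂ => jacobiTheta₂ p.1 p.2)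
    (f := fun x => (f x + 1 / 2 + g x / 2, g x)) z h1 (by fun_prop)

lemma differentiable_theta {τ : ℂ} (hτ : 0 < τ.im) : Differentiable ℂ fun z => jacobiTheta z τ :=
  fun _ => differentiableAt_theta differentiableAt_id (differentiableAt_const _) hτ

lemma theta_add_one (z τ : ℂ) : jacobiTheta (z + 1) τ = -jacobiTheta z τ := by
  rw [theta_eq, theta_eq, show z + 1 + 1 / 2 + τ / 2 = (z + 1 / 2 + τ / 2) + 1 by ring,
    jacobiTheta₂_add_left, show (π : ℂ) * Complex.I * (τ / 4 + (z + 1 + 1 / 2))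
      = π * Complex.I * (τ / 4 + (z + 1 / 2)) + π * Complex.I by ring, Complex.exp_add,
    Complex.exp_pi_mul_I]
  ring

lemma theta_add_tau (z τ : ℂ) : jacobiTheta (z + τ) τ =
    -Complex.exp (-π * Complex.I * τ - 2 * π * Complex.I * z) * jacobiTheta z τ := by
  rw [theta_eq, theta_eq, show z + τ + 1 / 2 + τ / 2 = (z + 1 / 2 + τ / 2) + τ by ring,
    jacobiTheta₂_add_left', ← mul_assoc, ← mul_assoc, ← Complex.exp_add,
    ← Complex.exp_add_pi_mul_I, ← Complex.exp_add]
  congr 1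
  exact Complex.exp_eq_exp_iff_exists_int.2 ⟨-1, by push_cast; ring⟩

lemma theta_zero (τ : ℂ) : jacobiTheta 0 τ = 0 := by
  have h1 := jacobiTheta₂_neg_left (1 / 2 + τ / 2) τ
  have h2 := jacobiTheta₂_add_left' (-(1 / 2 + τ / 2) + 1) τ
  rw [jacobiTheta₂_add_left, h1, show -(1 / 2 + τ / 2) + 1 + τ = 1 / 2 + τ / 2 by ring,
    show -(π : ℂ) * Complex.I * (τ + 2 * (-(1 / 2 + τ / 2) + 1)) = -(π * Complex.I) by ring,
    Complex.exp_neg, Complex.exp_pi_mul_I] at h2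
  have h3 : jacobiTheta₂ (1 / 2 + τ / 2) τ = 0 := by
    norm_num at h2
    linear_combination (1 / 2) * h2
  rw [theta_eq, zero_add, h3, mul_zero]

lemma theta_tau_add_one (z τ : ℂ) :
    jacobiTheta z (τ + 1) = Complex.exp (π * Complex.I / 4) * jacobiTheta z τ := by
  rw [jacobiTheta, jacobiTheta, ← tsum_mul_left]
  refine tsum_congr fun n => ?_
  obtain ⟨m, hm⟩ := Int.even_mul_succ_self n
  have hm' : (n : ℂ) * (n + 1) = m + m := by exact_mod_cast hm
  rw [← Complex.exp_add, Complex.exp_eq_exp_iff_exists_int]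
  refine ⟨m, ?_⟩
  linear_combination (π : ℂ) * Complex.I * hm'

lemma theta_neg_inv (z : ℂ) {τ : ℂ} (hτ : τ ≠ 0) : jacobiTheta (z / τ) (-1 / τ) =
    -Complex.I * (-Complex.I * τ) ^ (1 / 2 : ℂ) * Complex.exp (π * Complex.I * z ^ 2 / τ)
      * jacobiTheta z τ := by
  have hs : (-Complex.I * τ) ^ (1 / 2 : ℂ) ≠ 0 := by
    rw [Complex.cpow_ne_zero_iff]
    left
    simp [hτ]
  have h := jacobiTheta₂_functional_equation (z + τ / 2 - 1 / 2) τ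
  have hper : jacobiTheta₂ (z + τ / 2 - 1 / 2) τ = jacobiTheta₂ (z + 1 / 2 + τ / 2) τ := by
    rw [← jacobiTheta₂_add_left (z + τ / 2 - 1 / 2)]; ring_nf
  rw [hper] at h
  have harg : z / τ + 1 / 2 + -1 / τ / 2 = (z + τ / 2 - 1 / 2) / τ := by field_simp; ring
  rw [theta_eq, theta_eq, harg, h]
  have e : Complex.exp (π * Complex.I * (-1 / τ / 4 + (z / τ + 1 / 2))) =
      -Complex.I * Complex.exp (π * Complex.I * z ^ 2 / τ)
      * Complex.exp (π * Complex.I * (τ / 4 + (z + 1 / 2)))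
      * Complex.exp (-π * Complex.I * (z + τ / 2 - 1 / 2) ^ 2 / τ) := by
    rw [← exp_neg_pi_I_half, ← Complex.exp_add, ← Complex.exp_add, ← Complex.exp_add]
    congr 1
    field_simp
    ring
  rw [e]
  field_simp

lemma exists_theta_ne_zero {τ : ℂ} (hτ : 0 < τ.im) : ∃ z, jacobiTheta z τ ≠ 0 := by
  by_contra! hall
  have h0 : ∀ x : ℂ, jacobiTheta₂ x τ = 0 := by
    intro x
    have := hall (x - 1 / 2 - τ / 2)
    rw [theta_eq, show x - 1 / 2 - τ / 2 + 1 / 2 + τ / 2 = x by ring] at this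
    simpa [Complex.exp_ne_zero] using this
  have key := hasSum_integral_of_summable_integral_norm (μ := volume.restrict (Ioc (0 : ℝ) 1))
    (F := fun (n : ℤ) (x : ℝ) => jacobiTheta₂_term n x τ) (fun n => ?_) ?_
  · have hz : (fun n : ℤ => ∫ x in Ioc (0 : ℝ) 1, jacobiTheta₂_term n x τ)
        = fun n => if n = 0 then 1 else 0 := by
      ext n
      rw [← intervalIntegral.integral_of_le zero_le_one]
      simp only [jacobiTheta₂_term, Complex.exp_add]
      rw [intervalIntegral.integral_mul_const]
      split_ifs with h
      · simp [h]
      · have hc : 2 * (π : ℂ) * Complex.I * n ≠ 0 := by simp [h, pi_ne_zero]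
        rw [integral_exp_mul_complex hc]
        have : Complex.exp (2 * π * Complex.I * n * (1 : ℝ)) = 1 :=
          Complex.exp_eq_one_iff.2 ⟨n, by push_cast; ring⟩
        rw [this]
        simp
    rw [hz] at key
    have h1 := key.unique (hasSum_ite_eq 0 1)
    have h2 : ∀ x : ℝ, ∑' n : ℤ, jacobiTheta₂_term n x τ = 0 := fun x => h0 x
    simp [h2] at h1
  · refine (Continuous.integrableOn_Ioc ?_)
    simp only [jacobiTheta₂_term]
    fun_prop
  · have hn : ∀ (n : ℤ) (x : ℝ), ‖jacobiTheta₂_term n x τ‖ = ‖jacobiTheta₂_term n 0 τ‖ := by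
      intro n x; simp [norm_jacobiTheta₂_term]
    simp only [hn]
    simpa using ((summable_jacobiTheta₂_term_iff 0 τ).2 hτ).norm

/-- The `w̄`-derivative of `R` is a theta function. -/
lemma tsum_gTerm_zero (w : ℂ) {τ : ℂ} (hτ : 0 < τ.im) : ∑' n, gTerm 0 n (w, τ) =
    Complex.I * rexp (-2 * π * w.im ^ 2 / τ.im) * (starRingEnd ℂ) (jacobiTheta w τ) := by
  rw [jacobiTheta, Complex.conj_tsum, ← tsum_mul_left]
  refine tsum_congr fun n => ?_
  rw [gTerm, pow_zero, one_mul, rArg_sq n hτ, ← Complex.exp_conj]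
  have h1 : ((-1 : ℂ) ^ n) = Complex.exp (-(π * Complex.I * n)) := by
    rw [Complex.exp_neg, exp_pi_I_int, ← inv_zpow]; norm_num
  rw [h1, show ∀ a b : ℂ, Complex.I * a * b = Complex.exp (π * Complex.I * (1 / 2)) * a * b from
    fun a b => by rw [exp_pi_I_half]]
  push_cast
  rw [← Complex.exp_add, ← Complex.exp_add, ← Complex.exp_add, ← Complex.exp_add]
  congr 1
  simp only [map_add, map_mul, map_pow, Complex.conj_I, Complex.conj_ofReal, map_intCast, map_div₀,
    map_one, map_ofNat, rExp]
  have e : ∀ x : ℂ, (starRingEnd ℂ) x = x - 2 * x.im * Complex.I := by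
    intro x; apply Complex.ext <;> simp; ring
  rw [e w, e τ]
  have hv : (τ.im : ℂ) ≠ 0 := by exact_mod_cast hτ.ne'
  field_simp
  ring_nf
  simp only [Complex.I_sq]
  ring

/-! ### Appell–Lerch sums -/

/-- The lattice `ℤ τ + ℤ`. -/
def IsLatticePoint (τ u : ℂ) : Prop := ∃ m n : ℤ, u = m * τ + n

lemma isLatticePoint_add_int_iff {τ u : ℂ} (m n : ℤ) :
    IsLatticePoint τ (u + m * τ + n) ↔ IsLatticePoint τ u := by
  constructor
  · rintro ⟨a, b, h⟩
    exact ⟨a - m, b - n, by push_cast; linear_combination h⟩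
  · rintro ⟨a, b, h⟩
    exact ⟨a + m, b + n, by push_cast; linear_combination h⟩

lemma isLatticePoint_zero (τ : ℂ) : IsLatticePoint τ 0 := ⟨0, 0, by simp⟩

lemma exp_eq_one_iff_lattice (n : ℤ) (u τ : ℂ) :
    Complex.exp (2 * π * Complex.I * n * τ + 2 * π * Complex.I * u) = 1 ↔
      ∃ k : ℤ, u = -n * τ + k := by
  have h2 : 2 * (π : ℂ) * Complex.I ≠ 0 := by simp [pi_ne_zero]
  rw [Complex.exp_eq_one_iff]
  refine exists_congr fun k => ⟨fun h => ?_, fun h => ?_⟩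
  · apply mul_left_cancel₀ h2; linear_combination h
  · rw [h]; ring

lemma exp_ne_one_of_not_lattice {u τ : ℂ} (h : ¬ IsLatticePoint τ u) (n : ℤ) :
    Complex.exp (2 * π * Complex.I * n * τ + 2 * π * Complex.I * u) ≠ 1 := by
  intro h1
  obtain ⟨k, hk⟩ := (exp_eq_one_iff_lattice n u τ).1 h1
  exact h ⟨-n, k, by push_cast; exact hk⟩

/-- The numerators of the Appell–Lerch sum. -/
noncomputable def appellNum (n : ℤ) (v τ : ℂ) : ℂ :=
  (-1 : ℂ) ^ n * Complex.exp (π * Complex.I * ((n : ℂ) ^ 2 + n) * τ + 2 * π * Complex.I * n * v)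

/-- The terms of the Appell–Lerch sum. -/
noncomputable def appellTerm (n : ℤ) (u v τ : ℂ) : ℂ :=
  appellNum n v τ / (1 - Complex.exp (2 * π * Complex.I * n * τ + 2 * π * Complex.I * u))

/-- The Appell–Lerch sum in the definition of `μ`. -/
noncomputable def appell (u v τ : ℂ) : ℂ := ∑' n, appellTerm n u v τ

lemma mu_eq (u v τ : ℂ) :
    mu u v τ = Complex.exp (π * Complex.I * u) / jacobiTheta v τ * appell u v τ := rfl

lemma norm_appellNum (n : ℤ) (v τ : ℂ) :
    ‖appellNum n v τ‖ = ‖jacobiTheta₂_term n (v + τ / 2) τ‖ := by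
  rw [appellNum, norm_mul, norm_zpow, norm_neg, norm_one, one_zpow, one_mul, jacobiTheta₂_term]
  congr 2
  ring

lemma summable_appellNum (v : ℂ) {τ : ℂ} (hτ : 0 < τ.im) : Summable fun n => appellNum n v τ := by
  rw [← summable_norm_iff]
  simp only [norm_appellNum]
  exact ((summable_jacobiTheta₂_term_iff _ _).2 hτ).norm

lemma tsum_appellNum (v τ : ℂ) : ∑' n, appellNum n v τ =
    -Complex.I * Complex.exp (-(π * Complex.I * (τ / 4 + v))) * jacobiTheta v τ := by
  rw [jacobiTheta, ← tsum_mul_left]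
  refine tsum_congr fun n => ?_
  rw [appellNum, ← exp_pi_I_int, ← exp_neg_pi_I_half, ← Complex.exp_add, ← Complex.exp_add,
    ← Complex.exp_add]
  congr 1
  ring

/-- Away from finitely many terms the denominators are bounded below. -/
lemma half_le_norm_one_sub_exp {n : ℤ} {u τ : ℂ} (h : 1 ≤ |n * τ.im + u.im|) :
    1 / 2 ≤ ‖1 - Complex.exp (2 * π * Complex.I * n * τ + 2 * π * Complex.I * u)‖ := by
  have hn : ‖Complex.exp (2 * π * Complex.I * n * τ + 2 * π * Complex.I * u)‖
      = rexp (-(2 * π * (n * τ.im + u.im))) := by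
    rw [Complex.norm_exp]
    congr 1
    simp
    ring
  have h2 : 2 ≤ rexp (2 * π) := by linarith [add_one_le_exp (2 * π), pi_gt_three]
  rcases le_abs.1 h with h | h
  · have h3 : rexp (-(2 * π * (n * τ.im + u.im))) ≤ 1 / 2 := by
      rw [exp_neg, ← one_div]
      refine one_div_le_one_div_of_le two_pos (h2.trans (exp_le_exp.2 ?_))
      nlinarith [pi_pos]
    have := norm_sub_norm_le (1 : ℂ) (Complex.exp (2 * π * Complex.I * n * τ + 2 * π * Complex.I * u))
    rw [hn, norm_one] at this
    linarith
  · have h3 : 2 ≤ rexp (-(2 * π * (n * τ.im + u.im))) := by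
      refine h2.trans (exp_le_exp.2 ?_)
      nlinarith [pi_pos]
    have := norm_sub_norm_le (Complex.exp (2 * π * Complex.I * n * τ + 2 * π * Complex.I * u)) 1
    rw [hn, norm_one, norm_sub_rev] at this
    linarith

lemma exists_den_bound (u₀ : ℂ) {τ₀ : ℂ} (hτ : 0 < τ₀.im) :
    ∃ δ > 0, ∀ᶠ q : ℂ × ℂ in 𝓝 (u₀, τ₀), ∀ n : ℤ,
      Complex.exp (2 * π * Complex.I * n * τ₀ + 2 * π * Complex.I * u₀) ≠ 1 →
      δ ≤ ‖1 - Complex.exp (2 * π * Complex.I * n * q.2 + 2 * π * Complex.I * q.1)‖ := by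
  obtain ⟨N, hN⟩ := exists_nat_gt ((|u₀.im| + 2) / (τ₀.im / 2))
  have hN' : |u₀.im| + 2 < N * (τ₀.im / 2) := (div_lt_iff₀ (half_pos hτ)).1 hN
  have hfin : ∀ᶠ δ : ℝ in 𝓝[>] 0, ∀ n ∈ Finset.Icc (-(N : ℤ)) N,
      ∀ᶠ q : ℂ × ℂ in 𝓝 (u₀, τ₀),
        Complex.exp (2 * π * Complex.I * n * τ₀ + 2 * π * Complex.I * u₀) ≠ 1 →
      δ ≤ ‖1 - Complex.exp (2 * π * Complex.I * n * q.2 + 2 * π * Complex.I * q.1)‖ := by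
    rw [Filter.eventually_all_finset]
    intro n _
    by_cases h : Complex.exp (2 * π * Complex.I * n * τ₀ + 2 * π * Complex.I * u₀) = 1
    · simp [h]
    have hpos : 0 < ‖1 - Complex.exp (2 * π * Complex.I * n * τ₀ + 2 * π * Complex.I * u₀)‖ :=
      norm_pos_iff.2 (sub_ne_zero.2 (Ne.symm h))
    filter_upwards [nhdsWithin_le_nhds (eventually_lt_nhds hpos)] with δ hδ
    have hc : ContinuousAt (fun q : ℂ × ℂ =>
      ‖1 - Complex.exp (2 * π * Complex.I * n * q.2 + 2 * π * Complex.I * q.1)‖) (u₀, τ₀) := by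
      fun_prop
    filter_upwards [hc.eventually_const_le hδ] with q hq _ using hq
  obtain ⟨δ, ⟨h1, h2⟩, hδ⟩ := ((hfin.and (nhdsWithin_le_nhds
    (eventually_lt_nhds (show (0 : ℝ) < 1 / 2 by norm_num)))).and self_mem_nhdsWithin).exists
  refine ⟨δ, hδ, ?_⟩
  have c1 : ContinuousAt (fun q : ℂ × ℂ => q.2.im) (u₀, τ₀) := by fun_prop
  have c2 : ContinuousAt (fun q : ℂ × ℂ => |q.1.im|) (u₀, τ₀) := by fun_prop
  rw [← Filter.eventually_all_finset] at h1
  filter_upwards [h1, c1.eventually_const_le (half_lt_self hτ),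
    c2.eventually_le_const (lt_add_one |u₀.im|)] with q h3 h4 h5 n hn
  by_cases hm : n ∈ Finset.Icc (-(N : ℤ)) N
  · exact h3 n hm hn
  refine h2.le.trans (half_le_norm_one_sub_exp ?_)
  have habs : (N : ℝ) ≤ |(n : ℝ)| := by
    rw [Finset.mem_Icc, ← abs_le, not_le] at hm
    exact_mod_cast hm.le
  have h6 : (N : ℝ) * (τ₀.im / 2) ≤ |n * q.2.im| := by
    rw [abs_mul]
    exact mul_le_mul habs (h4.trans (le_abs_self _)) (half_pos hτ).le (abs_nonneg _)
  have h7 := abs_sub_abs_le_abs_add (n * q.2.im) q.1.im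
  linarith

lemma exists_appell_majorant (u₀ v₀ : ℂ) {τ₀ : ℂ} (hτ : 0 < τ₀.im) :
    ∃ B : ℤ → ℝ, Summable B ∧ ∀ᶠ q : ℂ × ℂ × ℂ in 𝓝 (u₀, v₀, τ₀), ∀ n : ℤ,
      Complex.exp (2 * π * Complex.I * n * τ₀ + 2 * π * Complex.I * u₀) ≠ 1 →
      ‖appellTerm n q.1 q.2.1 q.2.2‖ ≤ B n ∧
        1 - Complex.exp (2 * π * Complex.I * n * q.2.2 + 2 * π * Complex.I * q.1) ≠ 0 := by
  obtain ⟨δ, hδ, h⟩ := exists_den_bound u₀ hτ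
  obtain ⟨S, hS⟩ := exists_gt |(v₀ + τ₀ / 2).im|
  have hsum := (summable_pow_mul_jacobiTheta₂_term_bound S (half_pos hτ) 0).div_const δ
  refine ⟨_, hsum, ?_⟩
  have c0 : Tendsto (fun q : ℂ × ℂ × ℂ => (q.1, q.2.2)) (𝓝 (u₀, v₀, τ₀)) (𝓝 (u₀, τ₀)) := by
    have : ContinuousAt (fun q : ℂ × ℂ × ℂ => (q.1, q.2.2)) (u₀, v₀, τ₀) := by fun_prop
    exact this
  have c1 : ContinuousAt (fun q : ℂ × ℂ × ℂ => q.2.2.im) (u₀, v₀, τ₀) := by fun_prop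
  have c2 : ContinuousAt (fun q : ℂ × ℂ × ℂ => |(q.2.1 + q.2.2 / 2).im|) (u₀, v₀, τ₀) := by fun_prop
  filter_upwards [c0.eventually h, c1.eventually_const_le (half_lt_self hτ),
    c2.eventually_le_const hS] with q h1 h2 h3 n hn
  have h4 := h1 n hn
  refine ⟨?_, fun h0 => ?_⟩
  · rw [appellTerm, norm_div, norm_appellNum, pow_zero, one_mul]
    exact div_le_div₀ (exp_pos _).le (norm_jacobiTheta₂_term_le (half_pos hτ) h3 h2 n) hδ h4
  · rw [h0, norm_zero] at h4
    exact absurd h4 (not_le.2 hδ)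

lemma summable_appellTerm {u : ℂ} (v : ℂ) {τ : ℂ} (hτ : 0 < τ.im) (hu : ¬ IsLatticePoint τ u) :
    Summable fun n => appellTerm n u v τ := by
  obtain ⟨B, hB, h⟩ := exists_appell_majorant u v hτ
  exact hB.of_norm_bounded fun n => (h.self_of_nhds n (exp_ne_one_of_not_lattice hu n)).1

lemma differentiableAt_appell {f g h : ℂ → ℂ} {z : ℂ} (hf : ∀ᶠ x in 𝓝 z, DifferentiableAt ℂ f x)
    (hg : ∀ᶠ x in 𝓝 z, DifferentiableAt ℂ g x) (hh : ∀ᶠ x in 𝓝 z, DifferentiableAt ℂ h x)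
    (hτ : 0 < (h z).im) (hu : ¬ IsLatticePoint (h z) (f z)) :
    DifferentiableAt ℂ (fun x => appell (f x) (g x) (h x)) z := by
  obtain ⟨B, hB, hb⟩ := exists_appell_majorant (f z) (g z) hτ
  have hc : Tendsto (fun x => (f x, g x, h x)) (𝓝 z) (𝓝 (f z, g z, h z)) :=
    (hf.self_of_nhds.continuousAt.tendsto).prodMk_nhds
      ((hg.self_of_nhds.continuousAt.tendsto).prodMk_nhds hh.self_of_nhds.continuousAt.tendsto)
  obtain ⟨s, hs, hso, hzs⟩ := eventually_nhds_iff.1 (((hc.eventually hb).and hf).and (hg.and hh))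
  refine (Complex.differentiableOn_tsum_of_summable_norm hB (fun n x hx => ?_) hso
    (fun n x hx => ?_)).differentiableAt (hso.mem_nhds hzs)
  · obtain ⟨⟨h1, h2⟩, h3, h4⟩ := hs x hx
    have h5 := (h1 n (exp_ne_one_of_not_lattice hu n)).2
    refine DifferentiableAt.differentiableWithinAt ?_
    simp only [appellTerm, appellNum]
    exact DifferentiableAt.div (by fun_prop) (by fun_prop) h5
  · exact ((hs x hx).1.1 n (exp_ne_one_of_not_lattice hu n)).1

/-- The residue of the Appell–Lerch sum at `u = 0`. -/
lemma tendsto_mul_appell (v : ℂ) {τ : ℂ} (hτ : 0 < τ.im) :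
    Tendsto (fun u => u * appell u v τ) (𝓝[≠] 0) (𝓝 (-(2 * π * Complex.I)⁻¹)) := by
  obtain ⟨B, hB, hb⟩ := exists_appell_majorant 0 v hτ
  have hc : Tendsto (fun u : ℂ => (u, v, τ)) (𝓝[≠] 0) (𝓝 (0, v, τ)) := by
    have : Continuous (fun u : ℂ => (u, v, τ)) := by fun_prop
    exact (this.tendsto 0).mono_left nhdsWithin_le_nhds
  have hne : ∀ n : ℤ, n ≠ 0 →
      Complex.exp (2 * π * Complex.I * n * τ + 2 * π * Complex.I * 0) ≠ 1 := by
    intro n hn h1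
    obtain ⟨k, hk⟩ := (exp_eq_one_iff_lattice n 0 τ).1 h1
    have := congrArg Complex.im hk
    simp [hn, hτ.ne'] at this
  have hterm : ∀ u, appellTerm 0 u v τ = (1 - Complex.exp (2 * π * Complex.I * u))⁻¹ := by
    intro u; simp [appellTerm, appellNum]
  have hder : HasDerivAt (fun u : ℂ => 1 - Complex.exp (2 * π * Complex.I * u))
      (-(2 * π * Complex.I)) 0 := by
    have h1 : HasDerivAt (fun u : ℂ => 2 * π * Complex.I * u) (2 * π * Complex.I) 0 := by
      simpa using (hasDerivAt_id (0 : ℂ)).const_mul (2 * π * Complex.I)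
    simpa using h1.cexp.const_sub 1
  have hlim : Tendsto (fun u => u * appellTerm 0 u v τ) (𝓝[≠] 0) (𝓝 (-(2 * π * Complex.I)⁻¹)) := by
    have h1 := hder.tendsto_slope_zero.inv₀ (by simp [pi_ne_zero])
    rw [← neg_inv] at h1
    refine h1.congr fun u => ?_
    rw [hterm]
    simp [mul_comm]
  have hrest : Tendsto (fun u => u * ∑' n, if n = 0 then 0 else appellTerm n u v τ)
      (𝓝[≠] 0) (𝓝 0) := by
    refine squeeze_zero_norm' (a := fun u => ‖u‖ * ∑' n, |B n|) ?_ ?_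
    · filter_upwards [hc.eventually hb] with u hu
      rw [norm_mul]
      gcongr
      refine tsum_of_norm_bounded hB.abs.hasSum fun n => ?_
      split_ifs with h
      · simp
      · exact (hu n (hne n h)).1.trans (le_abs_self _)
    · have : Tendsto (fun u : ℂ => ‖u‖ * ∑' n, |B n|) (𝓝 0) (𝓝 (‖(0 : ℂ)‖ * ∑' n, |B n|)) := by
        refine Continuous.tendsto ?_ 0
        fun_prop
      rw [norm_zero, zero_mul] at this
      exact this.mono_left nhdsWithin_le_nhds
  have hsum := hlim.add hrest
  rw [add_zero] at hsum
  refine hsum.congr' ?_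
  filter_upwards [hc.eventually hb] with u hu
  have hs : Summable fun n => appellTerm n u v τ := by
    refine Summable.of_norm_bounded_eventually hB ?_
    filter_upwards [eventually_cofinite_ne (0 : ℤ)] with n hn using (hu n (hne n hn)).1
  rw [← mul_add, appell, hs.tsum_eq_add_tsum_ite 0]

/-! ### Elliptic transformations -/

lemma appell_add_one (u v τ : ℂ) : appell (u + 1) v τ = appell u v τ := by
  refine tsum_congr fun n => ?_
  rw [appellTerm, appellTerm, show 2 * (π : ℂ) * Complex.I * n * τ + 2 * π * Complex.I * (u + 1)
    = 2 * π * Complex.I * n * τ + 2 * π * Complex.I * u + 2 * π * Complex.I by ring,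
    Complex.exp_periodic]

lemma appellNum_add_one (n : ℤ) (v τ : ℂ) : appellNum n (v + 1) τ = appellNum n v τ := by
  rw [appellNum, appellNum]
  congr 1
  exact Complex.exp_eq_exp_iff_exists_int.2 ⟨n, by ring⟩

lemma appellNum_succ (n : ℤ) (v τ : ℂ) : appellNum (n + 1) v τ =
    -appellNum n v τ * Complex.exp (2 * π * Complex.I * (n + 1) * τ + 2 * π * Complex.I * v) := by
  rw [appellNum, appellNum, zpow_add_one₀ (by norm_num), neg_mul, mul_assoc _ (Complex.exp _),
    ← Complex.exp_add, mul_assoc, neg_one_mul, mul_neg]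
  congr 3
  push_cast
  ring

lemma appell_add_tau {u v τ : ℂ} (hτ : 0 < τ.im) (hu : ¬ IsLatticePoint τ u) :
    appell (u + τ) v τ = (∑' n, appellNum n v τ)
      - Complex.exp (2 * π * Complex.I * (u - v)) * appell u v τ := by
  have hs := summable_appellTerm v hτ hu
  have hs' : Summable fun n => appellTerm (n + 1) u v τ :=
    (Equiv.addRight (1 : ℤ)).summable_iff.2 hs
  have h1 : appell u v τ = ∑' n, appellTerm (n + 1) u v τ :=
    ((Equiv.addRight (1 : ℤ)).tsum_eq fun n => appellTerm n u v τ).symm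
  rw [h1, ← tsum_mul_left, ← (summable_appellNum v hτ).tsum_sub (hs'.mul_left _), appell]
  refine tsum_congr fun n => ?_
  have hd := exp_ne_one_of_not_lattice hu (n + 1)
  rw [appellTerm, appellTerm, appellNum_succ,
    show 2 * (π : ℂ) * Complex.I * n * τ + 2 * π * Complex.I * (u + τ)
      = 2 * π * Complex.I * (n + 1 : ℤ) * τ + 2 * π * Complex.I * u by push_cast; ring]
  have hd' : 1 - Complex.exp (2 * π * Complex.I * (n + 1 : ℤ) * τ + 2 * π * Complex.I * u) ≠ 0 :=
    sub_ne_zero.2 hd.symm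
  have he : Complex.exp (2 * π * Complex.I * (n + 1 : ℤ) * τ + 2 * π * Complex.I * u) =
      Complex.exp (2 * π * Complex.I * (u - v)) *
      Complex.exp (2 * π * Complex.I * (n + 1) * τ + 2 * π * Complex.I * v) := by
    rw [← Complex.exp_add]; congr 1; push_cast; ring
  rw [he] at hd' ⊢
  generalize Complex.exp (2 * π * Complex.I * (u - v)) = X at hd' ⊢
  generalize Complex.exp (2 * π * Complex.I * (n + 1) * τ + 2 * π * Complex.I * v) = Y at hd' ⊢
  field_simp
  ring

lemma appell_snd_add_tau {u v τ : ℂ} (hτ : 0 < τ.im) (hu : ¬ IsLatticePoint τ u) :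
    appell u (v + τ) τ = Complex.exp (-(2 * π * Complex.I * u)) *
      (appell u v τ - ∑' n, appellNum n v τ) := by
  rw [appell, appell, ← (summable_appellTerm v hτ hu).tsum_sub (summable_appellNum v hτ),
    ← tsum_mul_left]
  refine tsum_congr fun n => ?_
  have hd' : 1 - Complex.exp (2 * π * Complex.I * n * τ + 2 * π * Complex.I * u) ≠ 0 :=
    sub_ne_zero.2 (exp_ne_one_of_not_lattice hu n).symm
  have he : appellNum n (v + τ) τ = appellNum n v τ * (Complex.exp (-(2 * π * Complex.I * u)) *
      Complex.exp (2 * π * Complex.I * n * τ + 2 * π * Complex.I * u)) := by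
    rw [appellNum, appellNum, ← Complex.exp_add, mul_assoc ((-1 : ℂ) ^ n), ← Complex.exp_add]
    congr 2; ring
  rw [appellTerm, appellTerm, he]
  generalize Complex.exp (2 * π * Complex.I * n * τ + 2 * π * Complex.I * u) = X at hd' ⊢
  field_simp
  ring

lemma zwegersR_add_one (w τ : ℂ) : zwegersR (w + 1) τ = -zwegersR w τ := by
  rw [zwegersR_eq, zwegersR_eq, ← tsum_neg]
  refine tsum_congr fun n => ?_
  have h : Complex.exp (rExp n (w + 1, τ)) = -Complex.exp (rExp n (w, τ)) := by
    rw [← Complex.exp_add_pi_mul_I]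
    refine Complex.exp_eq_exp_iff_exists_int.2 ⟨-n - 1, ?_⟩
    simp only [rExp]
    push_cast
    ring
  rw [rTerm, rTerm, h]
  simp [rArg]

lemma sign_half_sub (n : ℤ) : Real.sign ((n : ℝ) + 1 / 2) - Real.sign ((n : ℝ) - 1 / 2) =
    if n = 0 then 2 else 0 := by
  rcases lt_trichotomy n 0 with h | h | h
  · have : (n : ℝ) ≤ -1 := by exact_mod_cast Int.le_sub_one_of_lt h
    rw [Real.sign_of_neg (by linarith), Real.sign_of_neg (by linarith)]
    simp [h.ne]
  · rw [h]; norm_num [Real.sign_of_pos, Real.sign_of_neg]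
  · have : (1 : ℝ) ≤ n := by exact_mod_cast h
    rw [Real.sign_of_pos (by linarith), Real.sign_of_pos (by linarith)]
    simp [h.ne']

lemma zwegersR_add_tau (w : ℂ) {τ : ℂ} (hτ : 0 < τ.im) : zwegersR (w + τ) τ =
    2 * Complex.exp (π * Complex.I * w + 3 * π * Complex.I * τ / 4)
      - Complex.exp (π * Complex.I * τ + 2 * π * Complex.I * w) * zwegersR w τ := by
  have hs := summable_rTerm 0 (p := (w, τ)) hτ
  have h1 : zwegersR (w + τ) τ = ∑' n, rTerm 0 (n - 1) (w + τ, τ) := by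
    rw [zwegersR_eq]
    exact ((Equiv.subRight (1 : ℤ)).tsum_eq fun n => rTerm 0 n (w + τ, τ)).symm
  have h2 : ∀ n : ℤ, rTerm 0 (n - 1) (w + τ, τ) =
      (if n = 0 then 2 * Complex.exp (π * Complex.I * w + 3 * π * Complex.I * τ / 4) else 0)
      - Complex.exp (π * Complex.I * τ + 2 * π * Complex.I * w) * rTerm 0 n (w, τ) := by
    intro n
    have ha : rArg (n - 1) (w + τ, τ) = rArg n (w, τ) := by
      simp only [rArg, Complex.add_im]
      push_cast
      rw [add_div, div_self hτ.ne']
      ring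
    have hE : Complex.exp (rExp (n - 1) (w + τ, τ)) =
        Complex.exp (π * Complex.I * τ + 2 * π * Complex.I * w) * Complex.exp (rExp n (w, τ)) := by
      rw [← Complex.exp_add]
      congr 1
      simp only [rExp]
      push_cast
      ring
    have hsg : Real.sign (((n - 1 : ℤ) : ℝ) + 1 / 2) = Real.sign ((n : ℝ) + 1 / 2)
        - if n = 0 then 2 else 0 := by
      rw [← sign_half_sub]
      push_cast
      ring_nf
    rw [rTerm, rTerm, ha, hE, hsg, zpow_sub_one₀ (by norm_num)]
    split_ifs with h
    · subst h
      have : Complex.exp (π * Complex.I * w + 3 * π * Complex.I * τ / 4) =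
          Complex.exp (π * Complex.I * τ + 2 * π * Complex.I * w) * Complex.exp (rExp 0 (w, τ)) := by
        rw [← Complex.exp_add]
        congr 1
        simp only [rExp]
        push_cast
        ring
      rw [this]
      push_cast
      norm_num
      ring
    · push_cast
      norm_num
      ring
  rw [h1, zwegersR_eq, ← tsum_mul_left]
  simp only [h2]
  rw [Summable.tsum_sub _ (hs.mul_left _), tsum_ite_eq]
  exact (hasSum_ite_eq (0 : ℤ) _).summable

lemma zwegersR_sub_tau (w : ℂ) {τ : ℂ} (hτ : 0 < τ.im) : zwegersR (w - τ) τ =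
    2 * Complex.exp (-π * Complex.I * w + 3 * π * Complex.I * τ / 4)
      - Complex.exp (π * Complex.I * τ - 2 * π * Complex.I * w) * zwegersR w τ := by
  have h := zwegersR_add_tau (w - τ) hτ
  rw [sub_add_cancel] at h
  have e1 : Complex.exp (π * Complex.I * τ - 2 * π * Complex.I * w) *
      Complex.exp (π * Complex.I * τ + 2 * π * Complex.I * (w - τ)) = 1 := by
    rw [← Complex.exp_add, ← Complex.exp_zero]; congr 1; ring
  have e2 : Complex.exp (π * Complex.I * τ - 2 * π * Complex.I * w) *
      Complex.exp (π * Complex.I * (w - τ) + 3 * π * Complex.I * τ / 4) =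
      Complex.exp (-π * Complex.I * w + 3 * π * Complex.I * τ / 4) := by
    rw [← Complex.exp_add]; congr 1; ring
  rw [h]
  linear_combination -zwegersR (w - τ) τ * e1 + 2 * e2

lemma muTilde_add_one (u v τ : ℂ) : muTilde (u + 1) v τ = -muTilde u v τ := by
  rw [muTilde, muTilde, mu_eq, mu_eq, appell_add_one, show u + 1 - v = u - v + 1 by ring,
    zwegersR_add_one, show (π : ℂ) * Complex.I * (u + 1) = π * Complex.I * u + π * Complex.I by ring,
    Complex.exp_add_pi_mul_I]
  ring

lemma muTilde_snd_add_one (u v τ : ℂ) : muTilde u (v + 1) τ = -muTilde u v τ := by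
  have h := zwegersR_add_one (u - (v + 1)) τ
  rw [show u - (v + 1) + 1 = u - v by ring] at h
  have h2 : appell u (v + 1) τ = appell u v τ := by
    simp only [appell, appellTerm, appellNum_add_one]
  rw [muTilde, muTilde, mu_eq, mu_eq, theta_add_one, h2, h]
  ring

lemma muTilde_add_tau {u v τ : ℂ} (hτ : 0 < τ.im) (hu : ¬ IsLatticePoint τ u)
    (hv : jacobiTheta v τ ≠ 0) : muTilde (u + τ) v τ =
      -Complex.exp (π * Complex.I * τ + 2 * π * Complex.I * (u - v)) * muTilde u v τ := by
  rw [muTilde, muTilde, mu_eq, mu_eq, appell_add_tau hτ hu, tsum_appellNum,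
    show u + τ - v = u - v + τ by ring, zwegersR_add_tau _ hτ]
  have e1 : Complex.exp (π * Complex.I * (u - v) + 3 * π * Complex.I * τ / 4) =
      Complex.exp (π * Complex.I * (u + τ)) * Complex.exp (-(π * Complex.I * (τ / 4 + v))) := by
    rw [← Complex.exp_add]; congr 1; ring
  have e2 : Complex.exp (π * Complex.I * (u + τ)) =
      Complex.exp (π * Complex.I * τ) * Complex.exp (π * Complex.I * u) := by
    rw [← Complex.exp_add]; congr 1; ring
  rw [e1, e2, Complex.exp_add (π * Complex.I * τ)]
  field_simp
  ring

lemma muTilde_snd_add_tau {u v τ : ℂ} (hτ : 0 < τ.im) (hu : ¬ IsLatticePoint τ u)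
    (hv : jacobiTheta v τ ≠ 0) : muTilde u (v + τ) τ =
      -Complex.exp (π * Complex.I * τ - 2 * π * Complex.I * (u - v)) * muTilde u v τ := by
  rw [muTilde, muTilde, mu_eq, mu_eq, appell_snd_add_tau hτ hu, tsum_appellNum,
    show u - (v + τ) = u - v - τ by ring, zwegersR_sub_tau _ hτ, theta_add_tau]
  have e1 : Complex.exp (-π * Complex.I * (u - v) + 3 * π * Complex.I * τ / 4) =
      Complex.exp (π * Complex.I * τ - 2 * π * Complex.I * (u - v)) *
      Complex.exp (π * Complex.I * u) * Complex.exp (-(π * Complex.I * (τ / 4 + v))) := by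
    rw [← Complex.exp_add, ← Complex.exp_add]; congr 1; ring
  have e2 : Complex.exp (-(2 * π * Complex.I * u)) =
      Complex.exp (π * Complex.I * τ - 2 * π * Complex.I * (u - v)) *
      Complex.exp (-π * Complex.I * τ - 2 * π * Complex.I * v) := by
    rw [← Complex.exp_add]; congr 1; ring
  have h0 := Complex.exp_ne_zero (-π * Complex.I * τ - 2 * π * Complex.I * v)
  rw [e1, e2]
  generalize Complex.exp (-π * Complex.I * τ - 2 * π * Complex.I * v) = X at h0
  generalize Complex.exp (π * Complex.I * τ - 2 * π * Complex.I * (u - v)) = Y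
  field_simp
  ring

/-! ### Elliptic functions without poles -/

lemma eventually_not_lattice {τ u : ℂ} (hτ : 0 < τ.im) (hu : ¬ IsLatticePoint τ u) :
    ∀ᶠ x in 𝓝 u, ¬ IsLatticePoint τ x := by
  obtain ⟨δ, hδ, h⟩ := exists_den_bound u hτ
  have hc : Tendsto (fun x : ℂ => (x, τ)) (𝓝 u) (𝓝 (u, τ)) := by
    have : Continuous (fun x : ℂ => (x, τ)) := by fun_prop
    exact this.tendsto u
  filter_upwards [hc.eventually h] with x hx
  rintro ⟨m, n, hmn⟩
  have h1 := hx (-m) (exp_ne_one_of_not_lattice hu (-m))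
  have h2 : Complex.exp (2 * π * Complex.I * (-m : ℤ) * τ + 2 * π * Complex.I * x) = 1 :=
    (exp_eq_one_iff_lattice _ _ _).2 ⟨n, by push_cast; rw [hmn]; ring⟩
  simp only [h2, sub_self, norm_zero] at h1
  linarith

lemma eventually_lattice_eq_zero {τ : ℂ} (hτ : 0 < τ.im) :
    ∀ᶠ x in 𝓝 (0 : ℂ), IsLatticePoint τ x → x = 0 := by
  have hpos : (0 : ℝ) < min 1 τ.im := lt_min one_pos hτ
  filter_upwards [Metric.ball_mem_nhds (0 : ℂ) hpos] with x hx
  rintro ⟨m, n, rfl⟩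
  rw [mem_ball_zero_iff, lt_min_iff] at hx
  have him := (Complex.abs_im_le_norm _).trans_lt hx.2
  have hm : m = 0 := by
    by_contra hm
    have h1 : (1 : ℝ) ≤ |(m : ℝ)| := by exact_mod_cast Int.one_le_abs hm
    simp [abs_mul, abs_of_pos hτ] at him
    nlinarith
  have hre := hx.1
  subst hm
  have hn : n = 0 := by
    by_contra hn
    have h1 : (1 : ℝ) ≤ |(n : ℝ)| := by exact_mod_cast Int.one_le_abs hn
    simp at hre
    linarith
  simp [hn]

lemma elliptic_entire_const {g : ℂ → ℂ} {τ : ℂ} (hτ : 0 < τ.im) (hd : Differentiable ℂ g)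
    (h1 : Function.Periodic g 1) (h2 : Function.Periodic g τ) (z w : ℂ) : g z = g w := by
  refine hd.apply_eq_apply_of_bounded ?_ z w
  have hK : IsCompact ((fun p : ℝ × ℝ => (p.1 : ℂ) + p.2 * τ) '' (Icc 0 1 ×ˢ Icc 0 1)) :=
    (isCompact_Icc.prod isCompact_Icc).image (by fun_prop)
  refine (hK.image hd.continuous).isBounded.subset ?_
  rintro _ ⟨u, rfl⟩
  set y : ℝ := u.im / τ.im
  set x : ℝ := u.re - y * τ.re
  have hu : u = x + y * τ := by
    apply Complex.ext
    · simp [x]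
    · simp [y, hτ.ne']
  refine ⟨(Int.fract x : ℝ) + (Int.fract y : ℝ) * τ, ⟨(Int.fract x, Int.fract y),
    ⟨⟨Int.fract_nonneg _, (Int.fract_lt_one _).le⟩,
      ⟨Int.fract_nonneg _, (Int.fract_lt_one _).le⟩⟩, rfl⟩, ?_⟩
  have e : u = (Int.fract x : ℝ) + (Int.fract y : ℝ) * τ + ((⌊x⌋ : ℤ) : ℂ) * 1
      + ((⌊y⌋ : ℤ) : ℂ) * τ := by
    rw [hu]
    simp only [Int.fract]
    push_cast
    ring
  conv_rhs => rw [e, h2.int_mul, h1.int_mul]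

/-- A doubly periodic function, holomorphic off the lattice and with at most removable
singularities, is constant. -/
lemma elliptic_const {f : ℂ → ℂ} {τ : ℂ} (hτ : 0 < τ.im)
    (hd : ∀ u, ¬ IsLatticePoint τ u → DifferentiableAt ℂ f u)
    (h1 : ∀ u, ¬ IsLatticePoint τ u → f (u + 1) = f u)
    (h2 : ∀ u, ¬ IsLatticePoint τ u → f (u + τ) = f u)
    (h0 : Tendsto (fun u => u * f u) (𝓝[≠] 0) (𝓝 0)) {z w : ℂ}
    (hz : ¬ IsLatticePoint τ z) (hw : ¬ IsLatticePoint τ w) : f z = f w := by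
  classical
  set c := limUnder (𝓝[≠] 0) f
  set g : ℂ → ℂ := fun u => if IsLatticePoint τ u then c else f u
  have hl1 : ∀ u, IsLatticePoint τ (u + 1) ↔ IsLatticePoint τ u := fun u => by
    simpa using isLatticePoint_add_int_iff (τ := τ) (u := u) 0 1
  have hl2 : ∀ u, IsLatticePoint τ (u + τ) ↔ IsLatticePoint τ u := fun u => by
    simpa using isLatticePoint_add_int_iff (τ := τ) (u := u) 1 0
  have g1 : Function.Periodic g 1 := by
    intro u
    by_cases hu : IsLatticePoint τ u
    · simp [g, hu, hl1]
    · simp [g, hu, hl1, h1 u hu]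
  have g2 : Function.Periodic g τ := by
    intro u
    by_cases hu : IsLatticePoint τ u
    · simp [g, hu, hl2]
    · simp [g, hu, hl2, h2 u hu]
  have hg0 : DifferentiableAt ℂ g 0 := by
    obtain ⟨s, hs, hso, h0s⟩ := eventually_nhds_iff.1 (eventually_lattice_eq_zero hτ)
    have hnot : ∀ x ∈ s \ {0}, ¬ IsLatticePoint τ x := fun x hx hl => hx.2 (hs x hx.1 hl)
    have hs' : s ∈ 𝓝 (0 : ℂ) := hso.mem_nhds h0s
    have key := Complex.differentiableOn_update_limUnder_of_isLittleO (f := f) (c := 0) hs'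
      (fun x hx => (hd x (hnot x hx)).differentiableWithinAt) ?_
    · refine (key.differentiableAt hs').congr_of_eventuallyEq ?_
      filter_upwards [hs'] with x hx
      by_cases hx0 : x = 0
      · simp [g, hx0, isLatticePoint_zero, c]
      · simp [g, hnot x ⟨hx, hx0⟩, hx0]
    · rw [isLittleO_iff_tendsto']
      · have hlin : Tendsto (fun u : ℂ => u * f 0) (𝓝[≠] 0) (𝓝 (0 * f 0)) :=
          ((continuous_id.mul continuous_const).tendsto (0 : ℂ)).mono_left nhdsWithin_le_nhds
        have := h0.sub hlin
        simp only [zero_mul, sub_zero] at this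
        refine this.congr fun u => ?_
        simp only [sub_zero, div_inv_eq_mul]
        ring
      · filter_upwards [self_mem_nhdsWithin] with u hu h
        simp at h
        exact absurd h hu
  have hg : Differentiable ℂ g := by
    intro u
    by_cases hu : IsLatticePoint τ u
    · obtain ⟨m, n, rfl⟩ := hu
      have e : g = fun x => g (x - (m * τ + n)) := by
        ext x
        have : x = x - (m * τ + n) + m * τ + n * 1 := by ring
        conv_lhs => rw [this, g1.int_mul, g2.int_mul]
      rw [e]
      refine DifferentiableAt.comp (g := g) (f := fun x => x - (m * τ + n)) _ ?_ (by fun_prop)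
      simpa using hg0
    · refine (hd u hu).congr_of_eventuallyEq ?_
      filter_upwards [eventually_not_lattice hτ hu] with x hx
      simp [g, hx]
  have := elliptic_entire_const hτ hg g1 g2 z w
  simpa [g, hz, hw] using this

lemma theta_neg (z τ : ℂ) : jacobiTheta (-z) τ = -jacobiTheta z τ := by
  have h := jacobiTheta₂_add_left' (z - 1 / 2 - τ / 2 + 1) τ
  rw [jacobiTheta₂_add_left, ← jacobiTheta₂_neg_left (z - 1 / 2 - τ / 2),
    show z - 1 / 2 - τ / 2 + 1 + τ = z + 1 / 2 + τ / 2 by ring,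
    show -(z - 1 / 2 - τ / 2) = -z + 1 / 2 + τ / 2 by ring] at h
  rw [theta_eq, theta_eq, h, ← mul_assoc, ← Complex.exp_add, ← neg_mul, ← Complex.exp_add_pi_mul_I]
  congr 1
  exact Complex.exp_eq_exp_iff_exists_int.2 ⟨0, by push_cast; ring⟩

lemma eventually_theta_sub_ne_zero (v u₀ : ℂ) {τ : ℂ} (hτ : 0 < τ.im) :
    ∀ᶠ u in 𝓝[≠] u₀, jacobiTheta (u - v) τ ≠ 0 := by
  by_contra h
  rw [not_eventually] at h
  simp only [not_not] at h
  have hd : Differentiable ℂ fun u => jacobiTheta (u - v) τ :=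
    (differentiable_theta hτ).comp (differentiable_id.sub_const v)
  have han : AnalyticOnNhd ℂ (fun u => jacobiTheta (u - v) τ) univ :=
    hd.differentiableOn.analyticOnNhd isOpen_univ
  have hz := han.eqOn_zero_of_preconnected_of_frequently_eq_zero isPreconnected_univ
    (mem_univ u₀) h
  obtain ⟨z, hz'⟩ := exists_theta_ne_zero hτ
  have := hz (mem_univ (z + v))
  simp at this
  exact hz' this

/-- Functions with the elliptic behaviour of `u ↦ μ̃(u, v; τ)` and no poles vanish; a form that
does not presuppose the location of the zeros of `θ`. -/
lemma mul_theta_eq_zero {f : ℂ → ℂ} {v τ : ℂ} (hτ : 0 < τ.im) (hv : ¬ IsLatticePoint τ v)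
    (hd : ∀ u, ¬ IsLatticePoint τ u → DifferentiableAt ℂ f u)
    (h1 : ∀ u, ¬ IsLatticePoint τ u → f (u + 1) = -f u)
    (h2 : ∀ u, ¬ IsLatticePoint τ u →
      f (u + τ) = -Complex.exp (π * Complex.I * τ + 2 * π * Complex.I * (u - v)) * f u)
    (h0 : Tendsto (fun u => u * f u * jacobiTheta (u - v) τ) (𝓝[≠] 0) (𝓝 0)) {u : ℂ}
    (hu : ¬ IsLatticePoint τ u) : f u * jacobiTheta (u - v) τ = 0 := by
  have hth := (differentiable_theta hτ).comp (differentiable_id.sub_const v)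
  have key := elliptic_const (f := fun u => f u * jacobiTheta (u - v) τ) hτ
    (fun u hu => (hd u hu).mul (hth u)) (fun u hu => ?_) (fun u hu => ?_)
    (by simpa only [mul_assoc] using h0) hu hv
  · simpa [theta_zero] using key
  · rw [h1 u hu, show u + 1 - v = u - v + 1 by ring, theta_add_one]
    ring
  · rw [h2 u hu, show u + τ - v = u - v + τ by ring, theta_add_tau]
    have : Complex.exp (π * Complex.I * τ + 2 * π * Complex.I * (u - v)) *
        Complex.exp (-π * Complex.I * τ - 2 * π * Complex.I * (u - v)) = 1 := by
      rw [← Complex.exp_add, ← Complex.exp_zero]; congr 1; ring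
    linear_combination f u * jacobiTheta (u - v) τ * this

/-- The theta function vanishes only at lattice points. -/
lemma theta_ne_zero {v τ : ℂ} (hτ : 0 < τ.im) (hv : ¬ IsLatticePoint τ v) :
    jacobiTheta v τ ≠ 0 := by
  intro hz
  have hres := tendsto_mul_appell v hτ
  have hev : ∀ᶠ u in 𝓝[≠] (0 : ℂ), u * appell u v τ = 0 := by
    filter_upwards [eventually_theta_sub_ne_zero v 0 hτ, self_mem_nhdsWithin,
      nhdsWithin_le_nhds (eventually_lattice_eq_zero hτ)] with u h1 h2 h3
    have h4 : ¬ IsLatticePoint τ u := fun h => h2 (h3 h)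
    have := mul_theta_eq_zero (f := fun u => Complex.exp (π * Complex.I * u) * appell u v τ) hτ hv
      (fun u hu => ?_) (fun u hu => ?_) (fun u hu => ?_) ?_ h4
    · simpa [h1, Complex.exp_ne_zero] using Or.inr (a := u = 0)
        (by simpa [h1, Complex.exp_ne_zero] using this)
    · exact DifferentiableAt.mul (by fun_prop) (differentiableAt_appell (f := fun x => x)
        (g := fun _ => v) (h := fun _ => τ) (Eventually.of_forall fun _ => differentiableAt_id)
        (Eventually.of_forall fun _ => differentiableAt_const _)
        (Eventually.of_forall fun _ => differentiableAt_const _) hτ hu)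
    · rw [appell_add_one, show (π : ℂ) * Complex.I * (u + 1) = π * Complex.I * u + π * Complex.I
        by ring, Complex.exp_add_pi_mul_I]
      ring
    · rw [appell_add_tau hτ hu, tsum_appellNum, hz, show (π : ℂ) * Complex.I * (u + τ) =
        π * Complex.I * u + π * Complex.I * τ by ring, Complex.exp_add, Complex.exp_add]
      ring
    · have hc : Tendsto (fun u : ℂ => Complex.exp (π * Complex.I * u) * jacobiTheta (u - v) τ)
          (𝓝[≠] 0) (𝓝 (Complex.exp (π * Complex.I * 0) * jacobiTheta (0 - v) τ)) := by
        refine Tendsto.mono_left (Continuous.tendsto ?_ 0) nhdsWithin_le_nhds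
        exact (by fun_prop : Continuous fun u : ℂ => Complex.exp (π * Complex.I * u)).mul
          ((differentiable_theta hτ).continuous.comp (continuous_id.sub continuous_const))
      have := hres.mul hc
      rw [zero_sub, theta_neg, hz, neg_zero, mul_zero, mul_zero] at this
      refine this.congr fun u => ?_
      ring
  have h0 : Tendsto (fun u => u * appell u v τ) (𝓝[≠] 0) (𝓝 0) :=
    tendsto_const_nhds.congr' (hev.mono fun u hu => hu.symm)
  have := tendsto_nhds_unique hres h0
  simp [pi_ne_zero] at this

lemma eq_zero_of_elliptic {f : ℂ → ℂ} {v τ : ℂ} (hτ : 0 < τ.im) (hv : ¬ IsLatticePoint τ v)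
    (hd : ∀ u, ¬ IsLatticePoint τ u → DifferentiableAt ℂ f u)
    (h1 : ∀ u, ¬ IsLatticePoint τ u → f (u + 1) = -f u)
    (h2 : ∀ u, ¬ IsLatticePoint τ u →
      f (u + τ) = -Complex.exp (π * Complex.I * τ + 2 * π * Complex.I * (u - v)) * f u)
    (h0 : Tendsto (fun u => u * f u) (𝓝[≠] 0) (𝓝 0)) {u : ℂ}
    (hu : ¬ IsLatticePoint τ u) : f u = 0 := by
  have h0' : Tendsto (fun u => u * f u * jacobiTheta (u - v) τ) (𝓝[≠] 0) (𝓝 0) := by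
    have hc : Tendsto (fun u : ℂ => jacobiTheta (u - v) τ) (𝓝[≠] 0) (𝓝 (jacobiTheta (0 - v) τ)) :=
      Tendsto.mono_left (Continuous.tendsto ((differentiable_theta hτ).continuous.comp
        (continuous_id.sub continuous_const)) 0) nhdsWithin_le_nhds
    simpa using h0.mul hc
  have hev : ∀ᶠ x in 𝓝[≠] u, f x = 0 := by
    filter_upwards [eventually_theta_sub_ne_zero v u hτ,
      nhdsWithin_le_nhds (eventually_not_lattice hτ hu)] with x hx hl
    exact (mul_eq_zero.1 (mul_theta_eq_zero hτ hv hd h1 h2 h0' hl)).resolve_right hx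
  exact tendsto_nhds_unique ((hd u hu).continuousAt.tendsto.mono_left nhdsWithin_le_nhds)
    (tendsto_const_nhds.congr' (hev.mono fun x hx => hx.symm))

/-! ### Modular transformations of `μ̃` -/

lemma continuousAt_zwegersR (w : ℂ) {τ : ℂ} (hτ : 0 < τ.im) :
    ContinuousAt (fun w => zwegersR w τ) w := by
  obtain ⟨A, hA, -⟩ := zwegersR_curve (hasDerivAt_id w) (hasDerivAt_const w τ) hτ
  exact hA.continuousAt

lemma tendsto_mul_muTilde (v : ℂ) {τ : ℂ} (hτ : 0 < τ.im) :
    Tendsto (fun u => u * muTilde u v τ) (𝓝[≠] 0)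
      (𝓝 (-(2 * π * Complex.I)⁻¹ / jacobiTheta v τ)) := by
  have h1 : Tendsto (fun u : ℂ => Complex.exp (π * Complex.I * u) / jacobiTheta v τ) (𝓝[≠] 0)
      (𝓝 (Complex.exp (π * Complex.I * 0) / jacobiTheta v τ)) :=
    Tendsto.mono_left (Continuous.tendsto (by fun_prop) 0) nhdsWithin_le_nhds
  have h2 : Tendsto (fun u : ℂ => u * (Complex.I / 2 * zwegersR (u - v) τ)) (𝓝[≠] 0)
      (𝓝 (0 * (Complex.I / 2 * zwegersR (0 - v) τ))) := by
    refine Tendsto.mono_left (ContinuousAt.tendsto ?_) nhdsWithin_le_nhds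
    have : ContinuousAt (fun u => zwegersR (u - v) τ) 0 :=
      ContinuousAt.comp (g := fun w => zwegersR w τ) (f := fun u => u - v)
        (continuousAt_zwegersR (0 - v) hτ) (by fun_prop)
    exact continuousAt_id.mul (continuousAt_const.mul this)
  have h3 := ((tendsto_mul_appell v hτ).mul h1).add h2
  rw [mul_zero, Complex.exp_zero, zero_mul, add_zero, mul_one_div] at h3
  refine h3.congr fun u => ?_
  rw [muTilde, mu_eq]
  ring

lemma neg_inv_im_pos {τ : ℂ} (hτ : 0 < τ.im) : 0 < (-1 / τ).im := by
  have h0 : τ ≠ 0 := by rintro rfl; simp at hτ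
  rw [neg_div, one_div, Complex.neg_im, Complex.inv_im]
  have := Complex.normSq_pos.2 h0
  rw [neg_div, neg_neg]
  positivity

lemma cpow_half_sq (z : ℂ) : (z ^ (1 / 2 : ℂ)) ^ 2 = z := by
  rw [one_div]
  exact Complex.cpow_nat_inv_pow z two_ne_zero

lemma differentiableAt_of_antilinear_eq_zero {f : ℂ → ℂ} {A : ℂ →L[ℝ] ℂ} {z : ℂ}
    (hA : HasFDerivAt f A z) (h : A 1 + Complex.I * A Complex.I = 0) : DifferentiableAt ℂ f z := by
  rw [differentiableAt_complex_iff_differentiableAt_real]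
  refine ⟨hA.differentiableAt, ?_⟩
  rw [hA.fderiv, smul_eq_mul]
  linear_combination -Complex.I * h + A Complex.I * Complex.I_sq

lemma im_sq_div_add (w : ℂ) {τ : ℂ} (hτ : 0 < τ.im) :
    (w ^ 2 / τ).im + (w / τ).im ^ 2 / (-1 / τ).im = w.im ^ 2 / τ.im := by
  have h0 : τ ≠ 0 := by rintro rfl; simp at hτ
  have hn : 0 < Complex.normSq τ := Complex.normSq_pos.2 h0
  have hn' : Complex.normSq τ = τ.re ^ 2 + τ.im ^ 2 := by rw [Complex.normSq_apply]; ring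
  rw [neg_div, one_div, Complex.neg_im, Complex.inv_im, Complex.div_im, Complex.div_im, pow_two w,
    Complex.mul_im, Complex.mul_re, neg_div, neg_neg]
  field_simp
  rw [hn']
  ring

/-- The sum of `R` and its transform under `τ ↦ -1/τ` is entire. -/
lemma differentiable_zwegersR_add {τ : ℂ} (hτ : 0 < τ.im) :
    Differentiable ℂ fun w => Complex.exp (π * Complex.I * w ^ 2 / τ) * zwegersR (w / τ) (-1 / τ)
      + (-Complex.I * τ) ^ (1 / 2 : ℂ) * zwegersR w τ := by
  intro w
  have h0 : τ ≠ 0 := by rintro rfl; simp at hτ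
  have hτ' := neg_inv_im_pos hτ
  set s := (-Complex.I * τ) ^ (1 / 2 : ℂ) with hs
  have hs2 : s ^ 2 = -Complex.I * τ := cpow_half_sq _
  obtain ⟨A₁, hA₁, hA₁'⟩ := zwegersR_curve ((hasDerivAt_id w).div_const τ)
    (hasDerivAt_const w (-1 / τ)) hτ'
  obtain ⟨A₂, hA₂, hA₂'⟩ := zwegersR_curve (hasDerivAt_id w) (hasDerivAt_const w τ) hτ
  have he : DifferentiableAt ℂ (fun w : ℂ => Complex.exp (π * Complex.I * w ^ 2 / τ)) w := by
    fun_prop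
  obtain ⟨c, hc⟩ : ∃ c, HasDerivAt (fun w : ℂ => Complex.exp (π * Complex.I * w ^ 2 / τ)) c w :=
    ⟨_, he.hasDerivAt⟩
  have hD := ((hc.hasFDerivAt.restrictScalars ℝ).mul hA₁).add (hA₂.const_mul s)
  refine differentiableAt_of_antilinear_eq_zero hD ?_
  have hG₁ := tsum_gTerm_zero (w / τ) hτ'
  have hG₂ := tsum_gTerm_zero w hτ
  have hI := im_sq_div_add w hτ
  rw [theta_neg_inv w h0, ← hs] at hG₁
  simp only [id, map_zero, mul_zero, zero_add, sub_zero, hG₁, map_div₀, map_one] at hA₁'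
  simp only [id, map_zero, mul_zero, zero_add, sub_zero, hG₂, map_one, mul_one] at hA₂'
  set e := Complex.exp (π * Complex.I * w ^ 2 / τ)
  have hee : e * (starRingEnd ℂ) e * rexp (-2 * π * (w / τ).im ^ 2 / (-1 / τ).im) =
      rexp (-2 * π * w.im ^ 2 / τ.im) := by
    have : ‖e‖ = rexp (-π * (w ^ 2 / τ).im) := by
      rw [Complex.norm_exp]
      congr 1
      rw [show (π : ℂ) * Complex.I * w ^ 2 / τ = (π : ℝ) * (w ^ 2 / τ * Complex.I) by ring,
        Complex.re_ofReal_mul, Complex.mul_I_re]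
      ring
    rw [Complex.mul_conj, Complex.normSq_eq_norm_sq, this, ← exp_nat_mul, ← Complex.ofReal_mul,
      ← exp_add]
    congr 2
    rw [mul_div_assoc, mul_div_assoc, ← hI]
    push_cast
    ring
  have hss : s * (starRingEnd ℂ) s = ‖τ‖ := by
    rw [Complex.mul_conj, Complex.normSq_eq_norm_sq, ← norm_pow, hs2]
    simp
  have hs2' : (starRingEnd ℂ) s ^ 2 = Complex.I * (starRingEnd ℂ) τ := by
    rw [← map_pow, hs2]; simp
  have hv : √(2 * (-1 / τ).im) * ‖τ‖ = √(2 * τ.im) := by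
    rw [← Real.sqrt_sq (norm_nonneg τ), ← Real.sqrt_mul (by positivity)]
    congr 1
    rw [neg_div, one_div, Complex.neg_im, Complex.inv_im, Complex.normSq_eq_norm_sq]
    have : ‖τ‖ ≠ 0 := norm_ne_zero_iff.2 h0
    field_simp
  have hv1 : (√(2 * (-1 / τ).im) : ℂ) ≠ 0 := by
    have : 0 < √(2 * (-1 / τ).im) := by positivity
    exact_mod_cast this.ne'
  have hn0 : (‖τ‖ : ℂ) ≠ 0 := by exact_mod_cast norm_ne_zero_iff.2 h0
  have hc0 : (starRingEnd ℂ) τ ≠ 0 := (map_ne_zero _).2 h0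
  have hv2 : (√(2 * τ.im) : ℂ) = √(2 * (-1 / τ).im) * ‖τ‖ := by exact_mod_cast hv.symm
  rw [hv2, ← hee] at hA₂'
  have hlin : e * (A₁ 1 + Complex.I * A₁ Complex.I) + s * (A₂ 1 + Complex.I * A₂ Complex.I) = 0 := by
    rw [hA₁', hA₂']
    simp only [map_mul, map_neg, Complex.conj_I, neg_neg]
    generalize (√(2 * (-1 / τ).im) : ℂ) = X at hv1
    have key : (‖τ‖ : ℂ) * (starRingEnd ℂ) s = s * Complex.I * (starRingEnd ℂ) τ := by
      rw [← hss]; linear_combination s * hs2'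
    generalize (rexp (-2 * π * (w / τ).im ^ 2 / (-1 / τ).im) : ℂ) = r
    generalize (starRingEnd ℂ) e = e₁
    generalize (starRingEnd ℂ) (jacobiTheta w τ) = θ₁
    field_simp
    linear_combination (-4 * (e * r * e₁ * θ₁) * Complex.I ^ 3) * key
      + (-4 * (e * r * e₁ * θ₁) * s * (starRingEnd ℂ) τ * Complex.I ^ 2) * Complex.I_sq
  simp
  linear_combination hlin + zwegersR (w / τ) (-1 / τ) * c * Complex.I_sq

lemma isLatticePoint_neg_inv {τ u : ℂ} (h0 : τ ≠ 0) :
    IsLatticePoint (-1 / τ) (u / τ) ↔ IsLatticePoint τ u := by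
  constructor
  · rintro ⟨m, n, h⟩
    refine ⟨n, -m, ?_⟩
    field_simp at h
    push_cast
    linear_combination h
  · rintro ⟨m, n, h⟩
    refine ⟨-n, m, ?_⟩
    field_simp
    push_cast
    linear_combination h

lemma differentiableAt_mu {u v τ : ℂ} (hτ : 0 < τ.im) (hu : ¬ IsLatticePoint τ u) :
    DifferentiableAt ℂ (fun u => mu u v τ) u := by
  simp only [mu_eq]
  exact DifferentiableAt.mul (by fun_prop) (differentiableAt_appell (f := fun x => x)
        (g := fun _ => v) (h := fun _ => τ) (Eventually.of_forall fun _ => differentiableAt_id)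
        (Eventually.of_forall fun _ => differentiableAt_const _)
        (Eventually.of_forall fun _ => differentiableAt_const _) hτ hu)

lemma muTilde_neg_inv_add {u v τ : ℂ} (hτ : 0 < τ.im) (hu : ¬ IsLatticePoint τ u)
    (hv : ¬ IsLatticePoint τ v) :
    Complex.exp (π * Complex.I * (u - v) ^ 2 / τ) * muTilde (u / τ) (v / τ) (-1 / τ)
      + (-Complex.I * τ) ^ (1 / 2 : ℂ) * muTilde u v τ = 0 := by
  have h0 : τ ≠ 0 := by rintro rfl; simp at hτ
  have hτ' := neg_inv_im_pos hτ
  have hv' := theta_ne_zero hτ' (mt (isLatticePoint_neg_inv h0).1 hv)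
  have hθ := theta_ne_zero hτ hv
  refine eq_zero_of_elliptic (f := fun u =>
    Complex.exp (π * Complex.I * (u - v) ^ 2 / τ) * muTilde (u / τ) (v / τ) (-1 / τ)
      + (-Complex.I * τ) ^ (1 / 2 : ℂ) * muTilde u v τ) hτ hv (fun u hu => ?_) (fun u hu => ?_)
      (fun u hu => ?_) ?_ hu
  · have e : (fun u => Complex.exp (π * Complex.I * (u - v) ^ 2 / τ) *
        muTilde (u / τ) (v / τ) (-1 / τ) + (-Complex.I * τ) ^ (1 / 2 : ℂ) * muTilde u v τ) =
      fun u => (Complex.exp (π * Complex.I * (u - v) ^ 2 / τ) * mu (u / τ) (v / τ) (-1 / τ)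
        + (-Complex.I * τ) ^ (1 / 2 : ℂ) * mu u v τ) + Complex.I / 2 *
        (Complex.exp (π * Complex.I * (u - v) ^ 2 / τ) * zwegersR ((u - v) / τ) (-1 / τ)
      + (-Complex.I * τ) ^ (1 / 2 : ℂ) * zwegersR (u - v) τ) := by
      ext u
      rw [muTilde, muTilde, sub_div]
      ring
    rw [e]
    refine DifferentiableAt.add (DifferentiableAt.add (DifferentiableAt.mul (by fun_prop) ?_)
      ((differentiableAt_mu hτ hu).const_mul _)) ?_
    · exact DifferentiableAt.comp (g := fun u => mu u (v / τ) (-1 / τ)) (f := fun u => u / τ) u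
        (differentiableAt_mu hτ' (mt (isLatticePoint_neg_inv h0).1 hu)) (by fun_prop)
    · exact DifferentiableAt.const_mul (DifferentiableAt.comp (f := fun u => u - v) u
        (differentiable_zwegersR_add hτ (u - v)) (by fun_prop)) _
  · have hu1 : ¬ IsLatticePoint τ (u + 1) := by
      have := isLatticePoint_add_int_iff (τ := τ) (u := u) 0 1
      simp at this
      rwa [this]
    have h1 := muTilde_add_tau (u := (u + 1) / τ) hτ' (mt (isLatticePoint_neg_inv h0).1 hu1) hv'
    rw [show (u + 1) / τ + -1 / τ = u / τ by ring] at h1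
    rw [muTilde_add_one, h1, show Complex.exp (π * Complex.I * (u + 1 - v) ^ 2 / τ) =
      Complex.exp (π * Complex.I * (u - v) ^ 2 / τ) *
      Complex.exp (π * Complex.I * (-1 / τ) + 2 * π * Complex.I * ((u + 1) / τ - v / τ)) by
        rw [← Complex.exp_add]; congr 1; field_simp; ring]
    ring
  · rw [muTilde_add_tau hτ hu hθ, add_div, div_self h0, muTilde_add_one,
      show Complex.exp (π * Complex.I * (u + τ - v) ^ 2 / τ) =
      Complex.exp (π * Complex.I * (u - v) ^ 2 / τ) *
      Complex.exp (π * Complex.I * τ + 2 * π * Complex.I * (u - v)) by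
        rw [← Complex.exp_add]; congr 1; field_simp; ring]
    ring
  · have l1 := (tendsto_mul_muTilde v hτ).const_mul ((-Complex.I * τ) ^ (1 / 2 : ℂ))
    have l2 : Tendsto (fun u : ℂ => u / τ) (𝓝[≠] 0) (𝓝[≠] 0) := by
      refine tendsto_nhdsWithin_iff.2 ⟨?_, ?_⟩
      · have : Tendsto (fun u : ℂ => u / τ) (𝓝 0) (𝓝 (0 / τ)) :=
          Continuous.tendsto (by fun_prop) 0
        rw [zero_div] at this
        exact this.mono_left nhdsWithin_le_nhds
      · filter_upwards [self_mem_nhdsWithin] with u hu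
        exact div_ne_zero hu h0
    have l3 := ((tendsto_mul_muTilde (v / τ) hτ').comp l2).const_mul τ
    have l4 : Tendsto (fun u : ℂ => Complex.exp (π * Complex.I * (u - v) ^ 2 / τ)) (𝓝[≠] 0)
      (𝓝 (Complex.exp (π * Complex.I * (0 - v) ^ 2 / τ))) :=
      Tendsto.mono_left (Continuous.tendsto (by fun_prop) 0) nhdsWithin_le_nhds
    have l5 := (l4.mul l3).add l1
    have hs2 := cpow_half_sq (-Complex.I * τ)
    have hs0 : (-Complex.I * τ) ^ (1 / 2 : ℂ) ≠ 0 := by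
      intro h
      rw [h] at hs2
      simp [h0] at hs2
    have hz : Complex.exp (π * Complex.I * (0 - v) ^ 2 / τ) *
        (τ * (-(2 * π * Complex.I)⁻¹ / jacobiTheta (v / τ) (-1 / τ))) +
        (-Complex.I * τ) ^ (1 / 2 : ℂ) * (-(2 * π * Complex.I)⁻¹ / jacobiTheta v τ) = 0 := by
      rw [theta_neg_inv v h0, zero_sub, neg_sq]
      have he := Complex.exp_ne_zero (π * Complex.I * v ^ 2 / τ)
      generalize Complex.exp (π * Complex.I * v ^ 2 / τ) = X at he
      generalize (-Complex.I * τ) ^ (1 / 2 : ℂ) = s at hs2 hs0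
      have hpi : (π : ℂ) ≠ 0 := by simp [pi_ne_zero]
      field_simp
      rw [hs2]
      linear_combination τ * Complex.I_sq
    rw [hz] at l5
    refine l5.congr fun u => ?_
    simp only [Function.comp]
    field_simp

lemma muTilde_neg_inv {u v τ : ℂ} (hτ : 0 < τ.im) (hu : ¬ IsLatticePoint τ u)
    (hv : ¬ IsLatticePoint τ v) : muTilde (u / τ) (v / τ) (-1 / τ) =
      -(-Complex.I * τ) ^ (1 / 2 : ℂ) * Complex.exp (-(π * Complex.I * (u - v) ^ 2 / τ))
        * muTilde u v τ := by
  have h := muTilde_neg_inv_add hτ hu hv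
  have e : Complex.exp (-(π * Complex.I * (u - v) ^ 2 / τ)) *
      Complex.exp (π * Complex.I * (u - v) ^ 2 / τ) = 1 := by
    rw [← Complex.exp_add]; simp
  linear_combination Complex.exp (-(π * Complex.I * (u - v) ^ 2 / τ)) * h
    - muTilde (u / τ) (v / τ) (-1 / τ) * e

lemma muTilde_tau_add_one (u v τ : ℂ) : muTilde u v (τ + 1) =
    Complex.exp (-(π * Complex.I / 4)) * muTilde u v τ := by
  have h1 : appell u v (τ + 1) = appell u v τ := by
    refine tsum_congr fun n => ?_
    obtain ⟨m, hm⟩ := Int.even_mul_succ_self n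
    have hm' : (n : ℂ) * (n + 1) = m + m := by exact_mod_cast hm
    have e1 : appellNum n v (τ + 1) = appellNum n v τ := by
      rw [appellNum, appellNum]
      congr 1
      refine Complex.exp_eq_exp_iff_exists_int.2 ⟨m, ?_⟩
      linear_combination (π : ℂ) * Complex.I * hm'
    have e2 : Complex.exp (2 * π * Complex.I * n * (τ + 1) + 2 * π * Complex.I * u) =
        Complex.exp (2 * π * Complex.I * n * τ + 2 * π * Complex.I * u) :=
      Complex.exp_eq_exp_iff_exists_int.2 ⟨n, by ring⟩
    rw [appellTerm, appellTerm, e1, e2]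
  have h2 : zwegersR (u - v) (τ + 1) =
      Complex.exp (-(π * Complex.I / 4)) * zwegersR (u - v) τ := by
    rw [zwegersR_eq, zwegersR_eq, ← tsum_mul_left]
    refine tsum_congr fun n => ?_
    obtain ⟨m, hm⟩ := Int.even_mul_succ_self n
    have hm' : (n : ℂ) * (n + 1) = m + m := by exact_mod_cast hm
    have e1 : Complex.exp (rExp n (u - v, τ + 1)) =
        Complex.exp (-(π * Complex.I / 4)) * Complex.exp (rExp n (u - v, τ)) := by
      rw [← Complex.exp_add]
      refine Complex.exp_eq_exp_iff_exists_int.2 ⟨-m, ?_⟩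
      simp only [rExp]
      push_cast
      linear_combination -(π : ℂ) * Complex.I * hm'
    rw [rTerm, rTerm, e1]
    simp only [rArg, Complex.add_im, Complex.one_im, add_zero]
    ring
  rw [muTilde, muTilde, mu_eq, mu_eq, h1, h2, theta_tau_add_one, Complex.exp_neg]
  have := Complex.exp_ne_zero (π * Complex.I / 4)
  field_simp

/-! ### The automorphy factor and its square root -/

lemma coe_smul_eq (γ : SL(2, ℤ)) (τ : ℍ) : ((γ • τ : ℍ) : ℂ) =
    (((γ 0 0 : ℤ) : ℂ) * τ + ((γ 0 1 : ℤ) : ℂ)) / autFactor γ τ := by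
  rw [UpperHalfPlane.coe_specialLinearGroup_apply]
  simp [autFactor]

lemma det_eq (γ : SL(2, ℤ)) : ((γ 0 0 : ℤ) : ℂ) * ((γ 1 1 : ℤ) : ℂ)
    - ((γ 0 1 : ℤ) : ℂ) * ((γ 1 0 : ℤ) : ℂ) = 1 := by
  have := γ.det_coe
  rw [Matrix.det_fin_two] at this
  exact_mod_cast this

lemma autFactor_ne_zero (γ : SL(2, ℤ)) (τ : ℍ) : autFactor γ τ ≠ 0 :=
  UpperHalfPlane.denom_ne_zero (γ : GL (Fin 2) ℝ) τ

lemma entries_mul (γ₁ γ₂ : SL(2, ℤ)) (i j : Fin 2) : (((γ₁ * γ₂) i j : ℤ) : ℂ) =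
    ((γ₁ i 0 : ℤ) : ℂ) * ((γ₂ 0 j : ℤ) : ℂ) + ((γ₁ i 1 : ℤ) : ℂ) * ((γ₂ 1 j : ℤ) : ℂ) := by
  simp [Matrix.mul_apply, Fin.sum_univ_two]

lemma autFactor_mul (γ₁ γ₂ : SL(2, ℤ)) (τ : ℍ) :
    autFactor (γ₁ * γ₂) τ = autFactor γ₁ (γ₂ • τ) * autFactor γ₂ τ := by
  have h := autFactor_ne_zero γ₂ τ
  have e : autFactor γ₁ (γ₂ • τ) * autFactor γ₂ τ = ((γ₁ 1 0 : ℤ) : ℂ) *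
      (((γ₂ 0 0 : ℤ) : ℂ) * τ + ((γ₂ 0 1 : ℤ) : ℂ)) + ((γ₁ 1 1 : ℤ) : ℂ) * autFactor γ₂ τ := by
    rw [autFactor, coe_smul_eq]
    field_simp
  rw [e, autFactor, autFactor, entries_mul, entries_mul]
  ring

lemma autFactor_one (τ : ℍ) : autFactor 1 τ = 1 := by simp [autFactor]

/-- The principal square root of the automorphy factor. -/
noncomputable def sqrtAut (γ : SL(2, ℤ)) (τ : ℍ) : ℂ := autFactor γ τ ^ (((1 / 2 : ℝ) : ℝ) : ℂ)

lemma sqrtAut_sq (γ : SL(2, ℤ)) (τ : ℍ) : sqrtAut γ τ ^ 2 = autFactor γ τ := by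
  rw [sqrtAut, show (((1 / 2 : ℝ) : ℝ) : ℂ) = 1 / 2 by push_cast; rfl, cpow_half_sq]

lemma sqrtAut_ne_zero (γ : SL(2, ℤ)) (τ : ℍ) : sqrtAut γ τ ≠ 0 := by
  intro h
  have := sqrtAut_sq γ τ
  rw [h] at this
  exact autFactor_ne_zero γ τ (by rw [← this]; simp)

lemma continuous_sqrtAut (γ : SL(2, ℤ)) : Continuous (sqrtAut γ) := by
  have hc : Continuous (autFactor γ) := by
    unfold autFactor
    exact (continuous_const.mul UpperHalfPlane.continuous_coe).add continuous_const
  by_cases h : γ 1 0 = 0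
  · have : sqrtAut γ = fun _ => ((γ 1 1 : ℤ) : ℂ) ^ (((1 / 2 : ℝ) : ℝ) : ℂ) := by
      ext τ; simp [sqrtAut, autFactor, h]
    rw [this]
    exact continuous_const
  · refine hc.cpow continuous_const fun τ => ?_
    right
    simpa [autFactor] using ⟨h, τ.im_pos.ne'⟩

lemma eq_const_mul_of_sq_eq {f g : ℍ → ℂ} (hf : Continuous f) (hg : Continuous g)
    (h : ∀ τ, f τ ^ 2 = g τ ^ 2) (h0 : ∀ τ, g τ ≠ 0) :
    ∃ ε : ℂ, ε ^ 2 = 1 ∧ ‖ε‖ = 1 ∧ ∀ τ, f τ = ε * g τ := by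
  rcases isPreconnected_univ.eq_or_eq_neg_of_sq_eq hf.continuousOn hg.continuousOn
    (fun τ _ => h τ) (fun _ => h0 _) with h | h
  · exact ⟨1, by simp, by simp, fun τ => by simpa using h (mem_univ τ)⟩
  · exact ⟨-1, by simp, by simp, fun τ => by simpa using h (mem_univ τ)⟩

lemma continuous_smul_SL (γ : SL(2, ℤ)) : Continuous fun τ : ℍ => γ • τ :=
  continuous_const_smul (γ : GL (Fin 2) ℝ)

lemma exists_sqrtAut_mul (γ₁ γ₂ : SL(2, ℤ)) : ∃ ε : ℂ, ε ^ 2 = 1 ∧ ‖ε‖ = 1 ∧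
    ∀ τ, sqrtAut γ₁ (γ₂ • τ) * sqrtAut γ₂ τ = ε * sqrtAut (γ₁ * γ₂) τ :=
  eq_const_mul_of_sq_eq
    (((continuous_sqrtAut γ₁).comp (continuous_smul_SL γ₂)).mul (continuous_sqrtAut γ₂))
    (continuous_sqrtAut _)
    (fun τ => by rw [mul_pow, sqrtAut_sq, sqrtAut_sq, sqrtAut_sq, autFactor_mul])
    (sqrtAut_ne_zero _)

/-! ### Jacobi-type transformation laws of weight `1/2` -/

section Law

variable {E : Type*} [AddCommGroup E] [Module ℂ E]

/-- `Φ` transforms under `γ` like a Jacobi form of weight `1/2` with multiplier `χ` and index form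
`Q`, at the points of `D`. -/
def TransformsWith (Q : E → ℂ) (D : E → ℍ → Prop) (Φ : E → ℍ → ℂ) (γ : SL(2, ℤ)) (χ : ℂ) : Prop :=
  ∀ (τ : ℍ) (x : E), D x τ → Φ ((autFactor γ τ)⁻¹ • x) (γ • τ) =
    χ * sqrtAut γ τ * Complex.exp (-(π * Complex.I * ((γ 1 0 : ℤ) : ℂ) * Q x / autFactor γ τ))
      * Φ x τ

variable {Q : E → ℂ} {D : E → ℍ → Prop} {Φ : E → ℍ → ℂ}

lemma TransformsWith.comp (hQ : ∀ (c : ℂ) x, Q (c • x) = c ^ 2 * Q x) {γ₁ γ₂ : SL(2, ℤ)}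
    {χ₁ χ₂ : ℂ} (hD : ∀ τ x, D x τ → D ((autFactor γ₂ τ)⁻¹ • x) (γ₂ • τ))
    (h₁ : TransformsWith Q D Φ γ₁ χ₁) (h₂ : TransformsWith Q D Φ γ₂ χ₂) {τ : ℍ} {x : E}
    (hx : D x τ) : Φ ((autFactor (γ₁ * γ₂) τ)⁻¹ • x) ((γ₁ * γ₂) • τ) =
      χ₁ * χ₂ * (sqrtAut γ₁ (γ₂ • τ) * sqrtAut γ₂ τ) *
      Complex.exp (-(π * Complex.I * (((γ₁ * γ₂) 1 0 : ℤ) : ℂ) * Q x / autFactor (γ₁ * γ₂) τ))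
      * Φ x τ := by
  have j₁ := autFactor_ne_zero γ₁ (γ₂ • τ)
  have j₂ := autFactor_ne_zero γ₂ τ
  have e := h₁ (γ₂ • τ) _ (hD τ x hx)
  rw [h₂ τ x hx, smul_smul, ← mul_inv, ← autFactor_mul, smul_smul] at e
  rw [e, hQ]
  have hexp : Complex.exp (-(π * Complex.I * (((γ₁ * γ₂) 1 0 : ℤ) : ℂ) * Q x /
      autFactor (γ₁ * γ₂) τ)) =
      Complex.exp (-(π * Complex.I * ((γ₁ 1 0 : ℤ) : ℂ) * ((autFactor γ₂ τ)⁻¹ ^ 2 * Q x) /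
        autFactor γ₁ (γ₂ • τ))) *
      Complex.exp (-(π * Complex.I * ((γ₂ 1 0 : ℤ) : ℂ) * Q x / autFactor γ₂ τ)) := by
    rw [← Complex.exp_add]
    congr 1
    have key : (((γ₁ * γ₂) 1 0 : ℤ) : ℂ) * autFactor γ₂ τ = ((γ₁ 1 0 : ℤ) : ℂ)
        + ((γ₂ 1 0 : ℤ) : ℂ) * (autFactor γ₁ (γ₂ • τ) * autFactor γ₂ τ) := by
      rw [← autFactor_mul, autFactor, autFactor, entries_mul, entries_mul]
      linear_combination ((γ₁ 1 0 : ℤ) : ℂ) * det_eq γ₂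
    rw [autFactor_mul]
    field_simp
    linear_combination (-Q x) * key
  rw [hexp]
  ring

lemma TransformsWith.mul (hQ : ∀ (c : ℂ) x, Q (c • x) = c ^ 2 * Q x) {γ₁ γ₂ : SL(2, ℤ)}
    {χ₁ χ₂ : ℂ} (hD : ∀ τ x, D x τ → D ((autFactor γ₂ τ)⁻¹ • x) (γ₂ • τ))
    (h₁ : TransformsWith Q D Φ γ₁ χ₁) (h₂ : TransformsWith Q D Φ γ₂ χ₂) :
    ∃ ε : ℂ, ‖ε‖ = 1 ∧ TransformsWith Q D Φ (γ₁ * γ₂) (χ₁ * χ₂ * ε) := by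
  obtain ⟨ε, -, hε, h⟩ := exists_sqrtAut_mul γ₁ γ₂
  refine ⟨ε, hε, fun τ x hx => ?_⟩
  rw [h₁.comp hQ hD h₂ hx, h]
  ring

lemma TransformsWith.inv (hQ : ∀ (c : ℂ) x, Q (c • x) = c ^ 2 * Q x) {γ : SL(2, ℤ)}
    {χ : ℂ} (hχ : χ ≠ 0) (hD : ∀ τ x, D x τ → D ((autFactor γ⁻¹ τ)⁻¹ • x) (γ⁻¹ • τ))
    (h₁ : TransformsWith Q D Φ γ χ) :
    ∃ ε : ℂ, ‖ε‖ = 1 ∧ TransformsWith Q D Φ γ⁻¹ (χ⁻¹ * ε) := by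
  obtain ⟨ε, hε2, hε, h⟩ := exists_sqrtAut_mul γ γ⁻¹
  refine ⟨ε, hε, fun τ x hx => ?_⟩
  have hj := autFactor_mul γ γ⁻¹ τ
  rw [mul_inv_cancel, autFactor_one] at hj
  have hs := h τ
  have hone : sqrtAut 1 τ = 1 := by simp [sqrtAut, autFactor_one]
  rw [mul_inv_cancel, hone, mul_one] at hs
  have j₂ := autFactor_ne_zero γ⁻¹ τ
  have j₁ := autFactor_ne_zero γ (γ⁻¹ • τ)
  have e := h₁ (γ⁻¹ • τ) _ (hD τ x hx)
  rw [smul_smul, ← mul_inv, ← hj, inv_one, one_smul, smul_smul, mul_inv_cancel, one_smul, hQ] at e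
  have hc : ((γ⁻¹ 1 0 : ℤ) : ℂ) = -((γ 1 0 : ℤ) : ℂ) := by
    rw [Matrix.SpecialLinearGroup.SL2_inv_expl]; simp
  have hexp : Complex.exp (-(π * Complex.I * ((γ⁻¹ 1 0 : ℤ) : ℂ) * Q x / autFactor γ⁻¹ τ)) *
      Complex.exp (-(π * Complex.I * ((γ 1 0 : ℤ) : ℂ) * ((autFactor γ⁻¹ τ)⁻¹ ^ 2 * Q x) /
        autFactor γ (γ⁻¹ • τ))) = 1 := by
    rw [← Complex.exp_add, ← Complex.exp_zero]
    congr 1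
    have : autFactor γ (γ⁻¹ • τ) = (autFactor γ⁻¹ τ)⁻¹ := eq_inv_of_mul_eq_one_left hj.symm
    rw [hc, this]
    field_simp
    ring
  rw [e]
  generalize Complex.exp (-(π * Complex.I * ((γ⁻¹ 1 0 : ℤ) : ℂ) * Q x / autFactor γ⁻¹ τ)) = X at hexp ⊢
  generalize Complex.exp (-(π * Complex.I * ((γ 1 0 : ℤ) : ℂ) * ((autFactor γ⁻¹ τ)⁻¹ ^ 2 * Q x) /
        autFactor γ (γ⁻¹ • τ))) = Y at hexp ⊢
  generalize Φ ((autFactor γ⁻¹ τ)⁻¹ • x) (γ⁻¹ • τ) = Z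
  have : χ⁻¹ * χ = 1 := inv_mul_cancel₀ hχ
  calc Z = (χ⁻¹ * χ) * ε ^ 2 * (X * Y) * Z := by rw [this, hε2, hexp]; ring
    _ = _ := by rw [pow_two]; nth_rewrite 2 [← hs]; ring

lemma cocycle_of_transforms (hQ : ∀ (c : ℂ) x, Q (c • x) = c ^ 2 * Q x) {γ₁ γ₂ : SL(2, ℤ)}
    {χ₁ χ₂ χ₃ : ℂ} (hD : ∀ τ x, D x τ → D ((autFactor γ₂ τ)⁻¹ • x) (γ₂ • τ))
    (h₁ : TransformsWith Q D Φ γ₁ χ₁) (h₂ : TransformsWith Q D Φ γ₂ χ₂)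
    (h₃ : TransformsWith Q D Φ (γ₁ * γ₂) χ₃) {τ : ℍ} (hne : ∃ x, D x τ ∧ Φ x τ ≠ 0) :
    χ₃ * sqrtAut (γ₁ * γ₂) τ = χ₁ * sqrtAut γ₁ (γ₂ • τ) * (χ₂ * sqrtAut γ₂ τ) := by
  obtain ⟨x, hx, hne⟩ := hne
  have e := (h₃ τ x hx).symm.trans (h₁.comp hQ hD h₂ hx)
  have e' := mul_right_cancel₀ (Complex.exp_ne_zero _) (mul_right_cancel₀ hne e)
  rw [e']
  ring

end Law

/-! ### Transformation of `μ̃` under `SL₂(ℤ)` -/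

lemma isLatticePoint_smul {γ : SL(2, ℤ)} {τ : ℍ} {u : ℂ} :
    IsLatticePoint (γ • τ : ℍ) ((autFactor γ τ)⁻¹ * u) ↔ IsLatticePoint τ u := by
  have hj := autFactor_ne_zero γ τ
  have hd := det_eq γ
  constructor
  · rintro ⟨m, n, h⟩
    refine ⟨m * γ 0 0 + n * γ 1 0, m * γ 0 1 + n * γ 1 1, ?_⟩
    rw [coe_smul_eq] at h
    field_simp at h
    rw [h, autFactor]
    push_cast
    ring
  · rintro ⟨m, n, h⟩
    refine ⟨m * γ 1 1 - n * γ 1 0, -m * γ 0 1 + n * γ 0 0, ?_⟩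
    rw [coe_smul_eq]
    field_simp
    rw [h, autFactor]
    push_cast
    linear_combination (-m * τ - n) * hd

/-- The points at which `μ̃(u, v; τ)` is given by its series. -/
def Regular (x : ℂ × ℂ) (τ : ℍ) : Prop := ¬ IsLatticePoint τ x.1 ∧ ¬ IsLatticePoint τ x.2

lemma regular_smul {γ : SL(2, ℤ)} {τ : ℍ} {x : ℂ × ℂ} (h : Regular x τ) :
    Regular ((autFactor γ τ)⁻¹ • x) (γ • τ) :=
  ⟨mt isLatticePoint_smul.1 h.1, mt isLatticePoint_smul.1 h.2⟩

lemma transforms_S : ∃ χ : ℂ, ‖χ‖ = 1 ∧ TransformsWith (fun x : ℂ × ℂ => (x.1 - x.2) ^ 2) Regular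
    (fun x τ => muTilde x.1 x.2 τ) ModularGroup.S χ := by
  have ha : ∀ τ : ℍ, autFactor ModularGroup.S τ = τ := by
    intro τ; simp [autFactor, ModularGroup.S]
  have hc : ModularGroup.S 1 0 = 1 := by simp [ModularGroup.S]
  have hcont : Continuous fun τ : ℍ => (-Complex.I * (τ : ℂ)) ^ (1 / 2 : ℂ) := by
    refine Continuous.cpow (continuous_const.mul UpperHalfPlane.continuous_coe) continuous_const
      fun τ => ?_
    left
    simpa using τ.im_pos
  have hsq : ∀ τ : ℍ, ((-Complex.I * (τ : ℂ)) ^ (1 / 2 : ℂ)) ^ 2 =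
      (Complex.exp (-(π / 4 * Complex.I)) * sqrtAut ModularGroup.S τ) ^ 2 := fun τ => by
    rw [cpow_half_sq, mul_pow, sqrtAut_sq, ha, ← Complex.exp_nat_mul,
      show ((2 : ℕ) : ℂ) * (-(π / 4 * Complex.I)) = -(π * Complex.I * (1 / 2)) by push_cast; ring,
      exp_neg_pi_I_half]
  obtain ⟨ε, -, hε, h⟩ := eq_const_mul_of_sq_eq hcont
    (continuous_const.mul (continuous_sqrtAut _)) hsq
    (fun τ => mul_ne_zero (Complex.exp_ne_zero _) (sqrtAut_ne_zero _ _))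
  refine ⟨-ε * Complex.exp (-(π / 4 * Complex.I)), ?_, fun τ x hx => ?_⟩
  · rw [norm_mul, norm_neg, hε, Complex.norm_exp]
    simp
  · have e := muTilde_neg_inv τ.im_pos hx.1 hx.2
    have hS : ((ModularGroup.S • τ : ℍ) : ℂ) = -1 / τ := by
      rw [coe_smul_eq, ha]; simp [ModularGroup.S]
    simp only [ha, hc, Prod.smul_fst, Prod.smul_snd, smul_eq_mul, hS, ← div_eq_inv_mul]
    rw [e, h τ, Pi.mul_apply]
    push_cast
    ring_nf

lemma transforms_T : ∃ χ : ℂ, ‖χ‖ = 1 ∧ TransformsWith (fun x : ℂ × ℂ => (x.1 - x.2) ^ 2) Regular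
    (fun x τ => muTilde x.1 x.2 τ) ModularGroup.T χ := by
  have ha : ∀ τ : ℍ, autFactor ModularGroup.T τ = 1 := by
    intro τ; simp [autFactor, ModularGroup.T]
  have hc : ModularGroup.T 1 0 = 0 := by simp [ModularGroup.T]
  refine ⟨Complex.exp (-(π * Complex.I / 4)), ?_, fun τ x hx => ?_⟩
  · rw [Complex.norm_exp]
    simp
  · have hT : ((ModularGroup.T • τ : ℍ) : ℂ) = τ + 1 := by
      rw [coe_smul_eq, ha]; simp [ModularGroup.T]
    simp only [ha, hc, sqrtAut, hT, inv_one, one_smul, muTilde_tau_add_one]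
    simp

lemma exists_transforms (γ : SL(2, ℤ)) : ∃ χ : ℂ, ‖χ‖ = 1 ∧
    TransformsWith (fun x : ℂ × ℂ => (x.1 - x.2) ^ 2) Regular
      (fun x τ => muTilde x.1 x.2 τ) γ χ := by
  have hQ : ∀ (c : ℂ) (x : ℂ × ℂ), ((c • x).1 - (c • x).2) ^ 2 = c ^ 2 * (x.1 - x.2) ^ 2 := by
    intro c x; simp; ring
  have hγ : γ ∈ Subgroup.closure {ModularGroup.S, ModularGroup.T} := by
    simp [SpecialLinearGroup.SL2Z_generators]
  induction hγ using Subgroup.closure_induction with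
  | mem g hg =>
    rcases hg with rfl | rfl
    · exact transforms_S
    · exact transforms_T
  | one =>
    refine ⟨1, by simp, fun τ x _ => ?_⟩
    simp [autFactor_one, sqrtAut]
  | mul g₁ g₂ _ _ h₁ h₂ =>
    obtain ⟨χ₁, n₁, t₁⟩ := h₁
    obtain ⟨χ₂, n₂, t₂⟩ := h₂
    obtain ⟨ε, hε, h⟩ := t₁.mul hQ (fun _ _ h => regular_smul h) t₂
    exact ⟨_, by simp [n₁, n₂, hε], h⟩
  | inv g _ h =>
    obtain ⟨χ, n, t⟩ := h
    obtain ⟨ε, hε, h⟩ := t.inv hQ (χ := χ) (by rintro rfl; simp at n) (fun _ _ h => regular_smul h)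
    exact ⟨_, by simp [n, hε], h⟩

/-! ### Translation by lattice points -/

lemma int_recursion_unique {g h : ℤ → ℂ} (r : ℤ → ℂ) (hr : ∀ k, r k ≠ 0)
    (hg : ∀ k, g (k + 1) = r k * g k) (hh : ∀ k, h (k + 1) = r k * h k) (h0 : g 0 = h 0) (k : ℤ) :
    g k = h k := by
  induction k using Int.induction_on with
  | zero => exact h0
  | succ k ih => rw [hg, hh, ih]
  | pred k ih =>
    have h1 := hg (-k - 1)
    have h2 := hh (-k - 1)
    rw [sub_add_cancel] at h1 h2
    exact mul_left_cancel₀ (hr _) (by rw [← h1, ← h2, ih])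

lemma muTilde_add_int (u v τ : ℂ) (l : ℤ) : muTilde (u + l) v τ = (-1) ^ l * muTilde u v τ :=
  int_recursion_unique (g := fun l : ℤ => muTilde (u + l) v τ)
    (h := fun l : ℤ => (-1) ^ l * muTilde u v τ) (fun _ => -1) (by simp)
    (fun k => by push_cast; rw [← add_assoc, muTilde_add_one]; ring)
    (fun k => by rw [zpow_add_one₀ (by norm_num)]; ring) (by simp) l

lemma muTilde_snd_add_int (u v τ : ℂ) (l : ℤ) : muTilde u (v + l) τ = (-1) ^ l * muTilde u v τ :=
  int_recursion_unique (g := fun l : ℤ => muTilde u (v + l) τ)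
    (h := fun l : ℤ => (-1) ^ l * muTilde u v τ) (fun _ => -1) (by simp)
    (fun k => by push_cast; rw [← add_assoc, muTilde_snd_add_one]; ring)
    (fun k => by rw [zpow_add_one₀ (by norm_num)]; ring) (by simp) l

lemma muTilde_tau_add_int (u v τ : ℂ) (l : ℤ) :
    muTilde u v (τ + l) = Complex.exp (-(π * Complex.I / 4)) ^ l * muTilde u v τ :=
  int_recursion_unique (g := fun l : ℤ => muTilde u v (τ + l))
    (h := fun l : ℤ => Complex.exp (-(π * Complex.I / 4)) ^ l * muTilde u v τ)
    (fun _ => Complex.exp (-(π * Complex.I / 4))) (fun _ => Complex.exp_ne_zero _)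
    (fun k => by push_cast; rw [← add_assoc, muTilde_tau_add_one])
    (fun k => by rw [zpow_add_one₀ (Complex.exp_ne_zero _)]; ring) (by simp) l

lemma muTilde_add_int_mul_tau {u v τ : ℂ} (hτ : 0 < τ.im) (hu : ¬ IsLatticePoint τ u)
    (hv : ¬ IsLatticePoint τ v) (k : ℤ) : muTilde (u + k * τ) v τ =
      (-1) ^ k * Complex.exp (π * Complex.I * (k ^ 2 * τ + 2 * k * (u - v))) * muTilde u v τ := by
  refine int_recursion_unique (g := fun k : ℤ => muTilde (u + k * τ) v τ)
    (h := fun k : ℤ => (-1) ^ k * Complex.exp (π * Complex.I * (k ^ 2 * τ + 2 * k * (u - v))) *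
      muTilde u v τ)
    (fun k => -Complex.exp (π * Complex.I * τ + 2 * π * Complex.I * (u + k * τ - v)))
    (fun k => neg_ne_zero.2 (Complex.exp_ne_zero _)) (fun k => ?_) (fun k => ?_) (by simp) k
  · have h : ¬ IsLatticePoint τ (u + k * τ) := by
      have := isLatticePoint_add_int_iff (τ := τ) (u := u) k 0
      simp at this
      rwa [this]
    rw [← muTilde_add_tau hτ h (theta_ne_zero hτ hv)]
    push_cast
    ring_nf
  · rw [zpow_add_one₀ (by norm_num), show (π : ℂ) * Complex.I * (((k + 1 : ℤ) : ℂ) ^ 2 * τ +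
      2 * ((k + 1 : ℤ) : ℂ) * (u - v)) = π * Complex.I * τ + 2 * π * Complex.I * (u + k * τ - v) +
      π * Complex.I * (k ^ 2 * τ + 2 * k * (u - v)) by push_cast; ring, Complex.exp_add]
    ring

lemma muTilde_snd_add_int_mul_tau {u v τ : ℂ} (hτ : 0 < τ.im) (hu : ¬ IsLatticePoint τ u)
    (hv : ¬ IsLatticePoint τ v) (k : ℤ) : muTilde u (v + k * τ) τ =
      (-1) ^ k * Complex.exp (π * Complex.I * (k ^ 2 * τ - 2 * k * (u - v))) * muTilde u v τ := by
  refine int_recursion_unique (g := fun k : ℤ => muTilde u (v + k * τ) τ)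
    (h := fun k : ℤ => (-1) ^ k * Complex.exp (π * Complex.I * (k ^ 2 * τ - 2 * k * (u - v))) *
      muTilde u v τ)
    (fun k => -Complex.exp (π * Complex.I * τ - 2 * π * Complex.I * (u - (v + k * τ))))
    (fun k => neg_ne_zero.2 (Complex.exp_ne_zero _)) (fun k => ?_) (fun k => ?_) (by simp) k
  · have h : ¬ IsLatticePoint τ (v + k * τ) := by
      have := isLatticePoint_add_int_iff (τ := τ) (u := v) k 0
      simp at this
      rwa [this]
    rw [← muTilde_snd_add_tau hτ hu (theta_ne_zero hτ h)]
    push_cast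
    ring_nf
  · rw [zpow_add_one₀ (by norm_num), show (π : ℂ) * Complex.I * (((k + 1 : ℤ) : ℂ) ^ 2 * τ -
      2 * ((k + 1 : ℤ) : ℂ) * (u - v)) = π * Complex.I * τ - 2 * π * Complex.I * (u - (v + k * τ)) +
      π * Complex.I * (k ^ 2 * τ - 2 * k * (u - v)) by push_cast; ring, Complex.exp_add]
    ring

/-- Translation of both arguments of `μ̃` by lattice points. -/
lemma muTilde_add_lattice {u v τ : ℂ} (hτ : 0 < τ.im) (hu : ¬ IsLatticePoint τ u)
    (hv : ¬ IsLatticePoint τ v) (k l m n : ℤ) :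
    muTilde (u + k * τ + l) (v + m * τ + n) τ = (-1) ^ (k + l + m + n) *
      Complex.exp (π * Complex.I * ((k - m) ^ 2 * τ + 2 * (k - m) * (u - v))) *
        muTilde u v τ := by
  have h : ¬ IsLatticePoint τ (v + m * τ) := by
    have := isLatticePoint_add_int_iff (τ := τ) (u := v) m 0
    simp at this
    rwa [this]
  rw [muTilde_add_int, muTilde_snd_add_int, muTilde_add_int_mul_tau hτ hu h,
    muTilde_snd_add_int_mul_tau hτ hu hv, zpow_add₀ (by norm_num), zpow_add₀ (by norm_num),
    zpow_add₀ (by norm_num), show (π : ℂ) * Complex.I * ((k - m) ^ 2 * τ + 2 * (k - m) * (u - v)) =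
    π * Complex.I * (k ^ 2 * τ + 2 * k * (u - (v + m * τ))) +
      π * Complex.I * (m ^ 2 * τ - 2 * m * (u - v)) by ring, Complex.exp_add]
  ring

/-! ### `μ̃` with real characteristics -/

/-- `a` and `b` are both integers. -/
def IsIntPair (a b : ℝ) : Prop := (∃ m : ℤ, a = m) ∧ ∃ n : ℤ, b = n

lemma isLatticePoint_real_iff {τ : ℂ} (hτ : 0 < τ.im) (a b : ℝ) :
    IsLatticePoint τ (a * τ + b) ↔ IsIntPair a b := by
  constructor
  · rintro ⟨m, n, h⟩
    have h1 := congrArg Complex.im h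
    have h2 := congrArg Complex.re h
    simp at h1 h2
    have h3 : a = m := by rcases h1 with h1 | h1 <;> [exact h1; exact absurd h1 hτ.ne']
    rw [h3] at h2
    exact ⟨⟨m, h3⟩, n, by linarith⟩
  · rintro ⟨⟨m, rfl⟩, n, rfl⟩
    exact ⟨m, n, by push_cast; ring⟩

/-- `e^{-πi(a₁-a₂)²τ} μ̃(a₁τ+b₁, a₂τ+b₂; τ)`. -/
noncomputable def muChar (a₁ b₁ a₂ b₂ : ℝ) (τ : ℂ) : ℂ :=
  Complex.exp (-(π * Complex.I * (a₁ - a₂) ^ 2 * τ)) * muTilde (a₁ * τ + b₁) (a₂ * τ + b₂) τ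

lemma isIntPair_smul {a b : ℝ} (γ : SL(2, ℤ))
    (h : IsIntPair (a * γ 0 0 + b * γ 1 0) (a * γ 0 1 + b * γ 1 1)) : IsIntPair a b := by
  have hd : ((γ 0 0 : ℤ) : ℝ) * ((γ 1 1 : ℤ) : ℝ) - ((γ 0 1 : ℤ) : ℝ) * ((γ 1 0 : ℤ) : ℝ) = 1 := by
    have := γ.det_coe
    rw [Matrix.det_fin_two] at this
    exact_mod_cast this
  obtain ⟨⟨m, hm⟩, n, hn⟩ := h
  refine ⟨⟨m * γ 1 1 - n * γ 1 0, ?_⟩, -m * γ 0 1 + n * γ 0 0, ?_⟩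
  · push_cast
    linear_combination ((γ 1 1 : ℤ) : ℝ) * hm - ((γ 1 0 : ℤ) : ℝ) * hn - a * hd
  · push_cast
    linear_combination -((γ 0 1 : ℤ) : ℝ) * hm + ((γ 0 0 : ℤ) : ℝ) * hn - b * hd

lemma norm_exp_pi_I_real (r : ℝ) : ‖Complex.exp (π * Complex.I * r)‖ = 1 := by
  rw [show (π : ℂ) * Complex.I * r = (π * r : ℝ) * Complex.I by push_cast; ring,
    Complex.norm_exp_ofReal_mul_I]

/-- `SL₂(ℤ)` acts on characteristics. -/
lemma exists_muChar_smul (γ : SL(2, ℤ)) {a₁ b₁ a₂ b₂ : ℝ} (h₁ : ¬ IsIntPair a₁ b₁)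
    (h₂ : ¬ IsIntPair a₂ b₂) : ∃ c : ℂ, ‖c‖ = 1 ∧ ∀ τ : ℍ, muChar a₁ b₁ a₂ b₂ (γ • τ : ℍ) =
      c * sqrtAut γ τ * muChar (a₁ * γ 0 0 + b₁ * γ 1 0) (a₁ * γ 0 1 + b₁ * γ 1 1)
        (a₂ * γ 0 0 + b₂ * γ 1 0) (a₂ * γ 0 1 + b₂ * γ 1 1) τ := by
  obtain ⟨χ, hχ, h⟩ := exists_transforms γ
  set κ : ℝ := -((a₁ - a₂) ^ 2 * γ 0 0 * γ 0 1 + 2 * (a₁ - a₂) * (b₁ - b₂) * γ 0 1 * γ 1 0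
    + (b₁ - b₂) ^ 2 * γ 1 0 * γ 1 1) with hκ
  refine ⟨χ * Complex.exp (π * Complex.I * κ), ?_, fun τ => ?_⟩
  · rw [norm_mul, hχ, norm_exp_pi_I_real, one_mul]
  have hj := autFactor_ne_zero γ τ
  have hd := det_eq γ
  have key := h τ ((a₁ * γ 0 0 + b₁ * γ 1 0 : ℝ) * τ + (a₁ * γ 0 1 + b₁ * γ 1 1 : ℝ),
    (a₂ * γ 0 0 + b₂ * γ 1 0 : ℝ) * τ + (a₂ * γ 0 1 + b₂ * γ 1 1 : ℝ))
    ⟨fun hl => h₁ (isIntPair_smul γ ((isLatticePoint_real_iff τ.im_pos _ _).1 hl)),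
     fun hl => h₂ (isIntPair_smul γ ((isLatticePoint_real_iff τ.im_pos _ _).1 hl))⟩
  have e : ∀ a b : ℝ, (autFactor γ τ)⁻¹ * ((a * γ 0 0 + b * γ 1 0 : ℝ) * τ +
      (a * γ 0 1 + b * γ 1 1 : ℝ)) = a * ((γ • τ : ℍ) : ℂ) + b := by
    intro a b
    rw [coe_smul_eq]
    field_simp
    rw [autFactor]
    push_cast
    ring
  simp only [Prod.smul_mk, smul_eq_mul, e] at key
  rw [muChar, key, muChar]
  have hexp : Complex.exp (-(π * Complex.I * (a₁ - a₂) ^ 2 * ((γ • τ : ℍ) : ℂ))) *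
      Complex.exp (-(π * Complex.I * ((γ 1 0 : ℤ) : ℂ) * ((a₁ * γ 0 0 + b₁ * γ 1 0 : ℝ) * τ +
        (a₁ * γ 0 1 + b₁ * γ 1 1 : ℝ) - ((a₂ * γ 0 0 + b₂ * γ 1 0 : ℝ) * τ +
        (a₂ * γ 0 1 + b₂ * γ 1 1 : ℝ))) ^ 2 / autFactor γ τ)) =
      Complex.exp (π * Complex.I * κ) * Complex.exp (-(π * Complex.I *
        (((a₁ * γ 0 0 + b₁ * γ 1 0 : ℝ) : ℂ) - (a₂ * γ 0 0 + b₂ * γ 1 0 : ℝ)) ^ 2 * τ)) := by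
    rw [← Complex.exp_add, ← Complex.exp_add]
    congr 1
    rw [coe_smul_eq, hκ]
    field_simp
    rw [autFactor]
    push_cast
    linear_combination ((a₁ - a₂) ^ 2 * (((γ 0 0 : ℤ) : ℂ) * τ + ((γ 0 1 : ℤ) : ℂ)) : ℂ) * hd
  linear_combination (χ * sqrtAut γ τ * muTilde ((a₁ * γ 0 0 + b₁ * γ 1 0 : ℝ) * τ +
    (a₁ * γ 0 1 + b₁ * γ 1 1 : ℝ)) ((a₂ * γ 0 0 + b₂ * γ 1 0 : ℝ) * τ +
    (a₂ * γ 0 1 + b₂ * γ 1 1 : ℝ)) τ) * hexp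

/-- Periodicity of `μ̃` with characteristics. -/
lemma exists_muChar_add_int {a₁ b₁ a₂ b₂ : ℝ} {s : ℤ} (h₁ : ∃ m : ℤ, a₁ * s = m)
    (h₂ : ∃ m : ℤ, a₂ * s = m) : ∃ c : ℂ, ‖c‖ = 1 ∧ ∀ τ : ℂ,
      muChar a₁ b₁ a₂ b₂ (τ + s) = c * muChar a₁ b₁ a₂ b₂ τ := by
  obtain ⟨m, hm⟩ := h₁
  obtain ⟨n, hn⟩ := h₂
  have hm' : (a₁ * s : ℂ) = m := by exact_mod_cast hm
  have hn' : (a₂ * s : ℂ) = n := by exact_mod_cast hn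
  refine ⟨Complex.exp (π * Complex.I * (-((a₁ - a₂) ^ 2 * s) : ℝ)) *
    ((-1) ^ m * ((-1) ^ n * Complex.exp (-(π * Complex.I / 4)) ^ s)), ?_, fun τ => ?_⟩
  · have : ‖Complex.exp (-(π * Complex.I / 4))‖ = 1 := by
      have := norm_exp_pi_I_real (-1 / 4)
      convert this using 3
      push_cast
      ring
    simp [norm_exp_pi_I_real, this, -Complex.ofReal_neg]
  · rw [muChar, muChar, muTilde_tau_add_int, show (a₁ : ℂ) * (τ + s) + b₁ = a₁ * τ + b₁ + m by
      rw [← hm']; ring, show (a₂ : ℂ) * (τ + s) + b₂ = a₂ * τ + b₂ + n by rw [← hn']; ring,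
      muTilde_add_int, muTilde_snd_add_int,
      show -(π * Complex.I * (a₁ - a₂ : ℂ) ^ 2 * (τ + s)) =
        π * Complex.I * (-((a₁ - a₂) ^ 2 * s) : ℝ) + -(π * Complex.I * (a₁ - a₂ : ℂ) ^ 2 * τ) by
        push_cast; ring, Complex.exp_add]
    ring

/-- Upper triangular representatives for the cosets of `diag(K, 1) γ`. -/
lemma exists_upper_triangular (γ : SL(2, ℤ)) {K : ℤ} (hK : 0 < K) :
    ∃ (γ' : SL(2, ℤ)) (A B D : ℤ), 0 < A ∧ 0 < D ∧ K * γ 0 0 = γ' 0 0 * A ∧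
      K * γ 0 1 = γ' 0 0 * B + γ' 0 1 * D ∧ γ 1 0 = γ' 1 0 * A ∧ γ 1 1 = γ' 1 0 * B + γ' 1 1 * D := by
  have hd : γ 0 0 * γ 1 1 - γ 0 1 * γ 1 0 = 1 := by
    have := γ.det_coe
    rwa [Matrix.det_fin_two] at this
  have hne : K * γ 0 0 ≠ 0 ∨ γ 1 0 ≠ 0 := by
    by_contra! h
    obtain ⟨h1, h2⟩ := h
    have h3 : γ 0 0 = 0 := by simpa [hK.ne'] using h1
    rw [h2, h3] at hd
    simp at hd
  obtain ⟨g, p, r, hg, hpr, hp, hr⟩ : ∃ g p r : ℤ, 0 < g ∧ IsCoprime p r ∧ K * γ 0 0 = p * g ∧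
      γ 1 0 = r * g := by
    have hg : 0 < Int.gcd (K * γ 0 0) (γ 1 0) := Int.gcd_pos_iff.2 hne
    obtain ⟨p, r, h1, h2, h3⟩ := Int.exists_gcd_one hg
    exact ⟨_, p, r, by exact_mod_cast hg, Int.isCoprime_iff_gcd_eq_one.2 h1, h2, h3⟩
  obtain ⟨y, x, hxy⟩ := hpr
  let γ' : SL(2, ℤ) := ⟨!![p, -x; r, y], by rw [Matrix.det_fin_two_of]; linarith⟩
  have hAD : g * (p * γ 1 1 - r * (K * γ 0 1)) = K := by
    linear_combination -γ 1 1 * hp + (K * γ 0 1) * hr + K * hd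
  refine ⟨γ', g, y * (K * γ 0 1) + x * γ 1 1, p * γ 1 1 - r * (K * γ 0 1), hg, ?_, hp, ?_, hr, ?_⟩
  · by_contra! h
    nlinarith
  · simp only [γ', Matrix.of_apply, Matrix.cons_val_zero,
      Matrix.cons_val_one, Matrix.cons_val', Matrix.cons_val_fin_one]
    linear_combination -(K * γ 0 1) * hxy
  · simp only [γ', Matrix.of_apply, Matrix.cons_val_zero,
      Matrix.cons_val_one, Matrix.cons_val', Matrix.cons_val_fin_one]
    linear_combination -(γ 1 1) * hxy

/-! ### Smoothness and the antiholomorphic derivative -/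

lemma isOpen_im_pos : IsOpen {z : ℂ | 0 < z.im} := isOpen_lt continuous_const Complex.continuous_im

/-- The terms of the antiholomorphic derivative of `muChar`. -/
noncomputable def shadowTerm (δ ε : ℝ) (n : ℤ) (τ : ℂ) : ℂ :=
  ((n : ℂ) + 1 / 2 + δ) * ((-1) ^ n * Complex.exp (-(2 * π * Complex.I * ε * ((n : ℂ) + 1 / 2)))) *
    Complex.exp (-(π * Complex.I * ((n : ℂ) + 1 / 2 + δ) ^ 2 * (starRingEnd ℂ) τ))

lemma exp_mul_gTerm (δ ε : ℝ) (n : ℤ) {τ : ℂ} (hτ : 0 < τ.im) :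
    Complex.exp (-(π * Complex.I * δ ^ 2 * τ)) *
      (gTerm 1 n (δ * τ + ε, τ) + δ * gTerm 0 n (δ * τ + ε, τ)) = shadowTerm δ ε n τ := by
  have h1 : ((δ : ℂ) * τ + ε).im / τ.im = δ := by
    simp [hτ.ne']
  have h2 : rArg n ((δ : ℂ) * τ + ε, τ) ^ 2 = ((n : ℝ) + 1 / 2 + δ) ^ 2 * (2 * τ.im) := by
    rw [rArg_sq n hτ, h1]
  have e : (τ.im : ℂ) = ((starRingEnd ℂ) τ - τ) * Complex.I / 2 := by
    apply Complex.ext <;> simp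
  have h3 : Complex.exp (-(π * Complex.I * δ ^ 2 * τ)) * (((rexp (-π * rArg n (δ * τ + ε, τ) ^ 2) :
      ℝ) : ℂ) * Complex.exp (rExp n (δ * τ + ε, τ))) =
      Complex.exp (-(2 * π * Complex.I * ε * ((n : ℂ) + 1 / 2))) *
      Complex.exp (-(π * Complex.I * ((n : ℂ) + 1 / 2 + δ) ^ 2 * (starRingEnd ℂ) τ)) := by
    rw [h2, Complex.ofReal_exp, ← Complex.exp_add, ← Complex.exp_add, ← Complex.exp_add, rExp]
    congr 1
    push_cast
    rw [e]
    ring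
  rw [shadowTerm, gTerm, gTerm]
  linear_combination (((n : ℂ) + 1 / 2 + δ) * (-1) ^ n) * h3

lemma norm_shadowTerm (δ ε : ℝ) (n : ℤ) (τ : ℂ) : ‖shadowTerm δ ε n τ‖ =
    |(n : ℝ) + 1 / 2 + δ| * rexp (-π * τ.im * ((n : ℝ) + 1 / 2 + δ) ^ 2) := by
  have h1 : ‖Complex.exp (-(2 * π * Complex.I * ε * ((n : ℂ) + 1 / 2)))‖ = 1 := by
    have := norm_exp_pi_I_real (-(2 * ε * (n + 1 / 2)))
    rw [← this]
    congr 2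
    push_cast
    ring
  have h2 : ‖((n : ℂ) + 1 / 2 + δ)‖ = |(n : ℝ) + 1 / 2 + δ| := by
    rw [← Real.norm_eq_abs, ← Complex.norm_real]; push_cast; rfl
  rw [shadowTerm, norm_mul, norm_mul, norm_mul, norm_zpow, norm_neg, norm_one, one_zpow, h1, h2,
    one_mul, mul_one, Complex.norm_exp]
  congr 2
  rw [show -(π * Complex.I * ((n : ℂ) + 1 / 2 + δ) ^ 2 * (starRingEnd ℂ) τ) =
    ((π * ((n : ℝ) + 1 / 2 + δ) ^ 2 : ℝ) : ℂ) * (-(starRingEnd ℂ) τ * Complex.I) by push_cast; ring,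
    Complex.re_ofReal_mul, Complex.mul_I_re]
  simp
  ring

lemma differentiableAt_mu_curve {a₁ b₁ a₂ b₂ : ℝ} (h₁ : ¬ IsIntPair a₁ b₁)
    (h₂ : ¬ IsIntPair a₂ b₂) {τ : ℂ} (hτ : 0 < τ.im) :
    DifferentiableAt ℂ (fun z : ℂ => mu (a₁ * z + b₁) (a₂ * z + b₂) z) τ := by
  simp only [mu_eq]
  refine DifferentiableAt.mul (DifferentiableAt.div (by fun_prop) (differentiableAt_theta
    (by fun_prop) differentiableAt_id hτ) (theta_ne_zero hτ (mt (isLatticePoint_real_iff hτ _ _).1 h₂)))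
    (differentiableAt_appell (Eventually.of_forall fun x => by fun_prop)
      (Eventually.of_forall fun x => by fun_prop) (Eventually.of_forall fun x => differentiableAt_id)
      hτ (mt (isLatticePoint_real_iff hτ _ _).1 h₁))

lemma muChar_eq (a₁ b₁ a₂ b₂ : ℝ) (τ : ℂ) : muChar a₁ b₁ a₂ b₂ τ =
    Complex.exp (-(π * Complex.I * ((a₁ - a₂ : ℝ) : ℂ) ^ 2 * τ)) *
      (mu (a₁ * τ + b₁) (a₂ * τ + b₂) τ +
        Complex.I / 2 * zwegersR ((a₁ - a₂ : ℝ) * τ + (b₁ - b₂ : ℝ)) τ) := by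
  rw [muChar, muTilde]
  push_cast
  ring_nf

lemma contDiffOn_muChar {a₁ b₁ a₂ b₂ : ℝ} (h₁ : ¬ IsIntPair a₁ b₁) (h₂ : ¬ IsIntPair a₂ b₂) :
    ContDiffOn ℝ ∞ (muChar a₁ b₁ a₂ b₂) {z : ℂ | 0 < z.im} := by
  have hmu : ContDiffOn ℝ ∞ (fun z : ℂ => mu (a₁ * z + b₁) (a₂ * z + b₂) z) {z : ℂ | 0 < z.im} :=
    (DifferentiableOn.contDiffOn (fun z hz =>
      (differentiableAt_mu_curve h₁ h₂ hz).differentiableWithinAt) isOpen_im_pos).restrict_scalars ℝ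
  have hR : ContDiffOn ℝ ∞ (fun z : ℂ => zwegersR ((a₁ - a₂ : ℝ) * z + (b₁ - b₂ : ℝ)) z)
      {z : ℂ | 0 < z.im} :=
    contDiffOn_zwegersR.comp (f := fun z : ℂ => (((a₁ - a₂ : ℝ) : ℂ) * z + (b₁ - b₂ : ℝ), z))
      (ContDiff.contDiffOn (by fun_prop)) fun z hz => hz
  refine ContDiffOn.congr ?_ fun z _ => muChar_eq a₁ b₁ a₂ b₂ z
  exact ContDiffOn.mul (ContDiff.contDiffOn (by fun_prop)) (hmu.add (contDiffOn_const.mul hR))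

lemma hasFDerivAt_muChar {a₁ b₁ a₂ b₂ : ℝ} (h₁ : ¬ IsIntPair a₁ b₁) (h₂ : ¬ IsIntPair a₂ b₂)
    {τ : ℂ} (hτ : 0 < τ.im) : ∃ A : ℂ →L[ℝ] ℂ, HasFDerivAt (muChar a₁ b₁ a₂ b₂) A τ ∧
      A 1 + Complex.I * A Complex.I =
        (√(2 * τ.im) : ℂ)⁻¹ * ∑' n, shadowTerm (a₁ - a₂) (b₁ - b₂) n τ := by
  set δ := a₁ - a₂ with hδ
  set ε := b₁ - b₂ with hε
  obtain ⟨B, hB, hB'⟩ := zwegersR_curve (w := fun z => (δ : ℂ) * z + ε) (w' := δ) (τ := fun z => z)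
    (τ' := 1) (z := τ) (by simpa using ((hasDerivAt_id τ).const_mul (δ : ℂ)).add_const (ε : ℂ))
    (hasDerivAt_id τ) hτ
  have hm := ((differentiableAt_mu_curve h₁ h₂ hτ).hasDerivAt.hasFDerivAt).restrictScalars ℝ
  have he : HasFDerivAt (fun z : ℂ => Complex.exp (-(π * Complex.I * (δ : ℂ) ^ 2 * z))) _ τ :=
    ((DifferentiableAt.hasDerivAt (by fun_prop)).hasFDerivAt).restrictScalars ℝ
  have hall := he.mul (hm.add (hB.const_mul (Complex.I / 2)))
  refine ⟨_, hall.congr_of_eventuallyEq (Eventually.of_forall fun z => muChar_eq a₁ b₁ a₂ b₂ z), ?_⟩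
  have hy : ((δ : ℂ) * τ + ε).im / τ.im = δ := by simp [hτ.ne']
  have hs : ∑' n, shadowTerm δ ε n τ = Complex.exp (-(π * Complex.I * δ ^ 2 * τ)) *
      ((∑' n, gTerm 1 n (δ * τ + ε, τ)) + δ * ∑' n, gTerm 0 n (δ * τ + ε, τ)) := by
    rw [← tsum_mul_left, ← (summable_gTerm 1 hτ).tsum_add ((summable_gTerm 0 hτ).mul_left _),
      ← tsum_mul_left]
    exact tsum_congr fun n => (exp_mul_gTerm δ ε n hτ).symm
  rw [hs]
  simp only [hy, map_one, Complex.conj_ofReal] at hB'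
  simp only [add_apply, smul_apply, ContinuousLinearMap.coe_restrictScalars',
    ContinuousLinearMap.toSpanSingleton_apply, smul_eq_mul]
  have hI : Complex.I ^ 2 = -1 := Complex.I_sq
  generalize deriv (fun z : ℂ => mu (a₁ * z + b₁) (a₂ * z + b₂) z) τ = m'
  generalize deriv (fun z : ℂ => Complex.exp (-(π * Complex.I * (δ : ℂ) ^ 2 * z))) τ = e'
  generalize ((fun z : ℂ => mu (a₁ * z + b₁) (a₂ * z + b₂) z) +
    fun y : ℂ => Complex.I / 2 * zwegersR (δ * y + ε) y) τ = X
  linear_combination (Complex.I / 2 * Complex.exp (-(π * Complex.I * δ ^ 2 * τ))) * hB' +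
    (Complex.exp (-(π * Complex.I * δ ^ 2 * τ)) * m' + X * e' -
      Complex.exp (-(π * Complex.I * δ ^ 2 * τ)) * (√(2 * τ.im) : ℂ)⁻¹ *
      ((∑' n, gTerm 1 n (δ * τ + ε, τ)) + δ * ∑' n, gTerm 0 n (δ * τ + ε, τ))) * hI

/-! ### Growth at the cusp `i∞` -/

lemma summable_exp_shift (δ : ℝ) :
    Summable fun n : ℤ => rexp (-π * ((n : ℝ) + 1 / 2 + δ) ^ 2) := by
  refine Summable.of_nonneg_of_le (fun n => (exp_pos _).le) (fun n => ?_)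
    (summable_half_pow_mul_exp |δ * 1 + 1 / 2| one_pos 0)
  simpa using exp_neg_mul_half_sq_le zero_le_one le_rfl (le_refl |δ * 1 + 1 / 2|) n

lemma summable_abs_mul_exp_shift (δ : ℝ) :
    Summable fun n : ℤ => |(n : ℝ) + 1 / 2 + δ| * rexp (-π * ((n : ℝ) + 1 / 2 + δ) ^ 2) := by
  have h := (summable_half_pow_mul_exp |δ * 1 + 1 / 2| one_pos 1).add
    ((summable_half_pow_mul_exp |δ * 1 + 1 / 2| one_pos 0).mul_left |δ|)
  refine Summable.of_nonneg_of_le (fun n => by positivity) (fun n => ?_) h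
  have h1 := exp_neg_mul_half_sq_le zero_le_one le_rfl (le_refl |δ * 1 + 1 / 2|) n
  have h2 := abs_add_le ((n : ℝ) + 1 / 2) δ
  simp only [mul_one, one_mul, pow_one, pow_zero] at h1 ⊢
  rw [← add_mul]
  exact mul_le_mul h2 h1 (exp_pos _).le (by positivity)

lemma exp_shift_le {v : ℝ} (hv : 1 ≤ v) (x : ℝ) : rexp (-π * v * x ^ 2) ≤ rexp (-π * x ^ 2) := by
  rw [exp_le_exp]
  nlinarith [mul_nonneg pi_pos.le (sq_nonneg x)]

lemma summable_shadowTerm (δ ε : ℝ) {τ : ℂ} (hτ : 0 < τ.im) :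
    Summable fun n => shadowTerm δ ε n τ := by
  simp only [← exp_mul_gTerm δ ε _ hτ]
  exact ((summable_gTerm 1 hτ).add ((summable_gTerm 0 hτ).mul_left _)).mul_left _

/-- The antiholomorphic derivative is bounded near `i∞`. -/
lemma exists_shadow_bound (δ ε : ℝ) : ∃ C : ℝ, 0 ≤ C ∧ ∀ τ : ℂ, 1 ≤ τ.im →
    ‖(√(2 * τ.im) : ℂ)⁻¹ * ∑' n, shadowTerm δ ε n τ‖ ≤ C := by
  refine ⟨∑' n : ℤ, |(n : ℝ) + 1 / 2 + δ| * rexp (-π * ((n : ℝ) + 1 / 2 + δ) ^ 2),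
    tsum_nonneg fun n => by positivity, fun τ hτ => ?_⟩
  have h1 : ‖(√(2 * τ.im) : ℂ)⁻¹‖ ≤ 1 := by
    rw [norm_inv, Complex.norm_real, Real.norm_eq_abs, abs_of_nonneg (sqrt_nonneg _)]
    exact inv_le_one_of_one_le₀ (one_le_sqrt.2 (by linarith))
  rw [norm_mul]
  refine (mul_le_mul_of_nonneg_right h1 (norm_nonneg _)).trans ?_
  rw [one_mul]
  refine tsum_of_norm_bounded (summable_abs_mul_exp_shift δ).hasSum fun n => ?_
  rw [norm_shadowTerm]
  exact mul_le_mul_of_nonneg_left (exp_shift_le hτ _) (abs_nonneg _)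

/-- The filter of neighbourhoods of `i∞` in `ℂ`. -/
def imAtTop : Filter ℂ := comap Complex.im atTop

lemma tendsto_im_imAtTop : Tendsto Complex.im imAtTop atTop := tendsto_comap

lemma eventually_le_im (c : ℝ) : ∀ᶠ τ in imAtTop, c ≤ τ.im :=
  tendsto_im_imAtTop.eventually (eventually_ge_atTop c)

/-- At most linear exponential growth in the imaginary part. -/
def ExpGrowth (f : ℂ → ℂ) : Prop := ∃ C : ℝ, f =O[imAtTop] fun τ => rexp (C * τ.im)

lemma ExpGrowth.mul {f g : ℂ → ℂ} (hf : ExpGrowth f) (hg : ExpGrowth g) :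
    ExpGrowth fun τ => f τ * g τ := by
  obtain ⟨C, hC⟩ := hf
  obtain ⟨D, hD⟩ := hg
  refine ⟨C + D, (IsBigO.mul hC hD).congr_right fun τ => ?_⟩
  rw [← exp_add, add_mul]

lemma exp_isBigO_of_le {C D : ℝ} (h : C ≤ D) :
    (fun τ : ℂ => rexp (C * τ.im)) =O[imAtTop] fun τ => rexp (D * τ.im) := by
  refine IsBigO.of_bound 1 ((eventually_le_im 0).mono fun τ hτ => ?_)
  rw [one_mul, norm_of_nonneg (exp_pos _).le, norm_of_nonneg (exp_pos _).le, exp_le_exp]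
  exact mul_le_mul_of_nonneg_right h hτ

lemma ExpGrowth.add {f g : ℂ → ℂ} (hf : ExpGrowth f) (hg : ExpGrowth g) :
    ExpGrowth fun τ => f τ + g τ := by
  obtain ⟨C, hC⟩ := hf
  obtain ⟨D, hD⟩ := hg
  exact ⟨max C D, (hC.trans (exp_isBigO_of_le (le_max_left _ _))).add
    (hD.trans (exp_isBigO_of_le (le_max_right _ _)))⟩

lemma expGrowth_of_le {f : ℂ → ℂ} (C D : ℝ) (h : ∀ᶠ τ in imAtTop, ‖f τ‖ ≤ D * rexp (C * τ.im)) :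
    ExpGrowth f :=
  ⟨C, IsBigO.of_bound D (h.mono fun τ hτ => by rwa [norm_of_nonneg (exp_pos _).le])⟩

lemma expGrowth_const (c : ℂ) : ExpGrowth fun _ => c :=
  expGrowth_of_le 0 ‖c‖ (Eventually.of_forall fun τ => by simp)

lemma expGrowth_exp (a : ℝ) (b : ℂ) : ExpGrowth fun τ => Complex.exp (π * Complex.I * (a * τ + b)) := by
  refine expGrowth_of_le (-π * a) ‖Complex.exp (π * Complex.I * b)‖ (Eventually.of_forall fun τ => ?_)
  rw [mul_add, Complex.exp_add, norm_mul, mul_comm, Complex.norm_exp (_ * (_ * _)),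
    show (π : ℂ) * Complex.I * (a * τ) = ((π * a : ℝ) : ℂ) * (τ * Complex.I) by push_cast; ring,
    Complex.re_ofReal_mul, Complex.mul_I_re]
  refine le_of_eq ?_
  congr 2
  ring

lemma expGrowth_zwegersR (δ ε : ℝ) : ExpGrowth fun τ => zwegersR (δ * τ + ε) τ := by
  refine expGrowth_of_le (8 * π * δ ^ 2) (2 * ∑' n : ℤ, rexp (-π * ((n : ℝ) + 1 / 2 + δ) ^ 2))
    ((eventually_le_im 1).mono fun τ hτ => ?_)
  have h0 : 0 < τ.im := by linarith
  have hy : ((δ : ℂ) * τ + ε).im = δ * τ.im := by simp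
  rw [zwegersR_eq, mul_right_comm, ← tsum_mul_left]
  refine tsum_of_norm_bounded ((summable_exp_shift δ).mul_left _).hasSum fun n => ?_
  refine (norm_rTerm_le 0 n (p := (δ * τ + ε, τ)) h0).trans ?_
  have e1 : 8 * π * (δ * τ.im) ^ 2 / τ.im = 8 * π * δ ^ 2 * τ.im := by field_simp
  have e2 : δ * τ.im / τ.im = δ := by field_simp
  simp only [pow_zero, one_mul, hy, e1, e2]
  exact mul_le_mul_of_nonneg_left (exp_shift_le hτ _) (by positivity)

lemma exists_den_bound_imAtTop {a b : ℝ} (h : ¬ IsIntPair a b) : ∃ c : ℝ, 0 < c ∧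
    ∀ᶠ τ in imAtTop, ∀ n : ℤ,
      c ≤ ‖1 - Complex.exp (2 * π * Complex.I * n * τ + 2 * π * Complex.I * (a * τ + b))‖ := by
  have key : ∀ η : ℝ, 0 < η → ∀ᶠ τ : ℂ in imAtTop, ∀ n : ℤ, η ≤ |n + a| →
      1 / 2 ≤ ‖1 - Complex.exp (2 * π * Complex.I * n * τ + 2 * π * Complex.I * (a * τ + b))‖ := by
    intro η hη
    filter_upwards [eventually_le_im (1 / η)] with τ hτ n hn
    refine half_le_norm_one_sub_exp ?_
    have h0 : 0 < τ.im := lt_of_lt_of_le (by positivity) hτ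
    rw [show (n : ℝ) * τ.im + (a * τ + b : ℂ).im = (n + a) * τ.im by simp; ring, abs_mul,
      abs_of_pos h0]
    calc (1 : ℝ) = η * (1 / η) := by field_simp
      _ ≤ _ := mul_le_mul hn hτ (by positivity) (abs_nonneg _)
  by_cases ha : ∃ m : ℤ, a = m
  · obtain ⟨m, rfl⟩ := ha
    have hb : 1 - Complex.exp (2 * π * Complex.I * b) ≠ 0 := by
      intro h0
      obtain ⟨n, hn⟩ := Complex.exp_eq_one_iff.1 (sub_eq_zero.1 h0).symm
      refine h ⟨⟨m, rfl⟩, n, ?_⟩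
      have : (2 * π * Complex.I : ℂ) ≠ 0 := Complex.two_pi_I_ne_zero
      have h3 : (b : ℂ) = n := mul_left_cancel₀ this (by rw [hn]; ring)
      exact_mod_cast h3
    refine ⟨min (1 / 2) ‖1 - Complex.exp (2 * π * Complex.I * b)‖,
      lt_min (by norm_num) (norm_pos_iff.2 hb), ?_⟩
    filter_upwards [key 1 one_pos] with τ hτ n
    by_cases hn : n + m = 0
    · refine (min_le_right _ _).trans_eq ?_
      have : (n : ℂ) = -m := by rw [eq_neg_iff_add_eq_zero]; exact_mod_cast hn
      congr 3
      rw [this]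
      push_cast
      ring
    · refine (min_le_left _ _).trans (hτ n ?_)
      exact_mod_cast Int.one_le_abs hn
  · have h0 : 0 < Int.fract a := (Int.fract_nonneg a).lt_of_ne fun h0 =>
      ha ⟨⌊a⌋, by have := Int.floor_add_fract a; rw [← h0] at this; linarith⟩
    refine ⟨1 / 2, by norm_num, ?_⟩
    filter_upwards [key (min (Int.fract a) (1 - Int.fract a))
      (lt_min h0 (by linarith [Int.fract_lt_one a]))] with τ hτ n
    refine hτ n ?_
    have e : (n : ℝ) + a = (n + ⌊a⌋ : ℤ) + Int.fract a := by
      push_cast; linarith [Int.floor_add_fract a]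
    rw [e]
    have h1 := Int.fract_lt_one a
    rcases le_or_gt 0 (n + ⌊a⌋) with hk | hk
    · have : (0 : ℝ) ≤ (n + ⌊a⌋ : ℤ) := by exact_mod_cast hk
      exact (min_le_left _ _).trans (le_abs.2 (Or.inl (by linarith)))
    · have : ((n + ⌊a⌋ : ℤ) : ℝ) ≤ -1 := by exact_mod_cast (by omega : n + ⌊a⌋ ≤ -1)
      exact (min_le_right _ _).trans (le_abs.2 (Or.inr (by linarith)))

lemma norm_appellNum_real (n : ℤ) (a b : ℝ) (τ : ℂ) : ‖appellNum n (a * τ + b) τ‖ =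
    rexp (π * (1 / 2 + a) ^ 2 * τ.im) * rexp (-π * τ.im * ((n : ℝ) + 1 / 2 + a) ^ 2) := by
  rw [appellNum, norm_mul, norm_zpow, norm_neg, norm_one, one_zpow, one_mul, Complex.norm_exp,
    ← exp_add, show (π : ℂ) * Complex.I * ((n : ℂ) ^ 2 + n) * τ + 2 * π * Complex.I * n * (a * τ + b)
      = ((π * (n ^ 2 + n + 2 * n * a) : ℝ) : ℂ) * (τ * Complex.I) + ((2 * π * n * b : ℝ) : ℂ) *
        Complex.I by push_cast; ring, Complex.add_re, Complex.re_ofReal_mul, Complex.re_ofReal_mul,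
    Complex.mul_I_re, Complex.I_re]
  congr 1
  ring

lemma expGrowth_appell {a₁ b₁ : ℝ} (h : ¬ IsIntPair a₁ b₁) (a₂ b₂ : ℝ) :
    ExpGrowth fun τ => appell (a₁ * τ + b₁) (a₂ * τ + b₂) τ := by
  obtain ⟨c, hc, hd⟩ := exists_den_bound_imAtTop h
  refine expGrowth_of_le (π * (1 / 2 + a₂) ^ 2)
    (c⁻¹ * ∑' n : ℤ, rexp (-π * ((n : ℝ) + 1 / 2 + a₂) ^ 2)) ?_
  filter_upwards [hd, eventually_le_im 1] with τ hτ h1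
  rw [mul_right_comm, ← tsum_mul_left, appell]
  refine tsum_of_norm_bounded ((summable_exp_shift a₂).mul_left _).hasSum fun n => ?_
  rw [appellTerm, norm_div, norm_appellNum_real, div_eq_inv_mul, mul_assoc c⁻¹]
  exact mul_le_mul (inv_anti₀ hc (hτ n))
    (mul_le_mul_of_nonneg_left (exp_shift_le h1 _) (exp_pos _).le) (by positivity) (by positivity)

lemma expGrowth_inv_theta_of_leading {a b x : ℝ} (S : Finset ℤ)
    (hS : ∀ n ∈ S, ((n : ℝ) + 1 / 2 + a) ^ 2 = x ^ 2)
    (hS' : ∀ n ∉ S, x ^ 2 < ((n : ℝ) + 1 / 2 + a) ^ 2)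
    (h0 : ∑ n ∈ S, Complex.exp (2 * π * Complex.I * ((n : ℂ) + 1 / 2) * (b + 1 / 2)) ≠ 0) :
    ExpGrowth fun τ => (jacobiTheta (a * τ + b) τ)⁻¹ := by
  set t : ℤ → ℂ → ℂ := fun n τ => Complex.exp (2 * π * Complex.I * ((n : ℂ) + 1 / 2) * (b + 1 / 2)) *
    Complex.exp (π * Complex.I * (((n : ℂ) + 1 / 2 + a) ^ 2 - x ^ 2) * τ) with ht
  have hθ : ∀ τ : ℂ, jacobiTheta (a * τ + b) τ =
      Complex.exp (-(π * Complex.I * (a ^ 2 - x ^ 2) * τ)) * ∑' n, t n τ := by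
    intro τ
    rw [jacobiTheta, ← tsum_mul_left]
    refine tsum_congr fun n => ?_
    simp only [ht]
    rw [← Complex.exp_add, ← Complex.exp_add]
    congr 1
    ring
  have hc : ∀ n : ℤ, ‖Complex.exp (2 * π * Complex.I * ((n : ℂ) + 1 / 2) * (b + 1 / 2))‖ = 1 := by
    intro n
    rw [← norm_exp_pi_I_real (2 * (n + 1 / 2) * (b + 1 / 2))]
    congr 2
    push_cast
    ring
  have hnorm : ∀ n τ, ‖t n τ‖ = rexp (-(π * (((n : ℝ) + 1 / 2 + a) ^ 2 - x ^ 2)) * τ.im) := by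
    intro n τ
    rw [ht, norm_mul, hc, one_mul, Complex.norm_exp, show (π : ℂ) * Complex.I *
      (((n : ℂ) + 1 / 2 + a) ^ 2 - x ^ 2) * τ = ((π * (((n : ℝ) + 1 / 2 + a) ^ 2 - x ^ 2) : ℝ) : ℂ) *
      (τ * Complex.I) by push_cast; ring, Complex.re_ofReal_mul, Complex.mul_I_re]
    congr 1
    ring
  have hlim : Tendsto (fun τ => ∑' n, t n τ) imAtTop (𝓝 (∑' n, if n ∈ S then
      Complex.exp (2 * π * Complex.I * ((n : ℂ) + 1 / 2) * (b + 1 / 2)) else 0)) := by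
    refine tendsto_tsum_of_dominated_convergence ((summable_exp_shift a).mul_left (rexp (π * x ^ 2)))
      (fun n => ?_) ((eventually_le_im 1).mono fun τ hτ n => ?_)
    · split_ifs with hn
      · refine tendsto_const_nhds.congr fun τ => ?_
        have : ((n : ℂ) + 1 / 2 + a) ^ 2 = x ^ 2 := by
          have := congrArg Complex.ofReal (hS n hn)
          push_cast at this
          exact this
        rw [ht]
        simp only [this]
        simp
      · rw [tendsto_zero_iff_norm_tendsto_zero]
        simp only [hnorm]
        refine tendsto_exp_atBot.comp (tendsto_im_imAtTop.const_mul_atTop_of_neg ?_)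
        have := hS' n hn
        have := mul_pos pi_pos (sub_pos.2 this)
        linarith
    · rw [hnorm, ← exp_add, exp_le_exp]
      have : 0 ≤ ((n : ℝ) + 1 / 2 + a) ^ 2 - x ^ 2 := by
        by_cases hn : n ∈ S
        · rw [hS n hn, sub_self]
        · linarith [hS' n hn]
      nlinarith [mul_nonneg pi_pos.le this]
  rw [tsum_eq_sum (s := S) (fun n hn => if_neg hn), Finset.sum_congr rfl (fun n hn => if_pos hn)]
    at hlim
  have hinv : ExpGrowth fun τ => (∑' n, t n τ)⁻¹ :=
    ⟨0, by simpa using (hlim.inv₀ h0).isBigO_one ℝ⟩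
  have := (expGrowth_exp (a ^ 2 - x ^ 2) 0).mul hinv
  convert this using 2 with τ
  rw [hθ, mul_inv, ← Complex.exp_neg]
  congr 2
  push_cast
  ring

lemma expGrowth_inv_theta {a b : ℝ} (h : ¬ IsIntPair a b) :
    ExpGrowth fun τ => (jacobiTheta (a * τ + b) τ)⁻¹ := by
  by_cases ha : ∃ m : ℤ, a = m
  · obtain ⟨m, rfl⟩ := ha
    have hsq : ∀ n : ℤ, ((n : ℝ) + 1 / 2 + m) ^ 2 = (1 / 2) ^ 2 + ((n + m) * (n + m + 1) : ℤ) := by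
      intro n; push_cast; ring
    refine expGrowth_inv_theta_of_leading (x := 1 / 2) {-m, -m - 1} (fun n hn => ?_)
      (fun n hn => ?_) ?_
    · rw [hsq]
      simp only [Finset.mem_insert, Finset.mem_singleton] at hn
      rcases hn with rfl | rfl
      · simp
      · rw [show -m - 1 + m + 1 = 0 by ring]
        simp
    · rw [hsq]
      simp only [Finset.mem_insert, Finset.mem_singleton, not_or] at hn
      have : 0 < (n + m) * (n + m + 1) := by
        rcases lt_or_gt_of_ne (show n + m ≠ 0 by omega) with h1 | h1
        · exact mul_pos_of_neg_of_neg h1 (by omega)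
        · exact mul_pos h1 (by omega)
      have : (0 : ℝ) < ((n + m) * (n + m + 1) : ℤ) := by exact_mod_cast this
      linarith
    · rw [Finset.sum_pair (by omega)]
      intro h0
      have e : Complex.exp (2 * π * Complex.I * (((-m : ℤ) : ℂ) + 1 / 2) * (b + 1 / 2)) =
          -Complex.exp (2 * π * Complex.I * (((-m - 1 : ℤ) : ℂ) + 1 / 2) * (b + 1 / 2)) *
            Complex.exp (2 * π * Complex.I * b) := by
        rw [← Complex.exp_add_pi_mul_I, ← Complex.exp_add]
        congr 1
        push_cast
        ring
      rw [e] at h0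
      have h1 : Complex.exp (2 * π * Complex.I * b) = 1 := by
        have := Complex.exp_ne_zero
          (2 * π * Complex.I * (((-m - 1 : ℤ) : ℂ) + 1 / 2) * (b + 1 / 2))
        exact mul_left_cancel₀ this (by linear_combination -h0)
      obtain ⟨n, hn⟩ := Complex.exp_eq_one_iff.1 h1
      refine h ⟨⟨m, rfl⟩, n, ?_⟩
      have h3 : (b : ℂ) = n := mul_left_cancel₀ Complex.two_pi_I_ne_zero (by rw [hn]; ring)
      exact_mod_cast h3
  · have hf : 0 < Int.fract a := (Int.fract_nonneg a).lt_of_ne fun h0 =>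
      ha ⟨⌊a⌋, by have := Int.floor_add_fract a; rw [← h0] at this; linarith⟩
    have hf1 := Int.fract_lt_one a
    have hfl := Int.floor_add_fract a
    refine expGrowth_inv_theta_of_leading (x := Int.fract a - 1 / 2) {-⌊a⌋ - 1} (fun n hn => ?_)
      (fun n hn => ?_) (by simp)
    · rw [Finset.mem_singleton.1 hn]
      push_cast
      congr 1
      linarith
    · rw [Finset.mem_singleton] at hn
      have e : (n : ℝ) + 1 / 2 + a = (n + ⌊a⌋ + 1 : ℤ) + (Int.fract a - 1 / 2) := by
        push_cast; linarith
      rw [e]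
      rcases lt_or_gt_of_ne (show n + ⌊a⌋ + 1 ≠ 0 by omega) with h1 | h1
      · have : ((n + ⌊a⌋ + 1 : ℤ) : ℝ) ≤ -1 := by exact_mod_cast (by omega : n + ⌊a⌋ + 1 ≤ -1)
        nlinarith
      · have : (1 : ℝ) ≤ (n + ⌊a⌋ + 1 : ℤ) := by exact_mod_cast h1
        nlinarith

lemma expGrowth_muChar {a₁ b₁ a₂ b₂ : ℝ} (h₁ : ¬ IsIntPair a₁ b₁) (h₂ : ¬ IsIntPair a₂ b₂) :
    ExpGrowth (muChar a₁ b₁ a₂ b₂) := by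
  have hmu := ((expGrowth_exp a₁ b₁).mul (expGrowth_inv_theta h₂)).mul (expGrowth_appell h₁ a₂ b₂)
  have h := (expGrowth_exp (-(a₁ - a₂) ^ 2) 0).mul
    (hmu.add ((expGrowth_const (Complex.I / 2)).mul (expGrowth_zwegersR (a₁ - a₂) (b₁ - b₂))))
  convert h using 2 with τ
  rw [muChar_eq, mu_eq, div_eq_mul_inv]
  congr 2
  push_cast
  ring

/-! ### Fourier expansions of quasi-periodic functions with bounded antiholomorphic derivative -/

/-- Change of the horizontal integrals of a periodic function with the height. -/
lemma norm_horizontal_integral_sub_le {H : ℂ → ℂ} (hH : ContDiffOn ℝ ∞ H {z : ℂ | 0 < z.im}) {w : ℝ}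
    (hw : 0 ≤ w) (hper : ∀ y : ℝ, 0 < y → H (w + y * Complex.I) = H ((0 : ℝ) + y * Complex.I))
    {C m v₁ v₂ : ℝ} (hm : m ≠ 0) (hv₁ : 0 < v₁) (hv : v₁ ≤ v₂)
    (hd : ∀ z : ℂ, v₁ ≤ z.im →
      ‖fderiv ℝ H z 1 + Complex.I * fderiv ℝ H z Complex.I‖ ≤ C * rexp (m * z.im)) :
    ‖(∫ x in (0 : ℝ)..w, H (x + v₁ * Complex.I)) - ∫ x in (0 : ℝ)..w, H (x + v₂ * Complex.I)‖ ≤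
      w * (C * ((rexp (m * v₂) - rexp (m * v₁)) / m)) := by
  have hsub : uIcc 0 w ×ℂ uIcc v₁ v₂ ⊆ {z : ℂ | 0 < z.im} := fun z hz => by
    have := (uIcc_of_le hv ▸ hz.2 : z.im ∈ Icc v₁ v₂).1
    exact lt_of_lt_of_le hv₁ this
  have hcf : ContinuousOn (fderiv ℝ H) {z : ℂ | 0 < z.im} :=
    hH.continuousOn_fderiv_of_isOpen isOpen_im_pos (by simp)
  have key := Complex.integral_boundary_rect_of_differentiableOn_real H ((0 : ℝ) + v₁ * Complex.I)
    (w + v₂ * Complex.I)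
  simp only [Complex.add_re, Complex.add_im, Complex.ofReal_re, Complex.ofReal_im,
    Complex.re_ofReal_mul, Complex.im_ofReal_mul, Complex.I_re, Complex.I_im, mul_zero, mul_one,
    zero_add, add_zero] at key
  have key := key ((hH.differentiableOn (by simp)).mono hsub) (by
    refine ContinuousOn.integrableOn_compact (isCompact_uIcc.reProdIm isCompact_uIcc) ?_
    have hc' := hcf.mono hsub
    fun_prop)
  have hvert : ∫ y in v₁..v₂, H (w + y * Complex.I) = ∫ y in v₁..v₂, H ((0 : ℝ) + y * Complex.I) := by
    refine intervalIntegral.integral_congr fun y hy => hper y ?_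
    rw [uIcc_of_le hv] at hy
    exact lt_of_lt_of_le hv₁ hy.1
  rw [hvert, add_sub_cancel_right] at key
  rw [key]
  have hintegral : ∫ y in v₁..v₂, C * rexp (m * y) = C * ((rexp (m * v₂) - rexp (m * v₁)) / m) := by
    rw [intervalIntegral.integral_const_mul,
      intervalIntegral.integral_eq_sub_of_hasDerivAt (f := fun y => rexp (m * y) / m)
        (fun y _ => ?_) (Continuous.intervalIntegrable (by fun_prop) _ _), sub_div]
    have := (((hasDerivAt_id y).const_mul m).exp).div_const m
    simpa [hm] using this
  have := intervalIntegral.norm_integral_le_of_norm_le_const (a := 0) (b := w)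
    (f := fun x : ℝ => ∫ y in v₁..v₂, Complex.I • fderiv ℝ H (x + y * Complex.I) 1 -
      fderiv ℝ H (x + y * Complex.I) Complex.I) (C := C * ((rexp (m * v₂) - rexp (m * v₁)) / m))
    (fun x _ => ?_)
  · rw [sub_zero, abs_of_nonneg hw, mul_comm] at this
    exact this
  · rw [← hintegral]
    refine intervalIntegral.norm_integral_le_of_norm_le hv (Eventually.of_forall fun y hy => ?_)
      (Continuous.intervalIntegrable (by fun_prop) _ _)
    have h1 := hd (x + y * Complex.I) (by simpa using hy.1.le)
    have h2 : Complex.I • fderiv ℝ H (x + y * Complex.I) 1 -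
        fderiv ℝ H (x + y * Complex.I) Complex.I = Complex.I * (fderiv ℝ H (x + y * Complex.I) 1 +
          Complex.I * fderiv ℝ H (x + y * Complex.I) Complex.I) := by
      rw [mul_add, ← mul_assoc, Complex.I_mul_I, smul_eq_mul]
      ring
    rw [h2, norm_mul, Complex.norm_I, one_mul]
    simpa using h1

lemma fderiv_mul_exp_antilinear {G : ℂ → ℂ} {z : ℂ} (hG : DifferentiableAt ℝ G z) (k : ℂ) :
    fderiv ℝ (fun z => G z * Complex.exp (k * z)) z 1 +
      Complex.I * fderiv ℝ (fun z => G z * Complex.exp (k * z)) z Complex.I =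
    (fderiv ℝ G z 1 + Complex.I * fderiv ℝ G z Complex.I) * Complex.exp (k * z) := by
  have he : HasFDerivAt (fun z : ℂ => Complex.exp (k * z)) _ z :=
    ((DifferentiableAt.hasDerivAt (by fun_prop)).hasFDerivAt).restrictScalars ℝ
  have h := hG.hasFDerivAt.mul he
  have h' : fderiv ℝ (fun z => G z * Complex.exp (k * z)) z = _ := h.fderiv
  rw [h']
  simp only [add_apply, smul_apply, ContinuousLinearMap.coe_restrictScalars',
    ContinuousLinearMap.toSpanSingleton_apply, smul_eq_mul]
  generalize deriv (fun z : ℂ => Complex.exp (k * z)) z = e'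
  linear_combination (G z * e') * Complex.I_sq

lemma exists_exp_eq_of_norm_eq_one {c : ℂ} (hc : ‖c‖ = 1) :
    ∃ κ : ℝ, Complex.exp (2 * π * Complex.I * κ) = c := by
  refine ⟨Complex.arg c / (2 * π), ?_⟩
  have h := Complex.norm_mul_exp_arg_mul_I c
  rw [hc, Complex.ofReal_one, one_mul] at h
  refine Eq.trans (congrArg Complex.exp ?_) h
  push_cast
  have : (π : ℂ) ≠ 0 := by exact_mod_cast pi_ne_zero
  field_simp

section

variable {g : ℍ → ℂ} {G : ℂ → ℂ} {w : ℕ} {κ C v₀ : ℝ}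

lemma horizontal_integral_eq (hg : ∀ τ : ℍ, g τ = G τ) (hw : 0 < w) (n : ℤ) {v : ℝ} (hv : 0 < v) :
    ∫ x in (0 : ℝ)..w, G (x + v * Complex.I) *
      Complex.exp (-(2 * π * Complex.I * ((n + κ) / w : ℝ)) * (x + v * Complex.I)) =
    w * (rexp (2 * π * ((n + κ) / w) * v) * fourierCoeffAt g w κ n v) := by
  have hw' : (w : ℂ) ≠ 0 := by exact_mod_cast hw.ne'
  rw [fourierCoeffAt, mul_left_comm _ (1 / (w : ℂ)), ← mul_assoc, mul_one_div_cancel hw', one_mul,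
    ← intervalIntegral.integral_const_mul]
  refine intervalIntegral.integral_congr fun x _ => ?_
  have h : 0 < ((x : ℂ) + v * Complex.I).im := by simpa using hv
  rw [hg, UpperHalfPlane.ofComplex_apply_of_im_pos h, mul_left_comm]
  simp only
  rw [Complex.ofReal_exp, ← Complex.exp_add]
  congr 2
  push_cast
  linear_combination -(2 * π * ((n + κ) / w) * v : ℂ) * Complex.I_sq

lemma norm_fourierCoeffAt_sub_le (hg : ∀ τ : ℍ, g τ = G τ)
    (hG : ContDiffOn ℝ ∞ G {z : ℂ | 0 < z.im}) (hw : 0 < w)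
    (hper : ∀ z : ℂ, 0 < z.im → G (z + w) = Complex.exp (2 * π * Complex.I * κ) * G z)
    (hv₀ : 0 < v₀)
    (hd : ∀ z : ℂ, v₀ ≤ z.im → ‖fderiv ℝ G z 1 + Complex.I * fderiv ℝ G z Complex.I‖ ≤ C)
    (n : ℤ) (hn : 2 * π * ((n + κ) / w) ≠ 0) {v₁ v₂ : ℝ} (hv₁ : v₀ ≤ v₁) (hv : v₁ ≤ v₂) :
    ‖rexp (2 * π * ((n + κ) / w) * v₁) * fourierCoeffAt g w κ n v₁ -
      rexp (2 * π * ((n + κ) / w) * v₂) * fourierCoeffAt g w κ n v₂‖ ≤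
      C * ((rexp (2 * π * ((n + κ) / w) * v₂) - rexp (2 * π * ((n + κ) / w) * v₁)) /
        (2 * π * ((n + κ) / w))) := by
  have hw' : (w : ℂ) ≠ 0 := by exact_mod_cast hw.ne'
  have hwr : (0 : ℝ) < w := by exact_mod_cast hw
  set k : ℂ := -(2 * π * Complex.I * ((n + κ) / w : ℝ)) with hk
  have h := norm_horizontal_integral_sub_le (H := fun z => G z * Complex.exp (k * z)) (w := w)
    (hG.mul (ContDiff.contDiffOn (by fun_prop))) hwr.le (fun y hy => ?_) hn
    (hv₀.trans_le hv₁) hv (C := C) (fun z hz => ?_)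
  · rw [horizontal_integral_eq hg hw n (hv₀.trans_le hv₁),
      horizontal_integral_eq hg hw n (hv₀.trans_le (hv₁.trans hv)), ← mul_sub, norm_mul,
      Complex.norm_natCast] at h
    exact le_of_mul_le_mul_left h hwr
  · have h0 := hper ((0 : ℝ) + y * Complex.I) (by simpa using hy)
    rw [show ((w : ℝ) : ℂ) + y * Complex.I = ((0 : ℝ) + y * Complex.I) + w by push_cast; ring, h0,
      mul_add k, Complex.exp_add, show k * w = -(2 * π * Complex.I * κ) - n * (2 * π * Complex.I) by
        rw [hk]; push_cast; field_simp; ring, Complex.exp_sub, Complex.exp_neg,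
      Complex.exp_int_mul_two_pi_mul_I]
    have := Complex.exp_ne_zero (2 * π * Complex.I * κ)
    field_simp
  · have h0 : 0 < z.im := by linarith
    rw [fderiv_mul_exp_antilinear ((hG.differentiableOn (by simp)).differentiableAt
      (isOpen_im_pos.mem_nhds h0)), norm_mul, Complex.norm_exp]
    refine mul_le_mul (hd z (hv₁.trans hz)) (le_of_eq ?_) (exp_pos _).le
      ((norm_nonneg _).trans (hd z (hv₁.trans hz)))
    rw [hk, show -(2 * π * Complex.I * ((n + κ) / w : ℝ)) * z = ((2 * π * ((n + κ) / w) : ℝ) : ℂ) *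
      (-z * Complex.I) by push_cast; ring, Complex.re_ofReal_mul, Complex.mul_I_re]
    simp

lemma exists_norm_fourierCoeffAt_le (hg : ∀ τ : ℍ, g τ = G τ) (hw : 0 < w) (hG : ExpGrowth G) :
    ∃ D E : ℝ, 0 ≤ E ∧ ∀ᶠ v in atTop, ∀ n : ℤ, ‖fourierCoeffAt g w κ n v‖ ≤ D * rexp (E * v) := by
  obtain ⟨E₀, hE⟩ := hG
  obtain ⟨D, hD⟩ := (hE.trans (exp_isBigO_of_le (le_max_left E₀ 0))).bound
  have hwr : (0 : ℝ) < w := by exact_mod_cast hw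
  set E := max E₀ 0
  refine ⟨D, E, le_max_right _ _, ?_⟩
  rw [imAtTop, eventually_comap] at hD
  filter_upwards [hD, eventually_gt_atTop 0] with v hv hv0 n
  rw [fourierCoeffAt, norm_mul]
  have := intervalIntegral.norm_integral_le_of_norm_le_const (a := 0) (b := w)
    (f := fun u : ℝ => g (UpperHalfPlane.ofComplex ((u : ℂ) + (v : ℂ) * Complex.I)) *
      Complex.exp (-2 * Real.pi * Complex.I * ((n : ℂ) + (κ : ℂ)) * (u : ℂ) / (w : ℂ)))
    (C := D * rexp (E * v)) (fun u _ => ?_)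
  · rw [sub_zero, abs_of_pos hwr] at this
    refine (mul_le_mul_of_nonneg_left this (norm_nonneg _)).trans (le_of_eq ?_)
    simp
    field_simp
  · have h : 0 < ((u : ℂ) + v * Complex.I).im := by simpa using hv0
    have h1 : ‖Complex.exp (-2 * Real.pi * Complex.I * ((n : ℂ) + (κ : ℂ)) * (u : ℂ) / (w : ℂ))‖
        = 1 := by
      rw [← norm_exp_pi_I_real (-2 * (n + κ) * u / w)]
      congr 2
      push_cast
      ring
    rw [norm_mul, h1, mul_one, hg, UpperHalfPlane.ofComplex_apply_of_im_pos h]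
    have := hv ((u : ℂ) + v * Complex.I) (by simp)
    simpa using this

/-- A smooth quasi-periodic function of at most exponential growth whose antiholomorphic derivative
is bounded near `i∞` has only finitely many growing Fourier terms. -/
lemma finitelyManyGrowingTerms_of_bounded (hg : ∀ τ : ℍ, g τ = G τ)
    (hG : ContDiffOn ℝ ∞ G {z : ℂ | 0 < z.im}) (hw : 0 < w) {c : ℂ} (hc : ‖c‖ = 1)
    (hper : ∀ z : ℂ, 0 < z.im → G (z + w) = c * G z)
    (hd : ∀ᶠ z in imAtTop, ‖fderiv ℝ G z 1 + Complex.I * fderiv ℝ G z Complex.I‖ ≤ C)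
    (hgr : ExpGrowth G) : FinitelyManyGrowingTerms g := by
  obtain ⟨κ, rfl⟩ := exists_exp_eq_of_norm_eq_one hc
  have hwr : (0 : ℝ) < w := by exact_mod_cast hw
  obtain ⟨v₀, hv₀, hd⟩ : ∃ v₀ : ℝ, 0 < v₀ ∧ ∀ z : ℂ, v₀ ≤ z.im →
      ‖fderiv ℝ G z 1 + Complex.I * fderiv ℝ G z Complex.I‖ ≤ C := by
    rw [imAtTop, eventually_comap, eventually_atTop] at hd
    obtain ⟨a, ha⟩ := hd
    exact ⟨max a 1, by positivity, fun z hz => ha z.im (le_of_max_le_left hz) z rfl⟩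
  obtain ⟨D, E, hE, hDE⟩ := exists_norm_fourierCoeffAt_le (κ := κ) hg hw hgr
  have hC : 0 ≤ C := (norm_nonneg _).trans (hd (v₀ * Complex.I) (by simp))
  refine ⟨w, hw, κ, fun τ => ?_, (Set.finite_Icc ⌊-E / (2 * π) * w - κ⌋ ⌈-κ⌉).subset fun n hn => ?_⟩
  · rw [hg, hg, ← hper _ τ.im_pos, UpperHalfPlane.coe_vadd]
    congr 1
    push_cast
    ring
  by_contra hout
  refine hn ?_
  set m := 2 * π * ((n + κ) / w) with hm
  have key : m ≠ 0 → ∀ {v₁ v₂ : ℝ}, v₀ ≤ v₁ → v₁ ≤ v₂ →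
      ‖rexp (m * v₁) * fourierCoeffAt g w κ n v₁ - rexp (m * v₂) * fourierCoeffAt g w κ n v₂‖ ≤
        C * ((rexp (m * v₂) - rexp (m * v₁)) / m) :=
    fun hm0 v₁ v₂ => norm_fourierCoeffAt_sub_le hg hG hw hper hv₀ hd n hm0
  have hnorm : ∀ v, ‖(rexp (m * v) : ℂ) * fourierCoeffAt g w κ n v‖ =
      rexp (m * v) * ‖fourierCoeffAt g w κ n v‖ := fun v => by
    rw [norm_mul, Complex.norm_real, norm_of_nonneg (exp_pos _).le]
  rw [mem_Icc, not_and_or, not_le, not_le] at hout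
  rcases hout with h | h
  · have hmE : m + E < 0 := by
      have h1 : (n : ℝ) < -E / (2 * π) * w - κ := lt_of_lt_of_le (by exact_mod_cast h) (Int.floor_le _)
      have h2 : (n + κ) / w < -E / (2 * π) := by rw [div_lt_iff₀ hwr]; linarith
      have h3 : 2 * π * ((n + κ) / w) < 2 * π * (-E / (2 * π)) :=
        mul_lt_mul_of_pos_left h2 (by positivity)
      rw [mul_div_cancel₀ _ (by positivity)] at h3
      linarith
    have hmneg : m < 0 := by linarith
    refine IsBigO.of_bound (C / (-m)) ((eventually_ge_atTop v₀).mono fun v hv => ?_)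
    rw [norm_one, mul_one]
    refine le_of_mul_le_mul_left ?_ (exp_pos (m * v))
    have hlim : Tendsto (fun v₂ => D * rexp ((m + E) * v₂) + rexp (m * v) * (C / (-m))) atTop
        (𝓝 (D * 0 + rexp (m * v) * (C / (-m)))) :=
      ((tendsto_exp_atBot.comp (tendsto_id.const_mul_atTop_of_neg hmE)).const_mul D).add_const _
    rw [mul_zero, zero_add] at hlim
    refine ge_of_tendsto hlim ?_
    filter_upwards [hDE, eventually_ge_atTop v] with v₂ h₂ hv₂
    have h1 := key hmneg.ne hv hv₂
    have h3 := norm_le_norm_add_norm_sub' ((rexp (m * v) : ℂ) * fourierCoeffAt g w κ n v)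
      (rexp (m * v₂) * fourierCoeffAt g w κ n v₂)
    rw [hnorm, hnorm] at h3
    have h4 : rexp (m * v₂) * ‖fourierCoeffAt g w κ n v₂‖ ≤ D * rexp ((m + E) * v₂) := by
      refine (mul_le_mul_of_nonneg_left (h₂ n) (exp_pos _).le).trans (le_of_eq ?_)
      rw [add_mul, exp_add]
      ring
    have h5 : C * ((rexp (m * v₂) - rexp (m * v)) / m) ≤ rexp (m * v) * (C / (-m)) := by
      have : 0 ≤ C / (-m) := div_nonneg hC (by linarith)
      have h6 : C * ((rexp (m * v₂) - rexp (m * v)) / m) =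
          rexp (m * v) * (C / (-m)) - rexp (m * v₂) * (C / (-m)) := by
        field_simp
        ring
      rw [h6]
      linarith [mul_nonneg (exp_pos (m * v₂)).le this]
    linarith
  · have hmpos : 0 < m := by
      have h1 : -κ < n := lt_of_le_of_lt (Int.le_ceil _) (by exact_mod_cast h)
      have : 0 < n + κ := by linarith
      positivity
    refine IsBigO.of_bound (‖(rexp (m * v₀) : ℂ) * fourierCoeffAt g w κ n v₀‖ + C / m)
      ((eventually_ge_atTop v₀).mono fun v hv => ?_)
    rw [norm_one, mul_one]
    refine le_of_mul_le_mul_left ?_ (exp_pos (m * v))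
    have h1 := key hmpos.ne' le_rfl hv
    have h3 := norm_le_norm_add_norm_sub ((rexp (m * v₀) : ℂ) * fourierCoeffAt g w κ n v₀)
      (rexp (m * v) * fourierCoeffAt g w κ n v)
    rw [hnorm v] at h3
    have h4 : C * ((rexp (m * v) - rexp (m * v₀)) / m) ≤ rexp (m * v) * (C / m) := by
      have : 0 ≤ C / m := by positivity
      have h6 : C * ((rexp (m * v) - rexp (m * v₀)) / m) =
          rexp (m * v) * (C / m) - rexp (m * v₀) * (C / m) := by ring
      rw [h6]
      linarith [mul_nonneg (exp_pos (m * v₀)).le this]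
    have h5 : 1 ≤ rexp (m * v) := one_le_exp (mul_nonneg hmpos.le (hv₀.le.trans hv))
    rw [mul_add]
    have h7 := mul_le_mul_of_nonneg_right h5
      (norm_nonneg ((rexp (m * v₀) : ℂ) * fourierCoeffAt g w κ n v₀))
    linarith

end

/-! ### Behaviour at the cusps -/

/-- The affine map `(A τ + B) / D` of the upper half-plane. -/
noncomputable def affine {A D : ℤ} (B : ℤ) (hA : 0 < A) (hD : 0 < D) (τ : ℍ) : ℍ :=
  ⟨(A * τ + B) / D, by
    have hA' : (0 : ℝ) < A := by exact_mod_cast hA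
    have hD' : (0 : ℝ) < D := by exact_mod_cast hD
    have : (((A : ℂ) * τ + B) / D).im = A * τ.im / D := by
      rw [show (D : ℂ) = ((D : ℝ) : ℂ) by push_cast; rfl, Complex.div_ofReal_im]
      simp
    rw [this]
    have := τ.im_pos
    positivity⟩

lemma coe_affine {A D : ℤ} (B : ℤ) (hA : 0 < A) (hD : 0 < D) (τ : ℍ) :
    (affine B hA hD τ : ℂ) = (A * τ + B) / D := rfl

lemma continuous_affine {A D : ℤ} (B : ℤ) (hA : 0 < A) (hD : 0 < D) :
    Continuous (affine B hA hD) := by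
  rw [UpperHalfPlane.isEmbedding_coe.continuous_iff]
  have : Continuous fun τ : ℍ => ((A * τ + B) / D : ℂ) :=
    ((continuous_const.mul UpperHalfPlane.continuous_coe).add continuous_const).div_const _
  exact this

lemma slash_half_eq (f : ℍ → ℂ) (γ : SL(2, ℤ)) (τ : ℍ) :
    slash (1 / 2) f γ τ = (sqrtAut γ τ)⁻¹ * f (γ • τ) := by
  rw [slash, sqrtAut, Complex.cpow_neg]

lemma not_isIntPair_smul {a b : ℝ} (γ : SL(2, ℤ)) (h : ¬ IsIntPair a b) :
    ¬ IsIntPair (a * γ 0 0 + b * γ 1 0) (a * γ 0 1 + b * γ 1 1) := mt (isIntPair_smul γ) h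

lemma exists_slash_muChar {a₁ b₁ a₂ b₂ : ℝ} (h₁ : ¬ IsIntPair a₁ b₁) (h₂ : ¬ IsIntPair a₂ b₂)
    (k : ℂ) {K : ℤ} (hK : 0 < K) (γ : SL(2, ℤ)) :
    ∃ (γ' : SL(2, ℤ)) (A B D : ℤ) (k' : ℂ), 0 < A ∧ 0 < D ∧ ∀ τ : ℍ,
      slash (1 / 2) (fun τ : ℍ => k * muChar a₁ b₁ a₂ b₂ (K * τ)) γ τ = k' *
        muChar (a₁ * γ' 0 0 + b₁ * γ' 1 0) (a₁ * γ' 0 1 + b₁ * γ' 1 1)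
          (a₂ * γ' 0 0 + b₂ * γ' 1 0) (a₂ * γ' 0 1 + b₂ * γ' 1 1) ((A * τ + B) / D) := by
  obtain ⟨γ', A, B, D, hA, hD, e1, e2, e3, e4⟩ := exists_upper_triangular γ hK
  have hD0 : (D : ℂ) ≠ 0 := by exact_mod_cast hD.ne'
  have e1' : (K : ℂ) * ((γ 0 0 : ℤ) : ℂ) = ((γ' 0 0 : ℤ) : ℂ) * A := by exact_mod_cast e1
  have e2' : (K : ℂ) * ((γ 0 1 : ℤ) : ℂ) = ((γ' 0 0 : ℤ) : ℂ) * B + ((γ' 0 1 : ℤ) : ℂ) * D := by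
    exact_mod_cast e2
  have e3' : ((γ 1 0 : ℤ) : ℂ) = ((γ' 1 0 : ℤ) : ℂ) * A := by exact_mod_cast e3
  have e4' : ((γ 1 1 : ℤ) : ℂ) = ((γ' 1 0 : ℤ) : ℂ) * B + ((γ' 1 1 : ℤ) : ℂ) * D := by
    exact_mod_cast e4
  have hj : ∀ τ : ℍ, autFactor γ τ = D * autFactor γ' (affine B hA hD τ) := by
    intro τ
    rw [autFactor, autFactor, e3', e4', coe_affine]
    field_simp
    ring
  have hsmul : ∀ τ : ℍ, (K : ℂ) * ((γ • τ : ℍ) : ℂ) = ((γ' • affine B hA hD τ : ℍ) : ℂ) := by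
    intro τ
    have h0 := autFactor_ne_zero γ' (affine B hA hD τ)
    rw [coe_smul_eq, coe_smul_eq, hj, ← mul_div_assoc, mul_add, ← mul_assoc, e1', e2', coe_affine]
    field_simp
    ring
  obtain ⟨c, -, hc⟩ := exists_muChar_smul γ' h₁ h₂
  obtain ⟨ε, hε, -, hs⟩ := eq_const_mul_of_sq_eq (f := sqrtAut γ)
    (g := fun τ => (√(D : ℝ) : ℂ) * sqrtAut γ' (affine B hA hD τ)) (continuous_sqrtAut γ)
    (continuous_const.mul ((continuous_sqrtAut γ').comp (continuous_affine B hA hD))) (fun τ => by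
      rw [mul_pow, sqrtAut_sq, sqrtAut_sq, hj, ← Complex.ofReal_pow, sq_sqrt
        (by exact_mod_cast hD.le)]
      push_cast
      rfl) (fun τ => mul_ne_zero (by
        rw [Complex.ofReal_ne_zero]; exact (sqrt_pos.2 (by exact_mod_cast hD)).ne')
        (sqrtAut_ne_zero _ _))
  have hD1 : (√(D : ℝ) : ℂ) ≠ 0 := by
    rw [Complex.ofReal_ne_zero]; exact (sqrt_pos.2 (by exact_mod_cast hD)).ne'
  have hε0 : ε ≠ 0 := by rintro rfl; simp at hε
  refine ⟨γ', A, B, D, k * c * (ε * √(D : ℝ))⁻¹, hA, hD, fun τ => ?_⟩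
  have h0 := sqrtAut_ne_zero γ' (affine B hA hD τ)
  rw [slash_half_eq, hs, hsmul, hc, coe_affine]
  field_simp

lemma im_affine {A B D : ℤ} (z : ℂ) : (((A : ℂ) * z + B) / D).im = (A / D : ℝ) * z.im := by
  rw [show (D : ℂ) = ((D : ℝ) : ℂ) by push_cast; rfl, Complex.div_ofReal_im]
  simp
  ring

lemma tendsto_affine_imAtTop {A D : ℤ} (B : ℤ) (hA : 0 < A) (hD : 0 < D) :
    Tendsto (fun z : ℂ => ((A : ℂ) * z + B) / D) imAtTop imAtTop := by
  have hA' : (0 : ℝ) < A := by exact_mod_cast hA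
  have hD' : (0 : ℝ) < D := by exact_mod_cast hD
  rw [imAtTop, tendsto_comap_iff]
  refine Tendsto.congr (f₁ := fun z : ℂ => (A / D : ℝ) * z.im) (fun z => (im_affine z).symm) ?_
  exact tendsto_im_imAtTop.const_mul_atTop (by positivity)

lemma ExpGrowth.comp_affine {f : ℂ → ℂ} (hf : ExpGrowth f) {A D : ℤ} (B : ℤ) (hA : 0 < A)
    (hD : 0 < D) : ExpGrowth fun z => f ((A * z + B) / D) := by
  obtain ⟨C, hC⟩ := hf
  refine ⟨C * (A / D : ℝ), (hC.comp_tendsto (tendsto_affine_imAtTop B hA hD)).congr_right fun z => ?_⟩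
  rw [Function.comp_apply, im_affine, mul_assoc]

lemma linearExponentialGrowth_of_expGrowth {g : ℍ → ℂ} {G : ℂ → ℂ} (hg : ∀ τ : ℍ, g τ = G τ)
    (hG : ExpGrowth G) : LinearExponentialGrowth g := by
  obtain ⟨C, hC⟩ := hG
  have h : Tendsto (fun τ : ℍ => (τ : ℂ)) UpperHalfPlane.atImInfty imAtTop := by
    rw [imAtTop, tendsto_comap_iff]
    exact tendsto_comap
  exact ⟨C, (hC.comp_tendsto h).congr_left fun τ => (hg τ).symm⟩

section

variable {a₁ b₁ a₂ b₂ : ℝ} {A D : ℤ} (B : ℤ) (k : ℂ)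

lemma contDiffOn_muChar_affine (h₁ : ¬ IsIntPair a₁ b₁) (h₂ : ¬ IsIntPair a₂ b₂) (hA : 0 < A)
    (hD : 0 < D) :
    ContDiffOn ℝ ∞ (fun z : ℂ => k * muChar a₁ b₁ a₂ b₂ ((A * z + B) / D)) {z : ℂ | 0 < z.im} := by
  have hA' : (0 : ℝ) < A := by exact_mod_cast hA
  have hD' : (0 : ℝ) < D := by exact_mod_cast hD
  refine contDiffOn_const.mul ((contDiffOn_muChar h₁ h₂).comp
    (f := fun z : ℂ => ((A : ℂ) * z + B) / D) (ContDiff.contDiffOn (by fun_prop)) fun z hz => ?_)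
  have hz' : 0 < z.im := hz
  have : 0 < (((A : ℂ) * z + B) / D).im := by
    rw [im_affine]
    positivity
  exact this

lemma antilinear_muChar_affine (h₁ : ¬ IsIntPair a₁ b₁) (h₂ : ¬ IsIntPair a₂ b₂) (hA : 0 < A)
    (hD : 0 < D) {z : ℂ} (hz : 0 < z.im) :
    fderiv ℝ (fun z : ℂ => k * muChar a₁ b₁ a₂ b₂ ((A * z + B) / D)) z 1 +
      Complex.I * fderiv ℝ (fun z : ℂ => k * muChar a₁ b₁ a₂ b₂ ((A * z + B) / D)) z Complex.I =
    k * (A / D) * ((√(2 * ((A * z + B) / D : ℂ).im) : ℂ)⁻¹ *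
      ∑' n, shadowTerm (a₁ - a₂) (b₁ - b₂) n ((A * z + B) / D)) := by
  have hA' : (0 : ℝ) < A := by exact_mod_cast hA
  have hD' : (0 : ℝ) < D := by exact_mod_cast hD
  have him : 0 < (((A : ℂ) * z + B) / D).im := by rw [im_affine]; positivity
  obtain ⟨L, hL, hL'⟩ := hasFDerivAt_muChar h₁ h₂ him
  have hd : HasDerivAt (fun z : ℂ => ((A : ℂ) * z + B) / D) ((A / D : ℝ) : ℂ) z := by
    have := ((((hasDerivAt_id z).const_mul (A : ℂ)).add_const (B : ℂ)).div_const (D : ℂ))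
    simpa using this
  have hall := (HasFDerivAt.comp (g := muChar a₁ b₁ a₂ b₂) z hL
    (hd.hasFDerivAt.restrictScalars ℝ)).const_mul k
  have hf : fderiv ℝ (fun z : ℂ => k * muChar a₁ b₁ a₂ b₂ ((A * z + B) / D)) z = _ := hall.fderiv
  rw [hf, ← hL']
  have hsm : ∀ x : ℂ, L (x * ((A / D : ℝ) : ℂ)) = (A / D : ℝ) * L x := fun x => by
    rw [mul_comm, ← Complex.real_smul, map_smul, Complex.real_smul]
  simp only [smul_apply, ContinuousLinearMap.comp_apply, ContinuousLinearMap.coe_restrictScalars',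
    ContinuousLinearMap.toSpanSingleton_apply, smul_eq_mul, hsm]
  push_cast
  ring

lemma finitelyManyGrowingTerms_muChar_affine (h₁ : ¬ IsIntPair a₁ b₁) (h₂ : ¬ IsIntPair a₂ b₂)
    (hA : 0 < A) (hD : 0 < D) {s : ℕ} (hs : 0 < s) (ha₁ : ∃ m : ℤ, a₁ * s = m)
    (ha₂ : ∃ m : ℤ, a₂ * s = m) {g : ℍ → ℂ}
    (hg : ∀ τ : ℍ, g τ = k * muChar a₁ b₁ a₂ b₂ ((A * τ + B) / D)) :
    FinitelyManyGrowingTerms g := by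
  have hD0 : (D : ℂ) ≠ 0 := by exact_mod_cast hD.ne'
  obtain ⟨C, hC, hb⟩ := exists_shadow_bound (a₁ - a₂) (b₁ - b₂)
  obtain ⟨c, hc, hper⟩ := exists_muChar_add_int (a₁ := a₁) (b₁ := b₁) (a₂ := a₂) (b₂ := b₂)
    (s := A * s) (by
      obtain ⟨m, hm⟩ := ha₁
      exact ⟨m * A, by push_cast; rw [← hm]; ring⟩) (by
      obtain ⟨m, hm⟩ := ha₂
      exact ⟨m * A, by push_cast; rw [← hm]; ring⟩)
  have hDn : ((D.toNat : ℕ) : ℂ) = D := by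
    rw [← Int.cast_natCast, Int.toNat_of_nonneg hD.le]
  refine finitelyManyGrowingTerms_of_bounded (w := s * D.toNat)
    (G := fun z => k * muChar a₁ b₁ a₂ b₂ ((A * z + B) / D)) hg
    (contDiffOn_muChar_affine B k h₁ h₂ hA hD) (Nat.mul_pos hs (by omega)) hc
    (fun z _ => ?_) (C := ‖k * (A / D)‖ * C) ?_
    ((expGrowth_const k).mul ((expGrowth_muChar h₁ h₂).comp_affine B hA hD))
  · rw [show ((A : ℂ) * (z + ((s * D.toNat : ℕ) : ℂ)) + B) / D = (A * z + B) / D + (A * s : ℤ) by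
      push_cast; rw [hDn]; field_simp; ring, hper]
    ring
  · filter_upwards [eventually_le_im 1,
      (tendsto_affine_imAtTop B hA hD).eventually (eventually_le_im 1)] with z hz hz'
    rw [antilinear_muChar_affine B k h₁ h₂ hA hD (by linarith), norm_mul]
    exact mul_le_mul_of_nonneg_left (hb _ hz') (norm_nonneg _)

end

/-- Growth and Fourier expansion of `muChar` at all cusps. -/
lemma cusps_muChar {a₁ b₁ a₂ b₂ : ℝ} (h₁ : ¬ IsIntPair a₁ b₁) (h₂ : ¬ IsIntPair a₂ b₂) {s : ℕ}
    (hs : 0 < s) (hs₁ : IsIntPair (a₁ * s) (b₁ * s)) (hs₂ : IsIntPair (a₂ * s) (b₂ * s)) (k : ℂ)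
    {K : ℤ} (hK : 0 < K) (γ : SL(2, ℤ)) :
    LinearExponentialGrowth (slash (1 / 2) (fun τ : ℍ => k * muChar a₁ b₁ a₂ b₂ (K * τ)) γ) ∧
    FinitelyManyGrowingTerms (slash (1 / 2) (fun τ : ℍ => k * muChar a₁ b₁ a₂ b₂ (K * τ)) γ) := by
  obtain ⟨γ', A, B, D, k', hA, hD, h⟩ := exists_slash_muChar h₁ h₂ k hK γ
  have hintegral : ∀ {a b : ℝ}, IsIntPair (a * s) (b * s) →
      ∃ m : ℤ, (a * γ' 0 0 + b * γ' 1 0) * s = m := by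
    rintro a b ⟨⟨m, hm⟩, n, hn⟩
    refine ⟨m * γ' 0 0 + n * γ' 1 0, ?_⟩
    push_cast
    rw [← hm, ← hn]
    ring
  exact ⟨linearExponentialGrowth_of_expGrowth h ((expGrowth_const k').mul
    ((expGrowth_muChar (not_isIntPair_smul γ' h₁) (not_isIntPair_smul γ' h₂)).comp_affine B hA hD)),
    finitelyManyGrowingTerms_muChar_affine B k' (not_isIntPair_smul γ' h₁)
      (not_isIntPair_smul γ' h₂) hA hD hs (hintegral hs₁) (hintegral hs₂) h⟩

/-! ### Modularity -/

/-- `K τ` as a point of the upper half-plane. -/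
noncomputable def scale {K : ℤ} (hK : 0 < K) (τ : ℍ) : ℍ :=
  ⟨K * τ, by
    have hK' : (0 : ℝ) < K := by exact_mod_cast hK
    have := τ.im_pos
    simp
    positivity⟩

lemma coe_scale {K : ℤ} (hK : 0 < K) (τ : ℍ) : (scale hK τ : ℂ) = K * τ := rfl

/-- The elliptic deformation `e^{-πiα²T - 2πiαz} μ̃(αT + z, -1/2; T)`, `T = K τ`. -/
noncomputable def muDeform (α : ℝ) (K : ℤ) (z : ℂ) (τ : ℍ) : ℂ :=
  Complex.exp (-(π * Complex.I * (α ^ 2 * (K * τ) + 2 * α * z))) *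
    muTilde (α * (K * τ) + z) (-1 / 2) (K * τ)

/-- The points where `muDeform` has no pole. -/
def DeformRegular (α : ℝ) (K : ℤ) (z : ℂ) (τ : ℍ) : Prop :=
  ¬ IsLatticePoint (K * τ) (α * (K * τ) + z)

lemma not_isIntPair_half : ¬ IsIntPair 0 (-1 / 2) := by
  rintro ⟨-, n, hn⟩
  have : (-1 : ℝ) = 2 * n := by linarith
  have : (-1 : ℤ) = 2 * n := by exact_mod_cast this
  omega

lemma not_isLatticePoint_half {τ : ℂ} (hτ : 0 < τ.im) : ¬ IsLatticePoint τ (-1 / 2) := by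
  have := mt (isLatticePoint_real_iff hτ 0 (-1 / 2)).1 not_isIntPair_half
  simpa using this

/-- The data that make `γ` act on the deformation: `diag(K, 1) γ diag(K, 1)⁻¹` is integral and fixes
the characteristics modulo integers. -/
structure FixesChar (α : ℝ) (K : ℤ) (γ : SL(2, ℤ)) (C k l m n : ℤ) : Prop where
  lower : γ 1 0 = K * C
  fst : α * (γ 0 0 - 1) = k
  snd : α * K * γ 0 1 = l
  trd : C = -2 * m
  fth : γ 1 1 - 1 = -2 * n

section

variable {α : ℝ} {K : ℤ} {γ : SL(2, ℤ)} {C k l m n : ℤ}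

/-- The conjugate of `γ` by `diag(K, 1)`. -/
def FixesChar.conj (h : FixesChar α K γ C k l m n) : SL(2, ℤ) :=
  ⟨!![γ 0 0, K * γ 0 1; C, γ 1 1], by
    have := γ.det_coe
    rw [Matrix.det_fin_two, h.lower] at this
    rw [Matrix.det_fin_two_of]
    linarith⟩

lemma FixesChar.autFactor_conj (h : FixesChar α K γ C k l m n) (hK : 0 < K) (τ : ℍ) :
    autFactor h.conj (scale hK τ) = autFactor γ τ := by
  rw [autFactor, autFactor, h.lower, coe_scale]
  simp [FixesChar.conj]
  ring

lemma FixesChar.sqrtAut_conj (h : FixesChar α K γ C k l m n) (hK : 0 < K) (τ : ℍ) :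
    sqrtAut h.conj (scale hK τ) = sqrtAut γ τ := by
  rw [sqrtAut, sqrtAut, h.autFactor_conj hK]

lemma FixesChar.conj_smul (h : FixesChar α K γ C k l m n) (hK : 0 < K) (τ : ℍ) :
    ((h.conj • scale hK τ : ℍ) : ℂ) = K * ((γ • τ : ℍ) : ℂ) := by
  rw [coe_smul_eq, coe_smul_eq, h.autFactor_conj hK, coe_scale]
  simp [FixesChar.conj]
  ring

lemma FixesChar.fst_eq (h : FixesChar α K γ C k l m n) (τ : ℍ) (z : ℂ) :
    (autFactor γ τ)⁻¹ * (α * (K * τ) + z + k * (K * τ) + l) =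
      α * (K * ((γ • τ : ℍ) : ℂ)) + (autFactor γ τ)⁻¹ * z := by
  have hj := autFactor_ne_zero γ τ
  have hk : (α : ℂ) * (((γ 0 0 : ℤ) : ℂ) - 1) = k := by exact_mod_cast congrArg Complex.ofReal h.fst
  have hl : (α : ℂ) * K * ((γ 0 1 : ℤ) : ℂ) = l := by exact_mod_cast congrArg Complex.ofReal h.snd
  rw [coe_smul_eq, ← hk, ← hl]
  field_simp
  ring

lemma FixesChar.snd_eq (h : FixesChar α K γ C k l m n) (τ : ℍ) :
    (autFactor γ τ)⁻¹ * (-1 / 2 + m * (K * τ) + n) = -1 / 2 := by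
  have hj := autFactor_ne_zero γ τ
  have hn : ((γ 1 1 : ℤ) : ℂ) - 1 = -2 * n := by exact_mod_cast h.fth
  have hm : ((γ 1 0 : ℤ) : ℂ) = K * (-2 * m) := by exact_mod_cast (h.trd ▸ h.lower)
  have e : (-1 / 2 + m * (K * τ) + n : ℂ) = -1 / 2 * autFactor γ τ := by
    rw [autFactor]
    linear_combination 1 / 2 * hn + τ / 2 * hm
  rw [e]
  field_simp

lemma FixesChar.regular (h : FixesChar α K γ C k l m n) (hK : 0 < K) {τ : ℍ} {z : ℂ}
    (hz : DeformRegular α K z τ) : DeformRegular α K ((autFactor γ τ)⁻¹ • z) (γ • τ) := by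
  rw [DeformRegular, smul_eq_mul, ← h.fst_eq, ← h.conj_smul hK, ← h.autFactor_conj hK,
    isLatticePoint_smul, coe_scale, isLatticePoint_add_int_iff]
  exact hz

lemma FixesChar.exists_transforms (h : FixesChar α K γ C k l m n) (hK : 0 < K) :
    ∃ ν : ℂ, ‖ν‖ = 1 ∧ TransformsWith (fun z : ℂ => z ^ 2 / K) (DeformRegular α K) (muDeform α K) γ ν := by
  obtain ⟨χ, hχ, ht⟩ := HarmonicMaass.exists_transforms h.conj
  set κ : ℝ := -(α ^ 2 * γ 0 0 * (K * γ 0 1) + α * (K * γ 0 1) * C + C * γ 1 1 / 4) +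
    (α * (γ 0 0 - 1) + C / 2) with hκ
  refine ⟨χ * ((-1) ^ (k + l + m + n) * Complex.exp (π * Complex.I * κ)), ?_, fun τ z hz => ?_⟩
  · rw [norm_mul, hχ, norm_mul, norm_zpow, norm_neg, norm_one, one_zpow, norm_exp_pi_I_real]
    norm_num
  have hT : 0 < ((K : ℂ) * τ).im := (scale hK τ).im_pos
  have hz' : ¬ IsLatticePoint (K * τ) (α * (K * τ) + z + k * (K * τ) + l) := by
    rw [isLatticePoint_add_int_iff]
    exact hz
  have hh : ¬ IsLatticePoint (K * τ) (-1 / 2 + m * (K * τ) + n) := by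
    rw [isLatticePoint_add_int_iff]
    exact not_isLatticePoint_half hT
  have key := ht (scale hK τ) (α * (K * τ) + z + k * (K * τ) + l, -1 / 2 + m * (K * τ) + n) ⟨hz', hh⟩
  simp only [Prod.smul_mk, smul_eq_mul, h.autFactor_conj hK, h.sqrtAut_conj hK, h.conj_smul hK,
    h.fst_eq, h.snd_eq] at key
  rw [muDeform, muDeform, smul_eq_mul, key, coe_scale,
    muTilde_add_lattice hT hz (not_isLatticePoint_half hT)]
  have hc : ((h.conj 1 0 : ℤ) : ℂ) = C := by simp [FixesChar.conj]
  have hexp : Complex.exp (-(π * Complex.I * (α ^ 2 * (K * ((γ • τ : ℍ) : ℂ)) +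
      2 * α * ((autFactor γ τ)⁻¹ * z)))) *
      Complex.exp (-(π * Complex.I * ((h.conj 1 0 : ℤ) : ℂ) * (α * (K * τ) + z + k * (K * τ) + l -
        (-1 / 2 + m * (K * τ) + n)) ^ 2 / autFactor γ τ)) *
      Complex.exp (π * Complex.I * ((k - m) ^ 2 * (K * τ) + 2 * (k - m) * (α * (K * τ) + z - -1 / 2))) =
      Complex.exp (π * Complex.I * κ) *
      Complex.exp (-(π * Complex.I * ((γ 1 0 : ℤ) : ℂ) * (z ^ 2 / K) / autFactor γ τ)) *
      Complex.exp (-(π * Complex.I * (α ^ 2 * (K * τ) + 2 * α * z))) := by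
    have hK0 : (K : ℂ) ≠ 0 := by exact_mod_cast hK.ne'
    have hj := autFactor_ne_zero γ τ
    have hd := det_eq γ
    have hk : (α : ℂ) * (((γ 0 0 : ℤ) : ℂ) - 1) = k := by
      exact_mod_cast congrArg Complex.ofReal h.fst
    have hl : (α : ℂ) * K * ((γ 0 1 : ℤ) : ℂ) = l := by exact_mod_cast congrArg Complex.ofReal h.snd
    have hn : ((γ 1 1 : ℤ) : ℂ) - 1 = -2 * n := by exact_mod_cast h.fth
    have hm : (C : ℂ) = -2 * m := by exact_mod_cast h.trd
    have hlow : ((γ 1 0 : ℤ) : ℂ) = K * C := by exact_mod_cast h.lower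
    have hn' : (n : ℂ) = -(((γ 1 1 : ℤ) : ℂ) - 1) / 2 := by rw [hn]; ring
    have hm' : (m : ℂ) = -C / 2 := by rw [hm]; ring
    rw [← Complex.exp_add, ← Complex.exp_add, ← Complex.exp_add, ← Complex.exp_add]
    congr 1
    rw [coe_smul_eq, hκ, hc, ← hk, ← hl, hn', hm', hlow]
    push_cast
    rw [hlow] at hd
    generalize ((γ 0 0 : ℤ) : ℂ) = a at *
    generalize ((γ 0 1 : ℤ) : ℂ) = b at *
    have hJ : autFactor γ τ = C * (K * τ) + ((γ 1 1 : ℤ) : ℂ) := by rw [autFactor, hlow]; ring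
    generalize ((γ 1 1 : ℤ) : ℂ) = d at *
    generalize hTK : (K : ℂ) * τ = T at *
    field_simp
    rw [hJ]
    linear_combination (16 * (α ^ 2 * (a * T + K * b) + 2 * α * z) : ℂ) * hd -
      (16 * α ^ 2 * a : ℂ) * hTK
  linear_combination (χ * sqrtAut γ τ * (-1) ^ (k + l + m + n) *
    muTilde (α * (K * τ) + z) (-1 / 2) (K * τ)) * hexp

end

lemma exists_muDeform_ne_zero (α : ℝ) {K : ℤ} (hK : 0 < K) (τ : ℍ) :
    ∃ z, DeformRegular α K z τ ∧ muDeform α K z τ ≠ 0 := by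
  have hT : 0 < ((K : ℂ) * τ).im := (scale hK τ).im_pos
  have hlim := tendsto_mul_muTilde (-1 / 2) hT
  have hne := hlim.eventually_ne (div_ne_zero (neg_ne_zero.2 (inv_ne_zero Complex.two_pi_I_ne_zero))
    (theta_ne_zero hT (not_isLatticePoint_half hT)))
  have hlat : ∀ᶠ u in 𝓝[≠] (0 : ℂ), ¬ IsLatticePoint (K * τ) u := by
    filter_upwards [nhdsWithin_le_nhds (eventually_lattice_eq_zero hT), self_mem_nhdsWithin]
      with u h1 h2 h3
    exact h2 (h1 h3)
  obtain ⟨u, hu, hl⟩ := (hne.and hlat).exists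
  refine ⟨u - α * (K * τ), ?_, ?_⟩
  · rw [DeformRegular, add_sub_cancel]
    exact hl
  · rw [muDeform, add_sub_cancel]
    exact mul_ne_zero (Complex.exp_ne_zero _) (right_ne_zero_of_mul hu)

/-! ### The functions `F_{h,t,N}` -/

/-- The theta series `∑ (Mn + h) e^{2πi(Mn + h)²z}`. -/
noncomputable def progressionTheta (h M : ℕ) (z : ℂ) : ℂ :=
  ∑' n : ℤ, ((M : ℂ) * n + h) * Complex.exp (2 * π * Complex.I * ((M : ℂ) * n + h) ^ 2 * z)

lemma norm_progressionTheta_term (h M : ℕ) (n : ℤ) (z : ℂ) :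
    ‖((M : ℂ) * n + h) * Complex.exp (2 * π * Complex.I * ((M : ℂ) * n + h) ^ 2 * z)‖ =
      |(M : ℝ) * n + h| * rexp (-2 * π * ((M : ℝ) * n + h) ^ 2 * z.im) := by
  rw [norm_mul, Complex.norm_exp]
  congr 1
  · rw [← Real.norm_eq_abs, ← Complex.norm_real]; push_cast; rfl
  · rw [show 2 * (π : ℂ) * Complex.I * ((M : ℂ) * n + h) ^ 2 * z =
      ((2 * π * ((M : ℝ) * n + h) ^ 2 : ℝ) : ℂ) * (z * Complex.I) by push_cast; ring,
      Complex.re_ofReal_mul, Complex.mul_I_re]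
    congr 1
    ring

lemma summable_progressionTheta_bound {M : ℕ} (hM : 0 < M) (h : ℕ) {c : ℝ} (hc : 0 < c) :
    Summable fun n : ℤ => |(M : ℝ) * n + h| * rexp (-2 * π * ((M : ℝ) * n + h) ^ 2 * c) := by
  have hM' : (0 : ℝ) < M := by exact_mod_cast hM
  have hs := (summable_shadowTerm (h / M - 1 / 2) 0
    (τ := ((2 * M ^ 2 * c : ℝ) : ℂ) * Complex.I) (by
      rw [Complex.im_ofReal_mul, Complex.I_im, mul_one]; positivity)).norm.mul_left (M : ℝ)
  refine hs.congr fun n => ?_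
  rw [norm_shadowTerm]
  have e : (n : ℝ) + 1 / 2 + (h / M - 1 / 2) = (M * n + h) / M := by field_simp; ring
  rw [e, abs_div, abs_of_pos hM', ← mul_assoc, mul_div_cancel₀ _ hM'.ne']
  congr 2
  simp only [Complex.im_ofReal_mul, Complex.I_im, mul_one]
  field_simp

lemma differentiableAt_progressionTheta {M : ℕ} (hM : 0 < M) (h : ℕ) {z : ℂ} (hz : 0 < z.im) :
    DifferentiableAt ℂ (progressionTheta h M) z := by
  have hopen : IsOpen {x : ℂ | z.im / 2 < x.im} := isOpen_lt continuous_const Complex.continuous_im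
  refine (Complex.differentiableOn_tsum_of_summable_norm
    (summable_progressionTheta_bound hM h (half_pos hz)) (fun n => ?_) hopen
    (fun n x hx => ?_)).differentiableAt (hopen.mem_nhds (by
      have : z.im / 2 < z.im := half_lt_self hz
      exact this))
  · exact Differentiable.differentiableOn (by fun_prop)
  · rw [norm_progressionTheta_term]
    refine mul_le_mul_of_nonneg_left ?_ (abs_nonneg _)
    rw [exp_le_exp]
    have hx' : z.im / 2 < x.im := hx
    have : 0 ≤ 2 * π * ((M : ℝ) * n + h) ^ 2 := by positivity
    nlinarith

/-- The integers in a residue class. -/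
noncomputable def residueClassEquiv {M : ℕ} (hM : 0 < M) (h : ℕ) :
    ℤ ≃ {r : ℤ // r ≡ (h : ℤ) [ZMOD (M : ℤ)]} :=
  Equiv.ofBijective (fun n => ⟨M * n + h, by simp [Int.ModEq]⟩) (by
    have hM' : (M : ℤ) ≠ 0 := by exact_mod_cast hM.ne'
    constructor
    · intro n n' hn
      have := congrArg Subtype.val hn
      exact mul_left_cancel₀ hM' (add_right_cancel this)
    · rintro ⟨r, hr⟩
      obtain ⟨n, hn⟩ := hr.symm.dvd
      exact ⟨n, Subtype.ext (by simp only; linarith)⟩)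

lemma coe_residueClassEquiv {M : ℕ} (hM : 0 < M) (h : ℕ) (n : ℤ) :
    (residueClassEquiv hM h n : ℤ) = M * n + h := rfl

lemma unaryTheta_div {h t N M : ℕ} (hM : 0 < M) (ht : 0 < t) (hN : 2 * N = t * M) (τ : ℂ) :
    unaryTheta h t N (τ / t) = progressionTheta h M τ := by
  have hdiv : 2 * N / t = M := by rw [hN, Nat.mul_div_cancel_left _ ht]
  have ht' : (t : ℂ) ≠ 0 := by exact_mod_cast ht.ne'
  rw [unaryTheta, progressionTheta, hdiv, ← (residueClassEquiv hM h).tsum_eq]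
  refine tsum_congr fun n => ?_
  rw [coe_residueClassEquiv]
  push_cast
  congr 2
  field_simp

lemma dbar_eq {f : ℍ → ℂ} {G : ℂ → ℂ} (hf : ∀ τ : ℍ, f τ = G τ) (τ : ℍ) : dbar f τ =
    (fderiv ℝ G τ 1 + Complex.I * fderiv ℝ G τ Complex.I) / 2 := by
  have h : (fun z : ℂ => f (UpperHalfPlane.ofComplex z)) =ᶠ[𝓝 (τ : ℂ)] G := by
    filter_upwards [isOpen_im_pos.mem_nhds τ.im_pos] with z hz
    rw [hf, UpperHalfPlane.ofComplex_apply_of_im_pos hz]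
  rw [dbar, h.fderiv_eq]

lemma dbar_eq_zero {f : ℍ → ℂ} {G : ℂ → ℂ} (hf : ∀ τ : ℍ, f τ = G τ) {τ : ℍ}
    (hG : DifferentiableAt ℂ G τ) : dbar f τ = 0 := by
  rw [dbar_eq hf, (hG.hasDerivAt.hasFDerivAt.restrictScalars ℝ).fderiv]
  simp only [ContinuousLinearMap.coe_restrictScalars', ContinuousLinearMap.toSpanSingleton_apply,
    smul_eq_mul]
  linear_combination (deriv G τ / 2) * Complex.I_sq

lemma F_eq {h t N M : ℕ} (hM : 0 < M) (ht : 0 < t) (hN : 2 * N = t * M) (τ : ℍ) : F h t N τ =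
    -1 * muChar (h / M - 1 / 2) 0 0 (-1 / 2) ((2 * M ^ 2 : ℤ) * τ) := by
  have ht' : (t : ℂ) ≠ 0 := by exact_mod_cast ht.ne'
  have hM' : (M : ℂ) ≠ 0 := by exact_mod_cast hM.ne'
  have hN' : (N : ℂ) = t * M / 2 := by
    have : (2 * N : ℂ) = t * M := by exact_mod_cast hN
    rw [← this]; ring
  have e1 : 8 * (N : ℂ) ^ 2 * (τ : ℂ) / (t : ℂ) ^ 2 = (2 * M ^ 2 : ℤ) * τ := by
    rw [hN']; push_cast; field_simp; ring
  have e2 : ((h : ℂ) * t - N) / (2 * N) = h / M - 1 / 2 := by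
    rw [hN']; field_simp
  have e3 : -2 * (π : ℂ) * Complex.I * ((h : ℂ) - (N : ℂ) / (t : ℂ)) ^ 2 * (τ : ℂ) =
      -(π * Complex.I * ((h : ℂ) / M - 1 / 2) ^ 2 * ((2 * M ^ 2 : ℤ) * τ)) := by
    rw [hN']; push_cast; field_simp
  rw [F, muChar, e1, e2, e3]
  push_cast
  simp only [sub_zero, add_zero, zero_mul, zero_add]
  ring

lemma conj_shadowTerm_half {M : ℕ} (hM : 0 < M) (h : ℕ) (n : ℤ) (τ : ℂ) :
    (starRingEnd ℂ) (shadowTerm (h / M - 1 / 2 - 0) (0 - -1 / 2) n (2 * M ^ 2 * τ)) =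
      Complex.I / M * (((M : ℂ) * n + h) *
        Complex.exp (2 * π * Complex.I * ((M : ℂ) * n + h) ^ 2 * τ)) := by
  have hM' : (M : ℂ) ≠ 0 := by exact_mod_cast hM.ne'
  have e : (n : ℂ) + 1 / 2 + ((h / M - 1 / 2 - 0 : ℝ) : ℂ) = (M * n + h) / M := by
    push_cast; field_simp; ring
  have e2 : Complex.exp (-(2 * π * Complex.I * ((0 - -1 / 2 : ℝ) : ℂ) * ((n : ℂ) + 1 / 2))) =
      (-1) ^ n * -Complex.I := by
    rw [show -(2 * π * Complex.I * ((0 - -1 / 2 : ℝ) : ℂ) * ((n : ℂ) + 1 / 2)) =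
      π * Complex.I * (-n : ℤ) + -(π * Complex.I * (1 / 2)) by push_cast; ring, Complex.exp_add,
      exp_pi_I_int, exp_neg_pi_I_half, zpow_neg, ← inv_zpow]
    norm_num
  rw [shadowTerm, e, e2, ← mul_assoc ((-1 : ℂ) ^ n), neg_one_zpow_sq]
  simp only [map_mul, ← Complex.exp_conj, map_neg, map_pow, map_div₀, map_add, Complex.conj_ofReal,
    Complex.conj_I, Complex.conj_conj, map_natCast, map_intCast, map_one, map_ofNat]
  rw [show -((π : ℂ) * -Complex.I * ((M * n + h) / M) ^ 2 * (2 * M ^ 2 * τ)) =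
    2 * π * Complex.I * ((M : ℂ) * n + h) ^ 2 * τ by field_simp]
  ring

lemma xi_F {h t N M : ℕ} (hM : 0 < M) (ht : 0 < t) (hN : 2 * N = t * M)
    (hα : ¬ IsIntPair (h / M - 1 / 2) 0) (τ : ℍ) :
    xi (1 / 2) (F h t N) τ = progressionTheta h M τ := by
  have hM' : (M : ℂ) ≠ 0 := by exact_mod_cast hM.ne'
  have hMr : (0 : ℝ) < M := by exact_mod_cast hM
  have hK : (0 : ℤ) < 2 * M ^ 2 := by positivity
  have hG : ∀ τ : ℍ, F h t N τ = -1 * muChar (h / M - 1 / 2) 0 0 (-1 / 2)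
      (((2 * M ^ 2 : ℤ) * (τ : ℂ) + (0 : ℤ)) / (1 : ℤ)) := by
    intro τ
    rw [F_eq hM ht hN]
    simp
  have hb := antilinear_muChar_affine 0 (-1) hα not_isIntPair_half hK one_pos τ.im_pos
  rw [xi, dbar_eq (G := fun z : ℂ => -1 * muChar (h / M - 1 / 2) 0 0 (-1 / 2)
      (((2 * M ^ 2 : ℤ) * z + (0 : ℤ)) / (1 : ℤ))) hG, hb]
  have eT : (((2 * M ^ 2 : ℤ) : ℂ) * (τ : ℂ) + ((0 : ℤ) : ℂ)) / ((1 : ℤ) : ℂ) = 2 * M ^ 2 * τ := by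
    push_cast; ring
  have hs : √(2 * (2 * M ^ 2 * τ : ℂ).im) = 2 * M * √τ.im := by
    have : (2 * M ^ 2 * τ : ℂ).im = 2 * M ^ 2 * τ.im := by
      rw [show (2 * M ^ 2 * τ : ℂ) = ((2 * M ^ 2 : ℝ) : ℂ) * τ by push_cast; ring,
        Complex.im_ofReal_mul]
      rfl
    rw [this, show 2 * (2 * (M : ℝ) ^ 2 * τ.im) = (2 * M) ^ 2 * τ.im by ring,
      sqrt_mul (by positivity), sqrt_sq (by positivity)]
  have hv : (√τ.im : ℂ) ≠ 0 := by
    rw [Complex.ofReal_ne_zero]; exact (sqrt_pos.2 τ.im_pos).ne'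
  rw [eT, hs, ← sqrt_eq_rpow]
  simp only [map_mul, map_div₀, map_inv₀, map_neg, map_one, Complex.conj_ofReal, map_ofNat,
    map_intCast, Complex.conj_tsum, conj_shadowTerm_half hM, tsum_mul_left]
  rw [← progressionTheta]
  push_cast
  field_simp
  linear_combination -progressionTheta h M τ * Complex.I_sq

lemma exists_fixesChar {M : ℕ} (hM : 0 < M) (h : ℕ) {γ : SL(2, ℤ)} (h00 : (2 * M : ℤ) ∣ γ 0 0 - 1)
    (h11 : (2 * M : ℤ) ∣ γ 1 1 - 1) (h10 : (4 * M ^ 2 : ℤ) ∣ γ 1 0) :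
    ∃ C k l m n : ℤ, FixesChar (h / M - 1 / 2) (2 * M ^ 2) γ C k l m n := by
  have hMr : (M : ℝ) ≠ 0 := by exact_mod_cast hM.ne'
  obtain ⟨p, hp⟩ := h00
  obtain ⟨q, hq⟩ := h11
  obtain ⟨c, hc⟩ := h10
  refine ⟨2 * c, (2 * h - M) * p, (2 * h - M) * M * γ 0 1, -c, -(M * q), ?_, ?_, ?_, by ring, ?_⟩
  · rw [hc]; ring
  · have : ((γ 0 0 : ℤ) : ℝ) - 1 = 2 * M * p := by exact_mod_cast hp
    rw [this]
    push_cast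
    field_simp
  · push_cast
    field_simp
  · rw [hq]; ring

lemma levelGroup_dvd {t N M : ℕ} (ht : 0 < t) (hN : 2 * N = t * M) {γ : SL(2, ℤ)}
    (hγ : γ ∈ levelGroup t N) : (2 * M : ℤ) ∣ γ 0 0 - 1 ∧ (2 * M : ℤ) ∣ γ 1 1 - 1 ∧
      (4 * M ^ 2 : ℤ) ∣ γ 1 0 := by
  have e1 : 4 * N / t = 2 * M := by
    rw [show 4 * N = t * (2 * M) by linarith, Nat.mul_div_cancel_left _ ht]
  have e2 : 16 * N ^ 2 / t ^ 2 = 4 * M ^ 2 := by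
    rw [show 16 * N ^ 2 = t ^ 2 * (4 * M ^ 2) by
      rw [show 16 * N ^ 2 = 4 * (2 * N) ^ 2 by ring, hN]; ring,
      Nat.mul_div_cancel_left _ (by positivity)]
  rw [levelGroup, e1, e2, Subgroup.mem_inf, CongruenceSubgroup.Gamma1_mem,
    CongruenceSubgroup.Gamma0_mem] at hγ
  obtain ⟨⟨h1, h2, -⟩, h3⟩ := hγ
  have key : ∀ a : ℤ, ((a : ℤ) : ZMod (2 * M)) = 1 → (2 * M : ℤ) ∣ a - 1 := fun a ha => by
    have := (ZMod.intCast_zmod_eq_zero_iff_dvd (a - 1) (2 * M)).1 (by push_cast; rw [ha, sub_self])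
    exact_mod_cast this
  refine ⟨key _ h1, key _ h2, ?_⟩
  have := (ZMod.intCast_zmod_eq_zero_iff_dvd (γ 1 0) (4 * M ^ 2)).1 h3
  exact_mod_cast this

lemma not_isIntPair_char {h t N M : ℕ} (hM : 0 < M) (hN : 2 * N = t * M)
    (hpole : ¬ ((2 * N : ℤ) ∣ (h : ℤ) * (t : ℤ) - (N : ℤ))) : ¬ IsIntPair (h / M - 1 / 2) 0 := by
  rintro ⟨⟨m, hm⟩, -⟩
  have hMr : (M : ℝ) ≠ 0 := by exact_mod_cast hM.ne'
  refine hpole ⟨m, ?_⟩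
  have h1 : (2 * N : ℝ) = t * M := by exact_mod_cast hN
  have h2 : (h : ℝ) * t - N = 2 * N * m := by
    rw [← hm, h1]
    have : (N : ℝ) = t * M / 2 := by linarith
    rw [this]
    field_simp
  exact_mod_cast h2

lemma F_eq_muDeform {h t N M : ℕ} (hM : 0 < M) (ht : 0 < t) (hN : 2 * N = t * M) (τ : ℍ) :
    F h t N τ = -muDeform (h / M - 1 / 2) (2 * M ^ 2) 0 τ := by
  rw [F_eq hM ht hN, muChar, muDeform]
  push_cast
  simp only [mul_zero, add_zero, sub_zero, zero_mul, zero_add]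
  ring_nf

/-- `F_{h,t,N}` transforms with a multiplier system of weight `1/2`. -/
lemma exists_multiplierSystem {h t N M : ℕ} (hM : 0 < M) (ht : 0 < t) (hN : 2 * N = t * M)
    (hα : ¬ IsIntPair (h / M - 1 / 2) 0) : ∃ ν : levelGroup t N → ℂ,
      IsMultiplierSystem (1 / 2) (levelGroup t N) ν ∧
      ∀ (γ : levelGroup t N) (τ : ℍ), (ν γ)⁻¹ * slash (1 / 2) (F h t N) (γ : SL(2, ℤ)) τ = F h t N τ := by
  have hK : (0 : ℤ) < 2 * M ^ 2 := by positivity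
  have hex : ∀ γ : levelGroup t N, ∃ ν : ℂ, ‖ν‖ = 1 ∧
      TransformsWith (fun z : ℂ => z ^ 2 / ((2 * M ^ 2 : ℤ) : ℂ))
        (DeformRegular (h / M - 1 / 2) (2 * M ^ 2)) (muDeform (h / M - 1 / 2) (2 * M ^ 2)) γ ν := by
    intro γ
    obtain ⟨h1, h2, h3⟩ := levelGroup_dvd ht hN γ.2
    obtain ⟨C, k, l, m, n, hf⟩ := exists_fixesChar hM h h1 h2 h3
    exact hf.exists_transforms hK
  choose ν hν htr using hex
  refine ⟨ν, ⟨hν, fun γ₁ γ₂ τ => ?_⟩, fun γ τ => ?_⟩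
  · refine cocycle_of_transforms (fun c x => ?_) (fun τ x hx => ?_) (htr γ₁) (htr γ₂)
      (htr (γ₁ * γ₂)) (exists_muDeform_ne_zero _ hK τ)
    · rw [smul_eq_mul]; ring
    · obtain ⟨h1, h2, h3⟩ := levelGroup_dvd ht hN γ₂.2
      obtain ⟨C, k, l, m, n, hf⟩ := exists_fixesChar hM h h1 h2 h3
      exact hf.regular hK hx
  · have hT : 0 < (((2 * M ^ 2 : ℤ) : ℂ) * τ).im := (scale hK τ).im_pos
    have hreg : DeformRegular (h / M - 1 / 2) (2 * M ^ 2) 0 τ := by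
      have := mt (isLatticePoint_real_iff hT (h / M - 1 / 2) 0).1 hα
      rwa [Complex.ofReal_zero] at this
    have key := htr γ τ 0 hreg
    rw [smul_zero] at key
    have hν0 : ν γ ≠ 0 := by
      intro h0
      have := hν γ
      rw [h0, norm_zero] at this
      exact zero_ne_one this
    have hs := sqrtAut_ne_zero (γ : SL(2, ℤ)) τ
    rw [slash_half_eq, F_eq_muDeform hM ht hN, F_eq_muDeform hM ht hN, key]
    simp
    field_simp

/-- `F_{h,t,N}` is a harmonic Maass form. -/
lemma isHarmonicMaassForm_F {h t N M : ℕ} (hM : 0 < M) (ht : 0 < t) (hN : 2 * N = t * M)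
    (hα : ¬ IsIntPair (h / M - 1 / 2) 0) {ν : levelGroup t N → ℂ}
    (hν : ∀ (γ : levelGroup t N) (τ : ℍ),
      (ν γ)⁻¹ * slash (1 / 2) (F h t N) (γ : SL(2, ℤ)) τ = F h t N τ) :
    IsHarmonicMaassForm (1 / 2) (levelGroup t N) ν (F h t N) := by
  have hK : (0 : ℤ) < 2 * M ^ 2 := by positivity
  have hM' : (M : ℝ) ≠ 0 := by exact_mod_cast hM.ne'
  have hF : F h t N = fun τ : ℍ => -1 * muChar (h / M - 1 / 2) 0 0 (-1 / 2) ((2 * M ^ 2 : ℤ) * τ) :=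
    funext fun τ => F_eq hM ht hN τ
  have hcusp := cusps_muChar hα not_isIntPair_half (s := 2 * M) (by positivity)
    ⟨⟨2 * h - M, by push_cast; field_simp⟩, 0, by simp⟩
    ⟨⟨0, by simp⟩, -M, by push_cast; ring⟩ (-1) hK
  refine ⟨?_, fun τ => ?_, hν, fun γ => ?_, fun γ => ?_⟩
  · refine (contDiffOn_muChar_affine 0 (-1) hα not_isIntPair_half hK one_pos).congr fun z hz => ?_
    rw [F_eq hM ht hN, UpperHalfPlane.ofComplex_apply_of_im_pos hz]
    simp
  · rw [laplacian, xi, dbar_eq_zero (G := progressionTheta h M)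
      (fun τ => xi_F hM ht hN hα τ)
      (differentiableAt_progressionTheta hM h τ.im_pos)]
    simp
  · rw [hF]
    exact (hcusp γ).1
  · rw [hF]
    exact (hcusp γ).2

end HarmonicMaass

theorem theorem3p3 (h t N : ℕ) (hN : 0 < N) (ht : t ∣ 2 * N)
    (hpole : ¬ ((2 * N : ℤ) ∣ (h : ℤ) * (t : ℤ) - (N : ℤ))) :
    (∃ ν : HarmonicMaass.levelGroup t N → ℂ,
      HarmonicMaass.IsMultiplierSystem (1 / 2) (HarmonicMaass.levelGroup t N) ν ∧
      HarmonicMaass.IsHarmonicMaassForm (1 / 2) (HarmonicMaass.levelGroup t N) ν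
        (HarmonicMaass.F h t N)) ∧
    ∀ τ : UpperHalfPlane,
      HarmonicMaass.xi (1 / 2) (HarmonicMaass.F h t N) τ =
        HarmonicMaass.unaryTheta h t N ((τ : ℂ) / (t : ℂ)) := by
  obtain ⟨M, hM⟩ := ht
  have ht0 : 0 < t := Nat.pos_of_ne_zero fun h0 => by simp [h0] at hM; omega
  have hM0 : 0 < M := Nat.pos_of_ne_zero fun h0 => by simp [h0] at hM; omega
  have hα := HarmonicMaass.not_isIntPair_char hM0 hM hpole
  obtain ⟨ν, hν, hmod⟩ := HarmonicMaass.exists_multiplierSystem hM0 ht0 hM hα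
  refine ⟨⟨ν, hν, HarmonicMaass.isHarmonicMaassForm_F hM0 ht0 hM hα hmod⟩, fun τ => ?_⟩
  rw [HarmonicMaass.unaryTheta_div hM0 ht0 hM,
    HarmonicMaass.xi_F hM0 ht0 hM hα]
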